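/- All simplicial complexes are finite and abstract. A triangulation of $S^n$ is a complex whose geometric realization is homeomorphic to $S^n$; a complex is flag if any set of pairwise adjacent vertices is a simplex; a square in $T$ is a full subcomplex with four vertices that is homeomorphic to $S^1$; and $\gamma_2(T)=f_3-2f_2+4f_1-8f_0+16$, where $f_i$ is the number of $i$-simplices of $T$. Let $T_{12}$ be the flag complex with vertices $a_i$ ($i\in\mathbb Z/9$) and $b_r$ ($r\in\mathbb Z/3$) in which $a_i,a_j$ are adjacent iff $i-j\in\{\pm1,\pm2,\pm3\}$, $a_i,b_r$ are adjacent iff $i\not\equiv r \pmod 3$, and $b_r,b_s$ are never adjacent. For a vertex $v$ of a flag complex $T$, let $D(T,v)$ be the complex obtained by gluing two copies of $T$ with the open star of $v$ removed along the link of $v$. Proposition. Call $(T_n)_{n\ge0}$ a doubling sequence if $T_0\cong T_{12}$ and, for every $n$, $T_{n+1}\cong D(T_n,v_n)$ for some vertex $v_n$ of $T_n$. Doubling sequences exist, and for every doubling sequence: each $T_n$ is a flag triangulation of $S^3$ with $\gamma_2(T_n)>0$ in which every edge is contained in a square; $\gamma_2(T_{n+1})=2\gamma_2(T_n)$ for all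 $n$; and the $T_n$ are pairwise nonisomorphic. In particular, there are infinitely many pairwise nonisomorphic flag triangulations of $S^3$ with $\gamma_2>0$ in which every edge is contained in a square. -/

import Mathlib

namespace SphereComplex

/-- The geometric realization of a simplicial complex with finite vertex set `V`: the points of
`ℝ^V`, in barycentric coordinates, whose support is a face. -/
def realization {V : Type} (K : AbstractSimplicialComplex V) : Set (V → ℝ) :=
  {x | (∀ v, 0 ≤ x v) ∧
    ∃ s ∈ K.faces, Function.support x = (s : Set V) ∧ ∑ v ∈ s, x v = 1}

/-- `K` is a triangulation of the sphere `S^n`: its geometric realization is homeomorphic to the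
unit sphere of `ℝ^(n+1)`. -/
def IsTriangulationOfSphere (n : ℕ) {V : Type} (K : AbstractSimplicialComplex V) : Prop :=
  Nonempty (realization K ≃ₜ Metric.sphere (0 : EuclideanSpace ℝ (Fin (n + 1))) 1)

/-- The 1-skeleton of a simplicial complex. -/
def skeleton {V : Type} (K : AbstractSimplicialComplex V) : SimpleGraph V where
  Adj x y := x ≠ y ∧ ∃ s ∈ K.faces, (s : Set V) = {x, y}
  symm := ⟨fun x y h => ⟨h.1.symm, by simpa [Set.pair_comm] using h.2⟩⟩
  loopless := ⟨fun _ h => h.1 rfl⟩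

/-- `K` is flag: pairwise adjacent vertices span a face. (As in Mathlib, the empty face is left
implicit.) -/
def IsFlag {V : Type} (K : AbstractSimplicialComplex V) : Prop :=
  ∀ s : Finset V, s.Nonempty → (skeleton K).IsClique (s : Set V) → s ∈ K.faces

/-- The full subcomplex of `K` with vertex set `W`. -/
def fullSubcomplex {V : Type} (K : AbstractSimplicialComplex V) (W : Set V) :
    AbstractSimplicialComplex W where
  faces := {s | s.map (Function.Embedding.subtype _) ∈ K.faces}
  isRelLowerSet_faces := by
    intro s hs
    refine ⟨Finset.map_nonempty.1 (K.isRelLowerSet_faces hs).1, fun t hts ht => ?_⟩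
    exact (K.isRelLowerSet_faces hs).2 (Finset.map_subset_map.2 hts) (Finset.map_nonempty.2 ht)
  singleton_mem v := by simpa using K.singleton_mem (v : V)

/-- `W` is the vertex set of a square of `K`: a full subcomplex with four vertices that is
homeomorphic to `S^1`. -/
def IsSquare {V : Type} (K : AbstractSimplicialComplex V) (W : Set V) : Prop :=
  W.ncard = 4 ∧ IsTriangulationOfSphere 1 (fullSubcomplex K W)

/-- Every edge of `K` is contained in a square. -/
def EveryEdgeInSquare {V : Type} (K : AbstractSimplicialComplex V) : Prop :=
  ∀ x y, (skeleton K).Adj x y → ∃ W : Set V, IsSquare K W ∧ x ∈ W ∧ y ∈ W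

/-- `faceCount K i` is the number `f_i` of `i`-dimensional simplices of `K`. -/
noncomputable def faceCount {V : Type} (K : AbstractSimplicialComplex V) (i : ℕ) : ℤ :=
  ({s ∈ K.faces | s.card = i + 1}.ncard : ℤ)

/-- `γ₂ = f₃ - 2 f₂ + 4 f₁ - 8 f₀ + 16`. -/
noncomputable def gammaTwo {V : Type} (K : AbstractSimplicialComplex V) : ℤ :=
  faceCount K 3 - 2 * faceCount K 2 + 4 * faceCount K 1 - 8 * faceCount K 0 + 16

/-- Isomorphism of simplicial complexes. -/
def Isomorphic {V W : Type} (K : AbstractSimplicialComplex V) (L : AbstractSimplicialComplex W) :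
    Prop :=
  ∃ e : V ≃ W, ∀ s : Finset V, s ∈ K.faces ↔ s.map e.toEmbedding ∈ L.faces

/-- The identification of two copies of the vertices other than `v` along the neighbours of `v`,
which are the vertices of the link of `v`. -/
def doubleSetoid {V : Type} (K : AbstractSimplicialComplex V) (v : V) :
    Setoid (({v}ᶜ : Set V) × Bool) where
  r p q := p.1 = q.1 ∧ (p.2 = q.2 ∨ (skeleton K).Adj v p.1)
  iseqv := by
    refine ⟨fun p => ⟨rfl, Or.inl rfl⟩, ?_, ?_⟩
    · rintro ⟨x, b⟩ ⟨y, c⟩ ⟨h, h'⟩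
      obtain rfl : x = y := h
      exact ⟨rfl, h'.imp Eq.symm id⟩
    · rintro ⟨x, b⟩ ⟨y, c⟩ ⟨z, d⟩ ⟨h, h'⟩ ⟨k, k'⟩
      obtain rfl : x = y := h
      obtain rfl : x = z := k
      refine ⟨rfl, ?_⟩
      rcases h' with h' | h'
      · rcases k' with k' | k'
        · exact Or.inl (h'.trans k')
        · exact Or.inr k'
      · exact Or.inr h'

/-- The vertex set of the double of `K` at `v`. -/
abbrev DoubleVertex {V : Type} (K : AbstractSimplicialComplex V) (v : V) : Type :=
  Quotient (doubleSetoid K v)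

/-- The inclusion of the copy with index `b` into the double. -/
def doubleIncl {V : Type} (K : AbstractSimplicialComplex V) (v : V) (b : Bool) :
    ({v}ᶜ : Set V) ↪ DoubleVertex K v where
  toFun x := Quotient.mk (doubleSetoid K v) (x, b)
  inj' x y h := (Quotient.exact h : (doubleSetoid K v).r (x, b) (y, b)).1

/-- The double of the complement of the open star of `v`. Removing the open star of `v` leaves the
full subcomplex on the vertices other than `v`; two copies of it are glued along the link of `v`.
(Gluing is done on vertices; in a flag complex the link is a full subcomplex, so that this is the
gluing of the two complexes along the link.) -/
def double {V : Type} (K : AbstractSimplicialComplex V) (v : V) :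
    AbstractSimplicialComplex (DoubleVertex K v) where
  faces := {s | ∃ b : Bool, ∃ t ∈ (fullSubcomplex K {v}ᶜ).faces, s = t.map (doubleIncl K v b)}
  isRelLowerSet_faces := by
    rintro _ ⟨b, t, ht, rfl⟩
    refine ⟨Finset.map_nonempty.2 ((fullSubcomplex K {v}ᶜ).isRelLowerSet_faces ht).1, ?_⟩
    intro u hu hne
    obtain ⟨t', ht', rfl⟩ := Finset.subset_map_iff.1 hu
    exact ⟨b, t', ((fullSubcomplex K {v}ᶜ).isRelLowerSet_faces ht).2 ht'
      (Finset.map_nonempty.1 hne), rfl⟩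
  singleton_mem q := by
    induction q using Quotient.inductionOn with
    | h p => exact ⟨p.2, {p.1}, (fullSubcomplex K {v}ᶜ).singleton_mem p.1, by
        rw [Finset.map_singleton]; rfl⟩

/-- The clique complex of a graph: the flag complex with the given 1-skeleton. -/
def cliqueComplex {V : Type} (G : SimpleGraph V) : AbstractSimplicialComplex V where
  faces := {s | s.Nonempty ∧ G.IsClique (s : Set V)}
  isRelLowerSet_faces := by
    intro s hs
    exact ⟨hs.1, fun t hts ht => ⟨ht, hs.2.subset (Finset.coe_subset.2 hts)⟩⟩
  singleton_mem v := by simp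

/-- The 1-skeleton of `T₁₂`. The vertices `inl i`, `i ∈ ℤ/9`, are arranged in a cycle and joined
when their distance along it is at most 3; the vertex `inr r`, `r ∈ ℤ/3`, is joined to those
`inl i` with `i ≢ r` modulo 3; the three vertices `inr r` are pairwise not adjacent. -/
def graphTwelve : SimpleGraph (ZMod 9 ⊕ ZMod 3) where
  Adj
    | .inl i, .inl j => i - j ∈ ({1, 2, 3, -1, -2, -3} : Finset (ZMod 9))
    | .inl i, .inr r => (i.cast : ZMod 3) ≠ r
    | .inr r, .inl i => (i.cast : ZMod 3) ≠ r
    | .inr _, .inr _ => False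
  symm := ⟨by
    rintro (i | r) (j | t) h
    · revert i j; decide
    · exact h
    · exact h
    · exact h⟩
  loopless := ⟨by
    rintro (i | r) h
    · revert i; decide
    · exact h⟩

/-- The flag complex `T₁₂`. -/
def complexTwelve : AbstractSimplicialComplex (ZMod 9 ⊕ ZMod 3) := cliqueComplex graphTwelve

/-- A finite simplicial complex together with its vertex set. -/
structure FiniteComplex where
  /-- The vertex set. -/
  V : Type
  /-- The vertex set is finite. -/
  finite : Finite V
  /-- The simplices. -/
  complex : AbstractSimplicialComplex V

/-- A sequence of finite complexes that starts with `T₁₂` and in which each complex is obtained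
from the preceding one by doubling the complement of the open star of some vertex, up to
isomorphism. -/
def IsDoublingSequence (T : ℕ → FiniteComplex) : Prop :=
  Isomorphic (T 0).complex complexTwelve ∧
    ∀ n, ∃ v : (T n).V, Isomorphic (T (n + 1)).complex (double (T n).complex v)

end SphereComplex

/-! The main difficulty is that doubling must preserve spheres and must be repeatable. Suppose that
the complement of the open star of $v$ in $T$ is carried onto the closed star of $v$ by a
homeomorphism that fixes the link, a reflection. Then the second copy inside $D(T,v)$ can be laid
over the missing star, and the double is homeomorphic to $T$. To iterate, the double needs
reflections of its own. Building them from those of $T$ means moving the double onto $T$ while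
keeping track of the link of a chosen vertex, so reflections have to respect the links of further
vertices. This leads to `HasReflections`: for every simplex $\tau\cup\{w\}$ the part of the complex
that avoids the simplex is reflected onto the part of the star of $w$ that avoids $\tau$, respecting
the links of the vertices of $\tau$.

This property is inherited by doubles of flag complexes (`IsDouble.hasReflections`):
`IsDouble.exists_homeo` moves the double, away from a simplex, onto $T$ away from the corresponding
simplex; a reflection of $T$ is applied there; its target is a cone over a part of a link, so
`exists_cone_extension` carries it back. The empty simplex in `IsDouble.exists_homeo` shows that the
double is a sphere.

For $T_{12}$, both sides of a reflection are stratified by the subsets $\rho\subseteq\tau$: a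
stratum consists of the points that can be joined to $\rho$. If every stratum is a ball bounded by
the common part and the next smaller strata, Alexander's trick extends the identity stratum by
stratum (`exists_stratified_extension`, `hasReflectionAt_of_balls`). The balls are certified by
shellings, resting on `IsBallPair.attach_simplex`. The kernel checks them for simplices representing
the orbits of a rotation of order nine. Star and antistar of one vertex also exhibit $T_{12}$ as a
sphere.

The rest is combinatorial. In dimension at most 3, $\gamma_2=16\sum(-1/2)^{|s|}$ over all simplices
including the empty one. The open star of $v$ contributes $-1/2$ times the contribution of the link,
so deleting two open stars cancels the overcount of the shared link, and $\gamma_2$ doubles. Since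
$\gamma_2(T_{12})=1$, one gets $\gamma_2(T_n)=2^n$, which is positive and separates the $T_n$. An
induced 4-cycle through $v$ is repaired by replacing $v$ with the mirror image of the opposite
vertex, which is distinct from that vertex because it lies outside the link of $v$. -/

namespace SphereComplex
open Set Metric Topology

/-! ### Homeomorphisms between compact subsets -/

section IsHomeoOn

variable {E F G : Type*} [TopologicalSpace E] [TopologicalSpace F] [TopologicalSpace G]

/-- `f` restricts to a homeomorphism from the compact set `X` onto `Y`. -/
structure IsHomeoOn (f : E → F) (X : Set E) (Y : Set F) : Prop where
  compact : IsCompact X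
  cont : ContinuousOn f X
  bij : BijOn f X Y

namespace IsHomeoOn

variable {f : E → F} {g : F → G} {X : Set E} {Y : Set F} {Z : Set G}

lemma compact_image (h : IsHomeoOn f X Y) : IsCompact Y := by
  rw [← h.bij.image_eq]; exact h.compact.image_of_continuousOn h.cont

lemma comp (hg : IsHomeoOn g Y Z) (hf : IsHomeoOn f X Y) : IsHomeoOn (g ∘ f) X Z :=
  ⟨hf.compact, hg.cont.comp hf.cont hf.bij.mapsTo, hg.bij.comp hf.bij⟩

/-- Compactness makes `f` a closed map: the preimage of a closed `t` under the inverse is the image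
of the compact set `X ∩ t`. -/
lemma symm [T2Space E] [T2Space F] [Nonempty E] (h : IsHomeoOn f X Y) :
    IsHomeoOn (Function.invFunOn f X) Y X := by
  have hb : BijOn (Function.invFunOn f X) Y X := BijOn.symm h.bij.invOn_invFunOn.symm h.bij
  refine ⟨h.compact_image, ?_, hb⟩
  rw [continuousOn_iff_isClosed]
  intro t ht
  refine ⟨f '' (X ∩ t), ?_, ?_⟩
  · exact ((h.compact.inter_right ht).image_of_continuousOn
      (h.cont.mono inter_subset_left)).isClosed
  · ext y
    constructor
    · rintro ⟨hy, hyY⟩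
      exact ⟨⟨_, ⟨hb.mapsTo hyY, hy⟩, h.bij.invOn_invFunOn.2 hyY⟩, hyY⟩
    · rintro ⟨⟨x, ⟨hx, hxt⟩, rfl⟩, hyY⟩
      refine ⟨?_, hyY⟩
      rw [mem_preimage, h.bij.invOn_invFunOn.1 hx]
      exact hxt

lemma restrict {X' : Set E} {Y' : Set F} (h : IsHomeoOn f X Y) (hX : IsCompact X') (hs : X' ⊆ X)
    (hY : Y' ⊆ Y) (hm : ∀ x ∈ X, (x ∈ X' ↔ f x ∈ Y')) : IsHomeoOn f X' Y' := by
  refine ⟨hX, h.cont.mono hs, fun x hx => (hm x (hs hx)).1 hx, h.bij.injOn.mono hs, ?_⟩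
  intro y hy
  obtain ⟨x, hx, rfl⟩ := h.bij.surjOn (hY hy)
  exact ⟨x, (hm x hx).2 hy, rfl⟩

/-- Homeomorphisms of two closed pieces that agree on the overlap glue. -/
lemma union [T2Space E] {f' : E → F} {X' : Set E} {Y' : Set F} (h : IsHomeoOn f X Y)
    (h' : IsHomeoOn f' X' Y') (e : EqOn f f' (X ∩ X'))
    (hn : ∀ x ∈ X, ∀ x' ∈ X', f x = f' x' → x ∈ X') :
    ∃ k : E → F, IsHomeoOn k (X ∪ X') (Y ∪ Y') ∧ EqOn k f X ∧ EqOn k f' X' := by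
  classical
  let k : E → F := fun x => if x ∈ X then f x else f' x
  have k1 : EqOn k f X := fun x hx => if_pos hx
  have k2 : EqOn k f' X' := by
    intro x hx
    by_cases hxX : x ∈ X
    · rw [k1 hxX, e ⟨hxX, hx⟩]
    · exact if_neg hxX
  refine ⟨k, ⟨h.compact.union h'.compact, ?_, ?_⟩, k1, k2⟩
  · exact (h.cont.congr k1).union_of_isClosed (h'.cont.congr k2) h.compact.isClosed
      h'.compact.isClosed
  · have b1 : BijOn k X Y := h.bij.congr k1.symm
    have b2 : BijOn k X' Y' := h'.bij.congr k2.symm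
    refine ⟨?_, ?_, b1.surjOn.union_union b2.surjOn⟩
    · exact b1.mapsTo.union_union b2.mapsTo
    -- A coincidence between the two pieces puts `x` into `X'` by `hn`, where injectivity of the
    -- second map decides.
    · have key : ∀ x ∈ X, ∀ x' ∈ X', k x = k x' → x = x' := by
        intro x hx x' hx' hxx
        have : x ∈ X' := hn x hx x' hx' (by rw [← k1 hx, hxx, k2 hx'])
        exact b2.injOn this hx' hxx
      rintro x (hx | hx) x' (hx' | hx') hxx
      · exact b1.injOn hx hx' hxx
      · exact key x hx x' hx' hxx
      · exact (key x' hx' x hx hxx.symm).symm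
      · exact b2.injOn hx hx' hxx

lemma nonempty_homeomorph [T2Space F] (h : IsHomeoOn f X Y) : Nonempty (X ≃ₜ Y) := by
  have : CompactSpace X := isCompact_iff_compactSpace.1 h.compact
  exact ⟨Continuous.homeoOfEquivCompactToT2 (f := h.bij.equiv f)
    (Continuous.subtype_mk (h.cont.domRestrict) _)⟩

end IsHomeoOn

end IsHomeoOn

/-! ### Radial extensions and star-shaped bodies -/

section Radial

variable {E F : Type*} [NormedAddCommGroup E] [NormedSpace ℝ E] [NormedAddCommGroup F]
  [NormedSpace ℝ F]

lemma normalize_mem {z : E} (hz : z ≠ 0) : ‖z‖⁻¹ • z ∈ sphere (0 : E) 1 := by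
  rw [mem_sphere_zero_iff_norm, norm_smul, norm_inv, norm_norm,
    inv_mul_cancel₀ (norm_ne_zero_iff.2 hz)]

lemma continuousOn_normalize : ContinuousOn (fun z : E => ‖z‖⁻¹ • z) {0}ᶜ := by
  apply ContinuousOn.smul
  · exact continuous_norm.continuousOn.inv₀ (fun z hz => norm_ne_zero_iff.2 hz)
  · exact continuousOn_id

/-- The radial extension of a map between unit spheres. -/
noncomputable def radialExtension (γ : E → F) (z : E) : F := ‖z‖ • γ (‖z‖⁻¹ • z)

lemma radialExtension_smul (γ : E → F) {u : E} (hu : u ∈ sphere (0 : E) 1) {t : ℝ} (ht : 0 ≤ t) :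
    radialExtension γ (t • u) = t • γ u := by
  rw [mem_sphere_zero_iff_norm] at hu
  rcases ht.eq_or_lt with rfl | ht
  · simp [radialExtension]
  · rw [radialExtension, norm_smul, hu, mul_one, Real.norm_of_nonneg ht.le, smul_smul,
      inv_mul_cancel₀ ht.ne', one_smul]

lemma norm_radialExtension {γ : E → F} (h : MapsTo γ (sphere 0 1) (sphere 0 1)) (z : E) :
    ‖radialExtension γ z‖ = ‖z‖ := by
  by_cases hz : z = 0
  · simp [radialExtension, hz]
  · have := h (normalize_mem hz)
    rw [mem_sphere_zero_iff_norm] at this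
    rw [radialExtension, norm_smul, this, norm_norm, mul_one]

/-- The direction of `z` has no limit at the origin, so continuity there comes from preservation of
norms; elsewhere the formula is a composition of continuous maps. -/
lemma continuous_radialExtension {γ : E → F} (h : MapsTo γ (sphere 0 1) (sphere 0 1))
    (hc : ContinuousOn γ (sphere 0 1)) : Continuous (radialExtension γ) := by
  rw [continuous_iff_continuousAt]
  intro z
  by_cases hz : z = 0
  · subst hz
    have h0 : radialExtension γ 0 = 0 := by simp [radialExtension]
    rw [ContinuousAt, h0, tendsto_zero_iff_norm_tendsto_zero]
    simp_rw [norm_radialExtension h]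
    simpa using (continuous_norm (E := E)).tendsto 0
  · have : ContinuousOn (radialExtension γ) {0}ᶜ :=
      continuous_norm.continuousOn.smul
        (hc.comp continuousOn_normalize (fun z hz => normalize_mem hz))
    exact this.continuousAt (isOpen_compl_singleton.mem_nhds hz)

lemma bijOn_radialExtension {γ : E → F} (h : BijOn γ (sphere 0 1) (sphere 0 1)) :
    BijOn (radialExtension γ) (closedBall 0 1) (closedBall 0 1) := by
  have hnorm := norm_radialExtension h.mapsTo
  refine ⟨?_, ?_, ?_⟩
  · intro z hz
    rw [mem_closedBall_zero_iff] at hz ⊢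
    rwa [hnorm]
  · intro z _ z' _ e
    have hn : ‖z‖ = ‖z'‖ := by rw [← hnorm, e, hnorm]
    by_cases hz : z = 0
    · subst hz; rw [norm_zero, eq_comm, norm_eq_zero] at hn; exact hn.symm
    · have hz' : z' ≠ 0 := by rwa [← norm_ne_zero_iff, ← hn, norm_ne_zero_iff]
      rw [radialExtension, radialExtension, hn] at e
      have hi := h.injOn (hn ▸ normalize_mem hz) (normalize_mem hz')
        (smul_right_injective _ (norm_ne_zero_iff.2 hz') e)
      exact smul_right_injective _ (inv_ne_zero (norm_ne_zero_iff.2 hz')) hi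
  · intro y hy
    by_cases hy0 : y = 0
    · exact ⟨0, by simp, by simp [radialExtension, hy0]⟩
    obtain ⟨u, hu, e⟩ := h.surjOn (normalize_mem hy0)
    refine ⟨‖y‖ • u, ?_, ?_⟩
    · rw [mem_sphere_zero_iff_norm] at hu
      rw [mem_closedBall_zero_iff] at hy ⊢
      rwa [norm_smul, norm_norm, hu, mul_one]
    · rw [radialExtension_smul γ hu (norm_nonneg _), e, smul_smul,
        mul_inv_cancel₀ (norm_ne_zero_iff.2 hy0), one_smul]

/-- The body that is star-shaped about the origin with radius function `r ≥ 1` is homeomorphic to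
the ball. -/
lemma isHomeoOn_starBody [FiniteDimensional ℝ E] {r : E → ℝ} (h1 : ∀ u, 1 ≤ r u)
    (hc : ContinuousOn r (sphere 0 1)) :
    ∃ g : E → E, ContinuousOn g univ ∧
      BijOn g {z | ‖z‖ ≤ r (‖z‖⁻¹ • z)} (closedBall 0 1) ∧
      (∀ z, ‖g z‖ = 1 ↔ ‖z‖ = r (‖z‖⁻¹ • z)) := by
  have hpos : ∀ u, 0 < r u := fun u => one_pos.trans_le (h1 u)
  let g : E → E := fun z => (r (‖z‖⁻¹ • z))⁻¹ • z
  have hg : ∀ z, ‖g z‖ = ‖z‖ / r (‖z‖⁻¹ • z) := by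
    intro z
    rw [norm_smul, norm_inv, Real.norm_of_nonneg (hpos _).le, div_eq_inv_mul]
  have hdir : ∀ (z : E) (c : ℝ), 0 < c → ‖c • z‖⁻¹ • c • z = ‖z‖⁻¹ • z := by
    intro z c hc
    rw [norm_smul, Real.norm_of_nonneg hc.le, smul_smul, mul_inv, mul_right_comm,
      inv_mul_cancel₀ hc.ne', one_mul]
  refine ⟨g, ?_, ⟨?_, ?_, ?_⟩, ?_⟩
  · rw [continuousOn_univ, continuous_iff_continuousAt]
    intro z
    by_cases hz : z = 0
    · subst hz
      have h0 : g 0 = 0 := smul_zero _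
      rw [ContinuousAt, h0, tendsto_zero_iff_norm_tendsto_zero]
      -- The radius in the direction of `z` need not converge as `z` tends to the origin; `r ≥ 1`
      -- still bounds `‖g z‖` by `‖z‖`.
      refine squeeze_zero (fun z => norm_nonneg _) (fun z => ?_)
        (by simpa using (continuous_norm (E := E)).tendsto 0)
      rw [hg]
      exact div_le_self (norm_nonneg _) (h1 _)
    · have : ContinuousOn g {0}ᶜ :=
        ((hc.comp continuousOn_normalize (fun z hz => normalize_mem hz)).inv₀
          (fun z _ => (hpos _).ne')).smul continuousOn_id
      exact this.continuousAt (isOpen_compl_singleton.mem_nhds hz)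
  · intro z hz
    rw [mem_closedBall_zero_iff, hg]
    exact (div_le_one (hpos _)).2 hz
  · intro z _ z' _ e
    have d : ‖z‖⁻¹ • z = ‖z'‖⁻¹ • z' := by
      rw [← hdir z _ (inv_pos.2 (hpos (‖z‖⁻¹ • z))), ← hdir z' _ (inv_pos.2 (hpos (‖z'‖⁻¹ • z')))]
      exact congrArg (fun w : E => ‖w‖⁻¹ • w) e
    simp only [g, d] at e
    exact smul_right_injective _ (inv_ne_zero (hpos _).ne') e
  · intro y hy
    rw [mem_closedBall_zero_iff] at hy
    refine ⟨r (‖y‖⁻¹ • y) • y, ?_, ?_⟩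
    · rw [mem_ofPred_eq, hdir _ _ (hpos _), norm_smul, Real.norm_of_nonneg (hpos _).le]
      exact mul_le_of_le_one_right (hpos _).le hy
    · simp only [g]
      rw [hdir _ _ (hpos _), smul_smul, inv_mul_cancel₀ (hpos _).ne', one_smul]
  · intro z
    rw [hg, div_eq_one_iff_eq (hpos _).ne']

end Radial

end SphereComplex

namespace SphereComplex
open Set Metric Topology

/-! ### Balls with their boundaries: extension, gluing, attaching -/

section BallPair

variable {E F : Type*} [TopologicalSpace E] [TopologicalSpace F]

/-- `X` is homeomorphic to the closed unit ball of `ℝ^n`, with `A` corresponding to the sphere. -/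
def IsBallPair (n : ℕ) (X A : Set E) : Prop :=
  ∃ φ : E → EuclideanSpace ℝ (Fin n), IsHomeoOn φ X (closedBall 0 1) ∧ A ⊆ X ∧
    ∀ x ∈ X, (x ∈ A ↔ ‖φ x‖ = 1)

lemma IsBallPair.isHomeoOn_boundary [T2Space E] [Nonempty E] {n : ℕ} {X A : Set E}
    {φ : E → EuclideanSpace ℝ (Fin n)} (hφ : IsHomeoOn φ X (closedBall 0 1)) (hA : A ⊆ X)
    (h : ∀ x ∈ X, (x ∈ A ↔ ‖φ x‖ = 1)) : IsHomeoOn φ A (sphere 0 1) := by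
  have hs : IsHomeoOn (Function.invFunOn φ X) (sphere 0 1) A := by
    refine hφ.symm.restrict (isCompact_sphere _ _) sphere_subset_closedBall hA ?_
    intro u hu
    rw [h _ (hφ.symm.bij.mapsTo hu), hφ.bij.invOn_invFunOn.2 hu, mem_sphere_zero_iff_norm]
  refine hφ.restrict hs.compact_image hA sphere_subset_closedBall ?_
  intro x hx
  rw [h x hx, mem_sphere_zero_iff_norm]

/-- A homeomorphism between the boundaries of two balls extends to the balls. -/
lemma exists_extension_of_isBallPair [T2Space E] [Nonempty E] [T2Space F] [Nonempty F] {n : ℕ}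
    {X A : Set E} {Y B : Set F} (hX : IsBallPair n X A) (hY : IsBallPair n Y B) {g : E → F}
    (hg : IsHomeoOn g A B) :
    ∃ h : E → F, IsHomeoOn h X Y ∧ EqOn h g A ∧ ∀ x ∈ X, (x ∈ A ↔ h x ∈ B) := by
  obtain ⟨φ, hφ, hA, hφA⟩ := hX
  obtain ⟨ψ, hψ, hB, hψB⟩ := hY
  have bA := IsBallPair.isHomeoOn_boundary hφ hA hφA
  have bB := IsBallPair.isHomeoOn_boundary hψ hB hψB
  -- Alexander's trick: `g`, read as a self-map of the unit sphere, extends radially over the ball.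
  let γ := ψ ∘ g ∘ Function.invFunOn φ A
  have hγ : IsHomeoOn γ (sphere 0 1) (sphere 0 1) := bB.comp (hg.comp bA.symm)
  have hγ' : IsHomeoOn (radialExtension γ) (closedBall 0 1) (closedBall 0 1) :=
    ⟨isCompact_closedBall _ _, (continuous_radialExtension hγ.bij.mapsTo hγ.cont).continuousOn,
      bijOn_radialExtension hγ.bij⟩
  have hn := norm_radialExtension hγ.bij.mapsTo
  refine ⟨Function.invFunOn ψ Y ∘ radialExtension γ ∘ φ, hψ.symm.comp (hγ'.comp hφ), ?_, ?_⟩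
  · intro x hx
    have hs := bA.bij.mapsTo hx
    have : radialExtension γ (φ x) = ψ (g x) := by
      have := radialExtension_smul γ hs zero_le_one
      rw [one_smul, one_smul] at this
      rw [this]
      simp only [γ, Function.comp]
      rw [bA.bij.invOn_invFunOn.1 hx]
    simp only [Function.comp]
    rw [this, hψ.bij.invOn_invFunOn.1 (hB (hg.bij.mapsTo hx))]
  · intro x hx
    have hz := hγ'.bij.mapsTo (hφ.bij.mapsTo hx)
    rw [hφA x hx, ← hn, ← hψ.bij.invOn_invFunOn.2 hz]
    exact (hψB _ (hψ.symm.bij.mapsTo hz)).symm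

/-- Two balls that meet exactly in their common boundary form a sphere. -/
lemma exists_homeo_sphere_of_isBallPair [T2Space E] [Nonempty E] {n : ℕ} {X Y A : Set E}
    (hX : IsBallPair n X A) (hY : IsBallPair n Y A) (hXY : X ∩ Y = A) :
    ∃ f : E → EuclideanSpace ℝ (Fin (n + 1)), IsHomeoOn f (X ∪ Y) (sphere 0 1) := by
  obtain ⟨φ, hφ, hA, hφA⟩ := hX
  have bA := IsBallPair.isHomeoOn_boundary hφ hA hφA
  have hB : IsBallPair n (closedBall (0 : EuclideanSpace ℝ (Fin n)) 1) (sphere 0 1) :=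
    ⟨id, ⟨isCompact_closedBall _ _, continuousOn_id, bijOn_id _⟩, sphere_subset_closedBall,
      fun x _ => mem_sphere_zero_iff_norm⟩
  -- The chart of `Y` is chosen to agree with `φ` on `A`, so that the two hemispheres fit together
  -- along the equator.
  obtain ⟨ψ, hψ, hψφ, hψA⟩ := exists_extension_of_isBallPair hY hB bA
  -- the graph of a height function over the ball
  let lift : ℝ → EuclideanSpace ℝ (Fin n) → EuclideanSpace ℝ (Fin (n + 1)) := fun c z =>
    WithLp.toLp 2 (Fin.cons (c * √(1 - ‖z‖ ^ 2)) z.ofLp : Fin (n + 1) → ℝ)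
  have hl0 : ∀ c z, (lift c z) 0 = c * √(1 - ‖z‖ ^ 2) := fun c z => rfl
  have hls : ∀ c z i, (lift c z) (Fin.succ i) = z i := fun c z i => rfl
  have hlc : ∀ c, Continuous (lift c) := by
    intro c
    refine (PiLp.continuous_toLp 2 _).comp (continuous_pi fun i => ?_)
    refine Fin.cases ?_ (fun i => ?_) i
    · simp only [Fin.cons_zero]; fun_prop
    · simp only [Fin.cons_succ]; fun_prop
  have hli : ∀ c c' z z', lift c z = lift c' z' → z = z' := by
    intro c c' z z' e
    ext i
    rw [← hls c z i, e, hls]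
  have hnorm : ∀ c, c ^ 2 = 1 → ∀ z ∈ closedBall (0 : EuclideanSpace ℝ (Fin n)) 1,
      lift c z ∈ sphere (0 : EuclideanSpace ℝ (Fin (n + 1))) 1 := by
    intro c hc z hz
    rw [mem_closedBall_zero_iff] at hz
    rw [mem_sphere_zero_iff_norm, ← sq_eq_sq₀ (norm_nonneg _) zero_le_one,
      EuclideanSpace.real_norm_sq_eq, Fin.sum_univ_succ, hl0]
    simp_rw [hls]
    rw [← EuclideanSpace.real_norm_sq_eq, mul_pow, hc, one_mul, Real.sq_sqrt]
    · ring
    · nlinarith [norm_nonneg z]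
  have him : ∀ c, c ^ 2 = 1 → IsHomeoOn (lift c) (closedBall 0 1)
      {y | y ∈ sphere (0 : EuclideanSpace ℝ (Fin (n + 1))) 1 ∧ 0 ≤ c * y 0} := by
    intro c hc
    refine ⟨isCompact_closedBall _ _, (hlc c).continuousOn, ?_, ?_, ?_⟩
    · intro z hz
      refine ⟨hnorm c hc z hz, ?_⟩
      rw [hl0, ← mul_assoc, ← sq, hc, one_mul]
      exact Real.sqrt_nonneg _
    · intro z _ z' _ e
      exact hli _ _ _ _ e
    · rintro y ⟨hy, hy0⟩
      have hz : ‖(WithLp.toLp 2 (fun i => y (Fin.succ i)) : EuclideanSpace ℝ (Fin n))‖ ^ 2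
          = 1 - y 0 ^ 2 := by
        rw [mem_sphere_zero_iff_norm] at hy
        have := EuclideanSpace.real_norm_sq_eq y
        rw [hy, Fin.sum_univ_succ] at this
        rw [EuclideanSpace.real_norm_sq_eq]
        simp only
        linarith
      refine ⟨WithLp.toLp 2 (fun i => y (Fin.succ i)), ?_, ?_⟩
      · rw [mem_closedBall_zero_iff, ← abs_of_nonneg (norm_nonneg _), ← sq_le_one_iff_abs_le_one, hz]
        nlinarith [sq_nonneg (y 0)]
      · ext i
        refine Fin.cases ?_ (fun i => ?_) i
        · rw [hl0, hz]
          have : √(1 - (1 - y 0 ^ 2)) = c * y 0 := by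
            rw [← Real.sqrt_sq hy0, mul_pow, hc]; congr 1; ring
          rw [this, ← mul_assoc, ← sq, hc, one_mul]
        · rw [hls]
  obtain ⟨f, hf, -, -⟩ := ((him 1 (by norm_num)).comp hφ).union ((him (-1) (by norm_num)).comp hψ)
    (by
      intro x hx
      rw [hXY] at hx
      simp only [Function.comp]
      rw [hψφ hx]
      have := bA.bij.mapsTo hx
      rw [mem_sphere_zero_iff_norm] at this
      simp [lift, this])
    (by
      intro x hx y hy e
      have e0 : (lift 1 (φ x)) 0 = (lift (-1) (ψ y)) 0 := congrArg (fun w => w 0) e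
      have e1 : φ x = ψ y := hli _ _ _ _ e
      rw [hl0, hl0, ← e1] at e0
      have hz : √(1 - ‖φ x‖ ^ 2) = 0 := by linarith
      have h1 := hφ.bij.mapsTo hx
      rw [mem_closedBall_zero_iff] at h1
      rw [Real.sqrt_eq_zero (by nlinarith [norm_nonneg (φ x)])] at hz
      have : x ∈ A := by
        rw [hφA x hx, ← pow_eq_one_iff_of_nonneg (norm_nonneg (φ x)) two_ne_zero]
        linarith
      exact (hXY ▸ this : x ∈ X ∩ Y).2)
  refine ⟨f, ?_⟩
  convert hf using 1
  ext y
  constructor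
  · intro hy
    rcases le_total 0 (y 0) with h | h
    · exact Or.inl ⟨hy, by simpa using h⟩
    · exact Or.inr ⟨hy, by simpa using h⟩
  · rintro (h | h) <;> exact h.1

/-- Attaching to a ball a piece `P` that is fibred by segments over a part `G` of the boundary, the
segments being degenerate exactly over the rest `H` of the boundary, gives a ball. -/
lemma IsBallPair.attach [T2Space E] [Nonempty E] {n : ℕ} {X G H P : Set E}
    (hX : IsBallPair n X (G ∪ H)) (hP : IsCompact P) (hG : IsCompact G) (hH : IsCompact H)
    (hXP : X ∩ P = G) {q : E → E} {s f : E → ℝ} (hq : ContinuousOn q P) (hs : ContinuousOn s P)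
    (hf : ContinuousOn f G) (hqG : MapsTo q P G) (hs0 : ∀ x ∈ P, 0 ≤ s x)
    (hsf : ∀ x ∈ P, s x ≤ f (q x)) (hinj : ∀ x ∈ P, ∀ y ∈ P, q x = q y → s x = s y → x = y)
    (hsurj : ∀ y ∈ G, ∀ t, 0 ≤ t → t ≤ f y → ∃ x ∈ P, q x = y ∧ s x = t)
    (hid : ∀ x ∈ G, q x = x ∧ s x = 0) (hf0 : ∀ y ∈ G, 0 ≤ f y)
    (hfH : ∀ y ∈ G, y ∈ H ↔ f y = 0) :
    IsBallPair n (X ∪ P) (H ∪ {x ∈ P | s x = f (q x)}) := by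
  classical
  obtain ⟨φ, hφ, hA, hφA⟩ := hX
  have bA := IsBallPair.isHomeoOn_boundary hφ hA hφA
  -- The ball grows only over `G`. Since `f` vanishes on `G ∩ H`, its extension by zero is
  -- continuous on the whole boundary.
  let f' : E → ℝ := fun y => if y ∈ G then f y else 0
  have f'G : EqOn f' f G := fun y hy => if_pos hy
  have f'H : EqOn f' 0 H := by
    intro y hy
    by_cases hyG : y ∈ G
    · rw [f'G hyG, (hfH y hyG).1 hy]; rfl
    · exact if_neg hyG
  have f'0 : ∀ y, 0 ≤ f' y := by
    intro y
    by_cases hyG : y ∈ G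
    · rw [f'G hyG]; exact hf0 y hyG
    · exact (if_neg hyG).ge
  have f'c : ContinuousOn f' (G ∪ H) :=
    (hf.congr f'G).union_of_isClosed (continuousOn_const.congr f'H) hG.isClosed hH.isClosed
  let r : EuclideanSpace ℝ (Fin n) → ℝ := fun u => 1 + f' (Function.invFunOn φ (G ∪ H) u)
  have hr1 : ∀ u, 1 ≤ r u := fun u => le_add_of_nonneg_right (f'0 _)
  have hrc : ContinuousOn r (sphere 0 1) :=
    continuousOn_const.add (f'c.comp bA.symm.cont bA.symm.bij.mapsTo)
  have hrφ : ∀ y ∈ G ∪ H, r (φ y) = 1 + f' y := by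
    intro y hy
    simp only [r]
    rw [bA.bij.invOn_invFunOn.1 hy]
  have hφ1 : ∀ y ∈ G ∪ H, ‖φ y‖ = 1 := fun y hy => (hφA y (hA hy)).1 hy
  have hdir : ∀ y ∈ G ∪ H, ∀ c : ℝ, 0 < c → ‖c • φ y‖ = c ∧ ‖c • φ y‖⁻¹ • c • φ y = φ y := by
    intro y hy c hc
    have : ‖c • φ y‖ = c := by rw [norm_smul, hφ1 y hy, mul_one, Real.norm_of_nonneg hc.le]
    exact ⟨this, by rw [this, smul_smul, inv_mul_cancel₀ hc.ne', one_smul]⟩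
  obtain ⟨g, hgc, hgb, hg1⟩ := isHomeoOn_starBody hr1 hrc
  have h1 : IsHomeoOn φ X (closedBall 0 1) := hφ
  -- The piece `P` becomes the shell between the unit sphere and radius `r`, in the directions of `φ
  -- '' G`: a point goes to radius `1 + s x` in the direction of `φ (q x)`. Ball and shell together
  -- form the star body.
  let Q : Set (EuclideanSpace ℝ (Fin n)) := {z | 1 ≤ ‖z‖ ∧ ‖z‖ ≤ r (‖z‖⁻¹ • z) ∧
    ∃ y ∈ G, ‖z‖⁻¹ • z = φ y}
  have hs1 : ∀ x ∈ P, 0 < 1 + s x := fun x hx => by linarith [hs0 x hx]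
  have h2 : IsHomeoOn (fun x => (1 + s x) • φ (q x)) P Q := by
    refine ⟨hP, ?_, ?_, ?_, ?_⟩
    · exact (continuousOn_const.add hs).smul
        (hφ.cont.comp hq (fun x hx => hA (Or.inl (hqG hx))))
    · intro x hx
      have hy := hqG hx
      obtain ⟨e1, e2⟩ := hdir _ (Or.inl hy) _ (hs1 x hx)
      refine ⟨?_, ?_, q x, hy, e2⟩
      · rw [e1]; linarith [hs0 x hx]
      · rw [e2, e1, hrφ _ (Or.inl hy), f'G hy]; linarith [hsf x hx]
    · intro x hx x' hx' e
      obtain ⟨e1, e2⟩ := hdir _ (Or.inl (hqG hx)) _ (hs1 x hx)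
      obtain ⟨e1', e2'⟩ := hdir _ (Or.inl (hqG hx')) _ (hs1 x' hx')
      simp only at e
      have es : s x = s x' := by
        have : 1 + s x = 1 + s x' := by rw [← e1, e, e1']
        linarith
      have eq : φ (q x) = φ (q x') := by rw [← e2, e, e2']
      exact hinj x hx x' hx' (hφ.bij.injOn (hA (Or.inl (hqG hx))) (hA (Or.inl (hqG hx'))) eq) es
    · rintro z ⟨hz1, hzr, y, hy, ez⟩
      rw [ez, hrφ _ (Or.inl hy), f'G hy] at hzr
      obtain ⟨x, hx, rfl, hxs⟩ := hsurj y hy (‖z‖ - 1) (by linarith) (by linarith)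
      refine ⟨x, hx, ?_⟩
      simp only
      rw [hxs, ← ez, add_sub_cancel, smul_smul, mul_inv_cancel₀ (by linarith), one_smul]
  obtain ⟨k, hk, kX, kP⟩ := h1.union h2
    (by
      intro x hx
      rw [hXP] at hx
      obtain ⟨e1, e2⟩ := hid x hx
      simp [e1, e2])
    (by
      intro x hx x' hx' e
      obtain ⟨e1, e2⟩ := hdir _ (Or.inl (hqG hx')) _ (hs1 x' hx')
      have hx1 := hφ.bij.mapsTo hx
      rw [mem_closedBall_zero_iff, e, e1] at hx1
      have hs' : s x' = 0 := le_antisymm (by linarith) (hs0 x' hx')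
      rw [hs', add_zero, one_smul] at e
      have := hφ.bij.injOn hx (hA (Or.inl (hqG hx'))) e
      have hG' : x ∈ G := this ▸ hqG hx'
      exact (hXP ▸ hG' : x ∈ X ∩ P).2)
  have hbody : closedBall 0 1 ∪ Q = {z | ‖z‖ ≤ r (‖z‖⁻¹ • z)} := by
    ext z
    constructor
    · rintro (hz | hz)
      · rw [mem_closedBall_zero_iff] at hz
        exact hz.trans (hr1 _)
      · exact hz.2.1
    · intro hz
      by_cases h : ‖z‖ ≤ 1
      · exact Or.inl (by rwa [mem_closedBall_zero_iff])
      · right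
        push Not at h
        have hz0 : z ≠ 0 := by rintro rfl; simp at h; linarith
        obtain ⟨y, hy, e⟩ := bA.bij.surjOn (normalize_mem hz0)
        refine ⟨h.le, hz, y, ?_, e.symm⟩
        by_contra hyG
        rw [mem_ofPred_eq, ← e, hrφ y hy] at hz
        simp only [f', if_neg hyG] at hz
        linarith
  rw [hbody] at hk
  have hg : IsHomeoOn g {z | ‖z‖ ≤ r (‖z‖⁻¹ • z)} (closedBall 0 1) :=
    ⟨hk.compact_image, hgc.mono (subset_univ _), hgb⟩
  have hHX : H ⊆ X := fun x hx => hA (Or.inr hx)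
  refine ⟨g ∘ k, hg.comp hk, ?_, ?_⟩
  · rintro x (hx | hx)
    · exact Or.inl (hHX hx)
    · exact Or.inr hx.1
  · intro x hx
    simp only [Function.comp]
    rw [hg1]
    by_cases hxP : x ∈ P
    · obtain ⟨e1, e2⟩ := hdir _ (Or.inl (hqG hxP)) _ (hs1 x hxP)
      rw [kP hxP, e2, e1, hrφ _ (Or.inl (hqG hxP)), f'G (hqG hxP), add_right_inj]
      constructor
      · rintro (h | h)
        · have hG' : x ∈ G := hXP ▸ ⟨hHX h, hxP⟩
          rw [(hid x hG').1, (hid x hG').2, (hfH x hG').1 h]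
        · exact h.2
      · intro h; exact Or.inr ⟨hxP, h⟩
    · have hxX : x ∈ X := hx.resolve_right hxP
      rw [kX hxX]
      have hxG : x ∉ G := fun h => hxP (hXP ▸ h : x ∈ X ∩ P).2
      constructor
      · rintro (h | h)
        · have e := hφ1 x (Or.inr h)
          rw [e, inv_one, one_smul, hrφ x (Or.inr h), f'H h]
          simp
        · exact absurd h.1 hxP
      · intro h
        left
        have h1 := hφ.bij.mapsTo hxX
        rw [mem_closedBall_zero_iff] at h1
        have : ‖φ x‖ = 1 := le_antisymm h1 (h ▸ hr1 _)
        exact ((hφA x hxX).2 this).resolve_left hxG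

end BallPair

end SphereComplex

namespace SphereComplex
open Set Metric Topology

set_option linter.unusedSectionVars false

/-! ### Points with prescribed supports, and the shelling step -/

section Geom

variable {V : Type} [Fintype V] [DecidableEq V]

/-- The support of a point in barycentric coordinates. -/
noncomputable def supp (x : V → ℝ) : Finset V := Finset.univ.filter (fun v => x v ≠ 0)

lemma mem_supp {x : V → ℝ} {v : V} : v ∈ supp x ↔ x v ≠ 0 := by simp [supp]

lemma notMem_supp {x : V → ℝ} {v : V} : v ∉ supp x ↔ x v = 0 := by simp [supp]

/-- The points in barycentric coordinates whose support belongs to the family `𝒜`. -/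
def geom (𝒜 : Set (Finset V)) : Set (V → ℝ) := {x | x ∈ stdSimplex ℝ V ∧ supp x ∈ 𝒜}

lemma supp_nonempty {x : V → ℝ} (hx : x ∈ stdSimplex ℝ V) : (supp x).Nonempty := by
  by_contra h
  rw [Finset.not_nonempty_iff_eq_empty] at h
  have : ∑ v, x v = 0 := Finset.sum_eq_zero fun v _ => by
    rw [← notMem_supp, h]; exact Finset.notMem_empty v
  rw [hx.2] at this
  exact one_ne_zero this

lemma geom_inter (𝒜 ℬ : Set (Finset V)) : geom 𝒜 ∩ geom ℬ = geom (𝒜 ∩ ℬ) := by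
  ext x; constructor
  · rintro ⟨h, h'⟩; exact ⟨h.1, h.2, h'.2⟩
  · rintro ⟨h, h', h''⟩; exact ⟨⟨h, h'⟩, h, h''⟩

lemma geom_union (𝒜 ℬ : Set (Finset V)) : geom 𝒜 ∪ geom ℬ = geom (𝒜 ∪ ℬ) := by
  ext x; constructor
  · rintro (h | h)
    · exact ⟨h.1, Or.inl h.2⟩
    · exact ⟨h.1, Or.inr h.2⟩
  · rintro ⟨h, h' | h'⟩
    · exact Or.inl ⟨h, h'⟩
    · exact Or.inr ⟨h, h'⟩

/-- Barycentric coordinates sum to 1, so no point has empty support and membership of `∅` in a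
family is immaterial. -/
lemma geom_congr {𝒜 ℬ : Set (Finset V)} (h : ∀ s : Finset V, s.Nonempty → (s ∈ 𝒜 ↔ s ∈ ℬ)) :
    geom 𝒜 = geom ℬ := by
  ext x
  exact and_congr_right fun hx => h _ (supp_nonempty hx)

lemma geom_mono {𝒜 ℬ : Set (Finset V)} (h : 𝒜 ⊆ ℬ) : geom 𝒜 ⊆ geom ℬ :=
  fun _ hx => ⟨hx.1, h hx.2⟩

/-- A family closed under nonempty subsets describes a finite union of closed faces of the standard
simplex. -/
lemma isCompact_geom {𝒜 : Set (Finset V)}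
    (h : ∀ s ∈ 𝒜, ∀ t ⊆ s, t.Nonempty → t ∈ 𝒜) : IsCompact (geom 𝒜) := by
  have : geom 𝒜 = stdSimplex ℝ V ∩ ⋃ s ∈ 𝒜, {x : V → ℝ | ∀ v ∉ s, x v = 0} := by
    ext x
    simp only [geom, mem_inter_iff, mem_iUnion, mem_ofPred_eq, exists_prop]
    refine and_congr_right fun hx => ⟨fun hs => ⟨_, hs, fun v => notMem_supp.1⟩, ?_⟩
    rintro ⟨s, hs, hv⟩
    refine h s hs _ (fun v hvs => ?_) (supp_nonempty hx)
    by_contra hn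
    exact mem_supp.1 hvs (hv v hn)
  rw [this]
  refine (isCompact_stdSimplex ℝ V).inter_right ?_
  refine Set.Finite.isClosed_biUnion (toFinite _) fun s _ => ?_
  simp only [ofPred_forall]
  exact isClosed_iInter fun v => isClosed_iInter fun _ =>
    isClosed_eq (continuous_apply v) continuous_const

lemma realization_eq_geom (K : AbstractSimplicialComplex V) : realization K = geom K.faces := by
  ext x
  constructor
  · rintro ⟨h0, s, hs, hsupp, hsum⟩
    have e : supp x = s := by
      ext v
      rw [mem_supp, ← Finset.mem_coe, ← hsupp, Function.mem_support]
    refine ⟨⟨h0, ?_⟩, e ▸ hs⟩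
    rw [← hsum]
    refine (Finset.sum_subset (Finset.subset_univ s) fun v _ hv => ?_).symm
    rwa [← e, notMem_supp] at hv
  · rintro ⟨⟨h0, h1⟩, hs⟩
    refine ⟨h0, supp x, hs, ?_, ?_⟩
    · ext v; rw [Finset.mem_coe, mem_supp, Function.mem_support]
    · rw [← h1]
      exact Finset.sum_subset (Finset.subset_univ _) fun v _ hv => notMem_supp.1 hv

lemma nonneg_of_mem_geom {𝒜 : Set (Finset V)} {x : V → ℝ} (h : x ∈ geom 𝒜) (v : V) : 0 ≤ x v :=
  h.1.1 v

/-- The minimum of the coordinates in `I`. -/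
noncomputable def minCoord (I : Finset V) (hI : I.Nonempty) (x : V → ℝ) : ℝ := I.inf' hI x

lemma continuous_minCoord (I : Finset V) (hI : I.Nonempty) : Continuous (minCoord I hI) := by
  unfold minCoord
  exact Continuous.finset_inf'_apply hI fun i _ => continuous_apply i

lemma minCoord_le {I : Finset V} (hI : I.Nonempty) (x : V → ℝ) {i : V} (hi : i ∈ I) :
    minCoord I hI x ≤ x i := Finset.inf'_le _ hi

lemma exists_eq_minCoord {I : Finset V} (hI : I.Nonempty) (x : V → ℝ) :
    ∃ i ∈ I, minCoord I hI x = x i := by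
  obtain ⟨i, hi, h⟩ := Finset.exists_mem_eq_inf' hI x
  exact ⟨i, hi, h⟩

lemma minCoord_nonneg {I : Finset V} (hI : I.Nonempty) {x : V → ℝ} (hx : ∀ v, 0 ≤ x v) :
    0 ≤ minCoord I hI x := by
  obtain ⟨i, -, h⟩ := exists_eq_minCoord hI x
  rw [h]; exact hx i

lemma minCoord_eq_zero {I : Finset V} (hI : I.Nonempty) {x : V → ℝ} (hx : ∀ v, 0 ≤ x v) :
    minCoord I hI x = 0 ↔ ¬ I ⊆ supp x := by
  rw [Finset.not_subset]
  simp_rw [notMem_supp]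
  constructor
  · intro h
    obtain ⟨i, hi, e⟩ := exists_eq_minCoord hI x
    exact ⟨i, hi, e ▸ h⟩
  · rintro ⟨i, hi, e⟩
    exact le_antisymm (e ▸ minCoord_le hI x hi) (minCoord_nonneg hI hx)

lemma minCoord_congr {I : Finset V} (hI : I.Nonempty) {x y : V → ℝ} {c : ℝ}
    (h : ∀ i ∈ I, y i = x i + c) : minCoord I hI y = minCoord I hI x + c := by
  apply le_antisymm
  · obtain ⟨i, hi, e⟩ := exists_eq_minCoord hI x
    rw [e, ← h i hi]; exact minCoord_le hI y hi
  · obtain ⟨i, hi, e⟩ := exists_eq_minCoord hI y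
    rw [e, h i hi]; linarith [minCoord_le hI x hi]

/-- The translation direction that increases the coordinates in `I` and decreases those in `J`,
keeping the sum of all coordinates. -/
noncomputable def shift (I J : Finset V) (v : V) : ℝ :=
  if v ∈ I then 1 else if v ∈ J then -(I.card / J.card : ℝ) else 0

lemma sum_shift {I J : Finset V} (hJ : J.Nonempty) (h : Disjoint I J) : ∑ v, shift I J v = 0 := by
  have : ∀ v, shift I J v = (if v ∈ I then (1 : ℝ) else 0) +
      (if v ∈ J then -(I.card / J.card : ℝ) else 0) := by
    intro v
    unfold shift
    by_cases hI : v ∈ I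
    · simp [hI, Finset.disjoint_left.1 h hI]
    · simp [hI]
  simp_rw [this, Finset.sum_add_distrib, Finset.sum_ite_mem, Finset.univ_inter, Finset.sum_const,
    nsmul_eq_mul]
  have : (J.card : ℝ) ≠ 0 := Nat.cast_ne_zero.2 hJ.card_pos.ne'
  field_simp
  ring

/-- Shelling step: attaching a simplex to a ball along some, but not all, of its facets, these lying
on the boundary of the ball, gives a ball. -/
lemma IsBallPair.attach_simplex {n : ℕ} {𝒳 ℋ : Set (Finset V)} {I J : Finset V} (hI : I.Nonempty)
    (hJ : J.Nonempty) (hIJ : Disjoint I J)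
    (hℋ : ∀ s ∈ ℋ, ∀ t ⊆ s, t.Nonempty → t ∈ ℋ)
    (hX : IsBallPair n (geom 𝒳) (geom ({t | t ⊆ I ∪ J ∧ ¬ I ⊆ t} ∪ ℋ)))
    (h𝒳 : ∀ t ⊆ I ∪ J, t.Nonempty → (t ∈ 𝒳 ↔ ¬ I ⊆ t))
    (hH : ∀ t ⊆ I ∪ J, t.Nonempty → ¬ I ⊆ t → (t ∈ ℋ ↔ ¬ J ⊆ t)) :
    IsBallPair n (geom (𝒳 ∪ {t | t ⊆ I ∪ J})) (geom (ℋ ∪ {t | t ⊆ I ∪ J ∧ ¬ J ⊆ t})) := by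
  rw [← geom_union] at hX ⊢
  have hI0 : (0 : ℝ) < I.card := Nat.cast_pos.2 hI.card_pos
  have hJ0 : (0 : ℝ) < J.card := Nat.cast_pos.2 hJ.card_pos
  set d : ℝ := I.card / J.card with hd
  have hd0 : 0 < d := div_pos hI0 hJ0
  let m := minCoord I hI
  let m' := minCoord J hJ
  have sI : ∀ i ∈ I, shift I J i = 1 := fun i hi => if_pos hi
  have sJ : ∀ j ∈ J, shift I J j = -d := fun j hj => by
    rw [shift, if_neg (Finset.disjoint_right.1 hIJ hj), if_pos hj]
  have s0 : ∀ v ∉ I ∪ J, shift I J v = 0 := fun v hv => by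
    rw [Finset.mem_union, not_or] at hv
    rw [shift, if_neg hv.1, if_neg hv.2]
  have hmv : ∀ {x : V → ℝ} {c : ℝ}, x ∈ geom {t : Finset V | t ⊆ I ∪ J} →
      -c ≤ m x → d * c ≤ m' x →
      (fun v => x v + c * shift I J v) ∈ geom {t : Finset V | t ⊆ I ∪ J} := by
    intro x c hx hc hc'
    refine ⟨⟨fun v => ?_, ?_⟩, fun v hv => ?_⟩
    · beta_reduce
      by_cases hvI : v ∈ I
      · rw [sI v hvI]; linarith [minCoord_le hI x hvI]
      by_cases hvJ : v ∈ J
      · rw [sJ v hvJ]; linarith [minCoord_le hJ x hvJ]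
      rw [s0 v (by simp [hvI, hvJ])]
      simpa using hx.1.1 v
    · rw [Finset.sum_add_distrib, ← Finset.mul_sum, sum_shift hJ hIJ, mul_zero, add_zero, hx.1.2]
    · by_contra hn
      rw [mem_supp, s0 v hn, mul_zero, add_zero] at hv
      exact hn (hx.2 (mem_supp.2 hv))
  have mI : ∀ (x : V → ℝ) (c : ℝ), m (fun v => x v + c * shift I J v) = m x + c := fun x c =>
    minCoord_congr hI fun i hi => by rw [sI i hi, mul_one]
  have mJ : ∀ (x : V → ℝ) (c : ℝ), m' (fun v => x v + c * shift I J v) = m' x + -(d * c) :=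
    fun x c => minCoord_congr hJ fun j hj => by rw [sJ j hj]; ring
  have nn : ∀ {x : V → ℝ} {𝒜}, x ∈ geom 𝒜 → ∀ v, 0 ≤ x v := fun h => nonneg_of_mem_geom h
  have memG : ∀ {x : V → ℝ}, x ∈ geom {t : Finset V | t ⊆ I ∪ J ∧ ¬ I ⊆ t} ↔
      x ∈ geom {t : Finset V | t ⊆ I ∪ J} ∧ m x = 0 := by
    intro x
    constructor
    · intro h; exact ⟨⟨h.1, h.2.1⟩, (minCoord_eq_zero hI (nn h)).2 h.2.2⟩
    · rintro ⟨h, h'⟩; exact ⟨h.1, h.2, (minCoord_eq_zero hI (nn h)).1 h'⟩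
  have htop : geom (ℋ ∪ {t : Finset V | t ⊆ I ∪ J ∧ ¬ J ⊆ t}) = geom ℋ ∪
      {x ∈ geom {t : Finset V | t ⊆ I ∪ J} |
        m x = (fun y => d⁻¹ * m' y) (fun v => x v + -m x * shift I J v)} := by
    rw [← geom_union]
    congr 1
    ext x
    simp only [mJ, mem_ofPred_eq]
    have e : m x = d⁻¹ * (m' x + -(d * -m x)) ↔ m' x = 0 := by
      field_simp
      constructor <;> intro h <;> linarith
    rw [e]
    constructor
    · intro h; exact ⟨⟨h.1, h.2.1⟩, (minCoord_eq_zero hJ (nn h)).2 h.2.2⟩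
    · rintro ⟨h, h'⟩; exact ⟨h.1, h.2, (minCoord_eq_zero hJ (nn h)).1 h'⟩
  rw [htop]
  have cm : Continuous m := continuous_minCoord I hI
  have cm' : Continuous m' := continuous_minCoord J hJ
  -- The simplex is fibred by segments in the direction `shift I J`. The height of `x` above the
  -- glued faces is `m x`, and `q` moves `x` down until some `I`-coordinate vanishes. From a glued
  -- point `y` one can rise by `d⁻¹ * m' y` before a `J`-coordinate vanishes, so the upper ends are
  -- the faces that do not contain `J`.
  refine hX.attach (isCompact_geom (𝒜 := {t | t ⊆ I ∪ J}) fun s hs t ht _ => ht.trans hs)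
    (isCompact_geom (𝒜 := {t | t ⊆ I ∪ J ∧ ¬ I ⊆ t}) fun s hs t ht _ => ⟨ht.trans hs.1, fun h => hs.2 (h.trans ht)⟩)
    (isCompact_geom hℋ) ?_ ?_ cm.continuousOn (f := fun y => d⁻¹ * m' y) ?_ ?_ ?_ ?_ ?_ ?_ ?_ ?_ ?_
  · rw [geom_inter]
    refine geom_congr fun t ht => ?_
    constructor
    · rintro ⟨h, h'⟩; exact ⟨h', (h𝒳 t h' ht).1 h⟩
    · rintro ⟨h, h'⟩; exact ⟨(h𝒳 t h ht).2 h', h⟩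
  · exact (continuous_pi fun v => (continuous_apply v).add
      (cm.neg.mul continuous_const)).continuousOn
  · exact (continuous_const.mul cm').continuousOn
  · intro x hx
    rw [memG, mI]
    refine ⟨hmv hx (by linarith) ?_, by ring⟩
    have h1 : 0 ≤ m x := minCoord_nonneg hI (nn hx)
    have h2 : 0 ≤ m' x := minCoord_nonneg hJ (nn hx)
    nlinarith
  · intro x hx; exact minCoord_nonneg hI (nn hx)
  · intro x hx
    simp only [mJ]
    have h2 : 0 ≤ m' x := minCoord_nonneg hJ (nn hx)
    have : d⁻¹ * (m' x + -(d * -m x)) = d⁻¹ * m' x + m x := by field_simp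
    rw [this]
    have := mul_nonneg (inv_nonneg.2 hd0.le) h2
    linarith
  · intro x _ y _ e e'
    ext v
    have := congrFun e v
    simp only [e'] at this
    linarith
  · intro y hy t ht0 ht
    rw [memG] at hy
    have ht' : d * t ≤ m' y := by rwa [inv_mul_eq_div, le_div_iff₀' hd0] at ht
    refine ⟨fun v => y v + t * shift I J v, hmv hy.1 ?_ ht', ?_, ?_⟩
    · rw [hy.2]; linarith
    · rw [mI, hy.2]
      ext v; ring
    · rw [mI, hy.2, zero_add]
  · intro x hx
    rw [memG] at hx
    refine ⟨?_, hx.2⟩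
    ext v
    rw [hx.2]; ring
  · intro y hy
    exact mul_nonneg (inv_nonneg.2 hd0.le) (minCoord_nonneg hJ (nn hy))
  · intro y hy
    rw [mul_eq_zero_iff_left (inv_ne_zero hd0.ne'), minCoord_eq_zero hJ (nn hy),
      ← hH _ hy.2.1 (supp_nonempty hy.1) hy.2.2]
    exact ⟨fun h => h.2, fun h => ⟨hy.1, h⟩⟩

end Geom

end SphereComplex

/-! ### Simplices are balls -/

namespace SphereComplex
open Set Metric Topology

set_option linter.unusedSectionVars false

/-- The corner simplex of `ℝ^n` is a ball. -/
lemma isBallPair_corner (n : ℕ) :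
    IsBallPair n {y : EuclideanSpace ℝ (Fin n) | (∀ i, 0 ≤ y i) ∧ ∑ i, y i ≤ 1}
      {y | ((∀ i, 0 ≤ y i) ∧ ∑ i, y i ≤ 1) ∧ ((∃ i, y i = 0) ∨ ∑ i, y i = 1)} := by
  set T : Set (EuclideanSpace ℝ (Fin n)) := {y | (∀ i, 0 ≤ y i) ∧ ∑ i, y i ≤ 1} with hT
  have hsum : Continuous fun y : EuclideanSpace ℝ (Fin n) => ∑ i, y i := by fun_prop
  have hcoord : ∀ i, Continuous fun y : EuclideanSpace ℝ (Fin n) => y i := fun i => by fun_prop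
  have hclosed : IsClosed T := by
    have : T = (⋂ i, {y | 0 ≤ y i}) ∩ {y | ∑ i, y i ≤ 1} := by
      ext y; simp [hT]
    rw [this]
    exact (isClosed_iInter fun i => isClosed_le continuous_const (hcoord i)).inter
      (isClosed_le hsum continuous_const)
  have hconv : Convex ℝ T := by
    rintro x ⟨hx, hx'⟩ y ⟨hy, hy'⟩ a b ha hb hab
    refine ⟨fun i => ?_, ?_⟩
    · simp only [PiLp.add_apply, PiLp.smul_apply, smul_eq_mul]
      exact add_nonneg (mul_nonneg ha (hx i)) (mul_nonneg hb (hy i))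
    · simp only [PiLp.add_apply, PiLp.smul_apply, smul_eq_mul, Finset.sum_add_distrib,
        ← Finset.mul_sum]
      nlinarith
  have hbdd : Bornology.IsBounded T := by
    refine (isBounded_iff_forall_norm_le).2 ⟨√n, fun y hy => ?_⟩
    rw [EuclideanSpace.norm_eq]
    refine Real.sqrt_le_sqrt ?_
    have : ∀ i ∈ Finset.univ, ‖y i‖ ^ 2 ≤ (1 : ℝ) := fun i _ => by
      have h1 : y i ≤ 1 :=
        (Finset.single_le_sum (fun j _ => hy.1 j) (Finset.mem_univ i)).trans hy.2
      rw [Real.norm_of_nonneg (hy.1 i)]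
      nlinarith [hy.1 i]
    simpa using Finset.sum_le_sum this
  have hint : interior T = {y | (∀ i, 0 < y i) ∧ ∑ i, y i < 1} := by
    apply Subset.antisymm
    · intro y hy
      have hyT := interior_subset hy
      rw [mem_interior_iff_mem_nhds] at hy
      -- A point with a zero coordinate leaves `T` when that coordinate is lowered slightly; a point
      -- with coordinate sum 1 leaves it when scaled up slightly.
      refine ⟨fun i => (hyT.1 i).lt_of_ne' fun h0 => ?_, hyT.2.lt_of_ne fun h1 => ?_⟩
      · have hc : Filter.Tendsto (fun t : ℝ => y - t • EuclideanSpace.single i (1 : ℝ)) (𝓝 0)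
            (𝓝 y) := by
          have : Continuous fun t : ℝ => y - t • EuclideanSpace.single i (1 : ℝ) := by fun_prop
          simpa using this.tendsto 0
        obtain ⟨ε, hε, h⟩ := Metric.mem_nhds_iff.1 (hc hy)
        have := (h (show ε / 2 ∈ ball (0 : ℝ) ε by
          rw [mem_ball_zero_iff, Real.norm_of_nonneg (by linarith)]; linarith)).1 i
        simp [h0] at this
        linarith
      · have hc : Filter.Tendsto (fun t : ℝ => (1 + t) • y) (𝓝 0) (𝓝 y) := by
          have : Continuous fun t : ℝ => (1 + t) • y := by fun_prop
          simpa using this.tendsto 0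
        obtain ⟨ε, hε, h⟩ := Metric.mem_nhds_iff.1 (hc hy)
        have := (h (show ε / 2 ∈ ball (0 : ℝ) ε by
          rw [mem_ball_zero_iff, Real.norm_of_nonneg (by linarith)]; linarith)).2
        simp only [PiLp.smul_apply, smul_eq_mul, ← Finset.mul_sum, h1] at this
        linarith
    · refine interior_maximal (fun y hy => ⟨fun i => (hy.1 i).le, hy.2.le⟩) ?_
      have : {y : EuclideanSpace ℝ (Fin n) | (∀ i, 0 < y i) ∧ ∑ i, y i < 1}
          = (⋂ i, {y | 0 < y i}) ∩ {y | ∑ i, y i < 1} := by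
        ext y; simp
      rw [this]
      exact (isOpen_iInter_of_finite fun i => isOpen_lt continuous_const (hcoord i)).inter
        (isOpen_lt hsum continuous_const)
  have hne : (interior T).Nonempty := by
    rw [hint]
    refine ⟨WithLp.toLp 2 fun _ => ((n : ℝ) + 1)⁻¹, fun i => by positivity, ?_⟩
    simp only [Finset.sum_const, Finset.card_univ, Fintype.card_fin, nsmul_eq_mul]
    rw [← div_eq_mul_inv, div_lt_one (by positivity)]
    linarith
  -- A bounded convex set with nonempty interior is turned into the unit ball by a homeomorphism of
  -- the whole space.
  obtain ⟨h, -, hcl, hfr⟩ := exists_homeomorph_image_interior_closure_frontier_eq_unitBall hconv hne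
    hbdd
  rw [hclosed.closure_eq] at hcl
  refine ⟨h, ⟨isCompact_of_isClosed_isBounded hclosed hbdd, h.continuous.continuousOn, ?_⟩,
    fun y hy => hy.1, ?_⟩
  · rw [← hcl]; exact h.injective.injOn.bijOn_image
  · intro y hy
    rw [← mem_sphere_zero_iff_norm, ← hfr, h.injective.mem_set_image, hclosed.frontier_eq, hint]
    constructor
    · rintro ⟨-, h⟩
      refine ⟨hy, fun h' => ?_⟩
      rcases h with ⟨i, hi⟩ | h
      · exact (h'.1 i).ne' hi
      · exact h'.2.ne h
    · rintro ⟨-, h⟩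
      refine ⟨hy, ?_⟩
      by_contra hn
      push Not at hn
      exact h ⟨fun i => (hy.1 i).lt_of_ne' (hn.1 i), hy.2.lt_of_ne hn.2⟩

lemma IsBallPair.of_isHomeoOn {E F : Type*} [TopologicalSpace E] [TopologicalSpace F] {n : ℕ}
    {X A : Set E} {Y B : Set F} (hY : IsBallPair n Y B) {g : E → F} (hg : IsHomeoOn g X Y)
    (hA : A ⊆ X) (h : ∀ x ∈ X, (x ∈ A ↔ g x ∈ B)) : IsBallPair n X A := by
  obtain ⟨ψ, hψ, -, hψB⟩ := hY
  exact ⟨ψ ∘ g, hψ.comp hg, hA, fun x hx => (h x hx).trans (hψB _ (hg.bij.mapsTo hx))⟩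

/-- A simplex with its boundary is a ball. -/
lemma isBallPair_simplex {V : Type} [Fintype V] [DecidableEq V] {n : ℕ} {s : Finset V}
    (hs : s.card = n + 1) :
    IsBallPair n (geom {t | t ⊆ s}) (geom {t | t ⊆ s ∧ ¬ s ⊆ t}) := by
  obtain ⟨v₀, hv₀⟩ : s.Nonempty := Finset.card_pos.1 (by omega)
  have hc : (s.erase v₀).card = n := by rw [Finset.card_erase_of_mem hv₀, hs]; rfl
  let e : Fin n ≃ s.erase v₀ := ((s.erase v₀).equivFinOfCardEq hc).symm
  have hsum : ∀ x : V → ℝ, ∑ i, x (e i) = ∑ v ∈ s.erase v₀, x v := by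
    intro x
    rw [← Finset.sum_coe_sort (s.erase v₀)]
    exact Equiv.sum_comp e fun v : s.erase v₀ => x v
  have hsplit : ∀ x ∈ geom {t : Finset V | t ⊆ s}, ∑ i, x (e i) = 1 - x v₀ := by
    intro x hx
    rw [hsum, eq_sub_iff_add_eq, Finset.sum_erase_add _ _ hv₀, ← hx.1.2]
    refine Finset.sum_subset (Finset.subset_univ _) fun v _ hv => ?_
    rw [← notMem_supp]; exact fun h => hv (hx.2 h)
  have hcov : ∀ v ∈ s, v = v₀ ∨ ∃ i, v = e i := by
    intro v hv
    by_cases h : v = v₀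
    · exact Or.inl h
    · exact Or.inr ⟨e.symm ⟨v, Finset.mem_erase.2 ⟨h, hv⟩⟩, by simp⟩
  have hes : ∀ i, (e i : V) ∈ s := fun i => Finset.mem_of_mem_erase (e i).2
  have hev : ∀ i, (e i : V) ≠ v₀ := fun i => Finset.ne_of_mem_erase (e i).2
  -- Forgetting the coordinate at `v₀`, which is 1 minus the sum of the others, identifies the
  -- simplex with the corner simplex.
  let g : (V → ℝ) → EuclideanSpace ℝ (Fin n) := fun x => WithLp.toLp 2 fun i => x (e i)
  have hg : Continuous g :=
    (PiLp.continuous_toLp 2 _).comp (continuous_pi fun i => continuous_apply _)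
  refine (isBallPair_corner n).of_isHomeoOn (g := g)
    ⟨isCompact_geom (𝒜 := {t | t ⊆ s}) fun a ha b hb _ => hb.trans ha, hg.continuousOn, ?_, ?_, ?_⟩
    (geom_mono fun t ht => ht.1) ?_
  · intro x hx
    refine ⟨fun i => hx.1.1 _, ?_⟩
    have := hsplit x hx
    have h0 := hx.1.1 v₀
    simp only [g]
    linarith
  · intro x hx y hy h
    have hi : ∀ i, x (e i) = y (e i) := fun i => congrArg (fun z => z i) h
    ext v
    by_cases hv : v ∈ s
    · rcases hcov v hv with rfl | ⟨i, rfl⟩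
      · have h1 := hsplit x hx
        have h2 := hsplit y hy
        simp_rw [hi] at h1
        linarith
      · exact hi i
    · rw [notMem_supp.1 fun h => hv (hx.2 h), notMem_supp.1 fun h => hv (hy.2 h)]
  · rintro y ⟨hy0, hy1⟩
    let x : V → ℝ := fun v => if h : v ∈ s.erase v₀ then y (e.symm ⟨v, h⟩)
      else if v = v₀ then 1 - ∑ i, y i else 0
    have hxe : ∀ i, x (e i) = y i := by
      intro i
      simp only [x]
      rw [dif_pos (e i).2]
      simp
    have hx0 : x v₀ = 1 - ∑ i, y i := by simp [x]
    have hxs : ∀ v ∉ s, x v = 0 := by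
      intro v hv
      simp only [x]
      rw [dif_neg fun h => hv (Finset.mem_of_mem_erase h), if_neg]
      rintro rfl; exact hv hv₀
    refine ⟨x, ⟨⟨fun v => ?_, ?_⟩, fun v hv => ?_⟩, ?_⟩
    · by_cases hv : v ∈ s
      · rcases hcov v hv with rfl | ⟨i, rfl⟩
        · rw [hx0]; linarith
        · rw [hxe]; exact hy0 i
      · rw [hxs v hv]
    · rw [← Finset.sum_subset (Finset.subset_univ s) fun v _ hv => hxs v hv,
        ← Finset.sum_erase_add _ _ hv₀, ← hsum, hx0]
      simp_rw [hxe]; ring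
    · by_contra hn
      exact mem_supp.1 hv (hxs v hn)
    · ext i; exact hxe i
  · intro x hx
    have key : x ∈ geom {t : Finset V | t ⊆ s ∧ ¬ s ⊆ t} ↔ ∃ v ∈ s, x v = 0 := by
      simp_rw [← notMem_supp, ← Finset.not_subset]
      exact ⟨fun h => h.2.2, fun h => ⟨hx.1, hx.2, h⟩⟩
    have h1 := hsplit x hx
    rw [key]
    constructor
    · rintro ⟨v, hv, h0⟩
      refine ⟨⟨fun i => hx.1.1 _, ?_⟩, ?_⟩
      · have h0 := hx.1.1 v₀
        simp only [g]
        linarith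
      · rcases hcov v hv with rfl | ⟨i, rfl⟩
        · right; simp only [g]; linarith
        · exact Or.inl ⟨i, h0⟩
    · rintro ⟨-, ⟨i, hi⟩ | h⟩
      · exact ⟨_, hes i, hi⟩
      · refine ⟨v₀, hv₀, ?_⟩
        simp only [g] at h
        linarith

end SphereComplex

/-! ### Homeomorphisms of stratified balls -/

namespace SphereComplex
open Set Metric Topology

set_option linter.unusedSectionVars false

lemma IsBallPair.isCompact {E : Type*} [TopologicalSpace E] {n : ℕ} {X A : Set E}
    (h : IsBallPair n X A) : IsCompact X := h.choose_spec.1.compact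

/-- Two families of balls, indexed by the subsets of `τ` and with matching incidences, that agree
along `A`, are related by a homeomorphism that respects the families and fixes `A`. -/
lemma exists_stratified_extension {V E : Type*} [DecidableEq V] [TopologicalSpace E] [T2Space E]
    [Nonempty E] (τ : Finset V) (X Y : Finset V → Set E) {A : Set E} (hA : IsCompact A)
    (hX : ∀ ρ ⊆ τ, ∀ ρ' ⊆ τ, X ρ ∩ X ρ' = X (ρ ∪ ρ'))
    (hY : ∀ ρ ⊆ τ, ∀ ρ' ⊆ τ, Y ρ ∩ Y ρ' = Y (ρ ∪ ρ'))
    (hXY : ∀ ρ ⊆ τ, ∀ x ∈ A, (x ∈ X ρ ↔ x ∈ Y ρ))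
    (ball : ∀ ρ ⊆ τ, ∃ n, IsBallPair n (X ρ) (X ρ ∩ A ∪ ⋃ y ∈ τ \ ρ, X (insert y ρ)) ∧
      IsBallPair n (Y ρ) (Y ρ ∩ A ∪ ⋃ y ∈ τ \ ρ, Y (insert y ρ))) :
    ∃ h : E → E, IsHomeoOn h (A ∪ X ∅) (A ∪ Y ∅) ∧ EqOn h id A ∧
      ∀ ρ ⊆ τ, ∀ x ∈ A ∪ X ∅, (x ∈ X ρ ↔ h x ∈ Y ρ) := by
  have mono : ∀ Z : Finset V → Set E, (∀ ρ ⊆ τ, ∀ ρ' ⊆ τ, Z ρ ∩ Z ρ' = Z (ρ ∪ ρ')) →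
      ∀ ρ ρ', ρ' ⊆ τ → ρ ⊆ ρ' → Z ρ' ⊆ Z ρ := by
    intro Z hZ ρ ρ' hρ' h
    rw [← Finset.union_eq_right.2 h, ← hZ ρ (h.trans hρ') ρ' hρ']
    exact inter_subset_left
  -- When all strictly smaller strata have been treated, the boundary of `Z ρ` is exactly where it
  -- meets `A` and the treated strata.
  have bdry : ∀ Z : Finset V → Set E, (∀ ρ ⊆ τ, ∀ ρ' ⊆ τ, Z ρ ∩ Z ρ' = Z (ρ ∪ ρ')) →
      ∀ (𝒰 : Finset (Finset V)) (ρ), ρ ⊆ τ → (∀ ρ' ∈ 𝒰, ρ' ⊆ τ ∧ ¬ ρ' ⊆ ρ) →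
      (∀ y ∈ τ \ ρ, insert y ρ ∈ 𝒰) →
      Z ρ ∩ A ∪ ⋃ y ∈ τ \ ρ, Z (insert y ρ) = Z ρ ∩ (A ∪ ⋃ ρ' ∈ 𝒰, Z ρ') := by
    intro Z hZ 𝒰 ρ hρ h𝒰 hy
    rw [inter_union_distrib_left]
    congr 1
    ext x
    simp only [mem_iUnion, mem_inter_iff, exists_prop]
    constructor
    · rintro ⟨y, hyτ, hx⟩
      have := (h𝒰 _ (hy y hyτ)).1
      exact ⟨mono Z hZ _ _ this (Finset.subset_insert _ _) hx, _, hy y hyτ, hx⟩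
    · rintro ⟨hx, ρ', hρ', hx'⟩
      obtain ⟨y, hyρ', hyρ⟩ := Finset.not_subset.1 (h𝒰 ρ' hρ').2
      refine ⟨y, Finset.mem_sdiff.2 ⟨(h𝒰 ρ' hρ').1 hyρ', hyρ⟩, ?_⟩
      have hmem : x ∈ Z (ρ ∪ ρ') := by rw [← hZ ρ hρ ρ' (h𝒰 ρ' hρ').1]; exact ⟨hx, hx'⟩
      refine mono Z hZ _ _ (Finset.union_subset hρ (h𝒰 ρ' hρ').1) ?_ hmem
      exact Finset.insert_subset (Finset.mem_union_right _ hyρ') Finset.subset_union_left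
  -- Larger `ρ` means a smaller stratum, so the homeomorphism is built over upward closed
  -- collections of index sets, down to `∅`.
  suffices H : ∀ 𝒰 : Finset (Finset V), (∀ ρ ∈ 𝒰, ρ ⊆ τ) →
      (∀ ρ ∈ 𝒰, ∀ ρ' ⊆ τ, ρ ⊆ ρ' → ρ' ∈ 𝒰) →
      ∃ h : E → E, IsHomeoOn h (A ∪ ⋃ ρ ∈ 𝒰, X ρ) (A ∪ ⋃ ρ ∈ 𝒰, Y ρ) ∧ EqOn h id A ∧
        ∀ ρ ⊆ τ, ∀ x ∈ A ∪ ⋃ ρ ∈ 𝒰, X ρ, (x ∈ X ρ ↔ h x ∈ Y ρ) by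
    have full : ∀ Z : Finset V → Set E, (∀ ρ ⊆ τ, ∀ ρ' ⊆ τ, Z ρ ∩ Z ρ' = Z (ρ ∪ ρ')) →
        ⋃ ρ ∈ τ.powerset, Z ρ = Z ∅ := by
      intro Z hZ
      apply Subset.antisymm
      · exact iUnion₂_subset fun ρ hρ =>
          mono Z hZ _ _ (Finset.mem_powerset.1 hρ) (Finset.empty_subset _)
      · exact subset_biUnion_of_mem (u := Z) (Finset.empty_mem_powerset τ)
    have := H τ.powerset (fun ρ => Finset.mem_powerset.1)
      (fun ρ _ ρ' h _ => Finset.mem_powerset.2 h)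
    rwa [full X hX, full Y hY] at this
  intro 𝒰
  induction 𝒰 using Finset.strongInduction with
  | H 𝒰 ih =>
    intro h𝒰 hup
    rcases 𝒰.eq_empty_or_nonempty with rfl | hne
    · refine ⟨id, ⟨by simpa using hA, continuousOn_id, by simpa using bijOn_id A⟩,
        fun _ _ => rfl, fun ρ hρ x hx => hXY ρ hρ x (by simpa using hx)⟩
    -- An index of minimal cardinality can be removed without destroying upward closure; its stratum
    -- is added last.
    obtain ⟨ρ, hρ, hmin⟩ := 𝒰.exists_min_image Finset.card hne
    have hρτ := h𝒰 ρ hρ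
    set 𝒰' := 𝒰.erase ρ
    have h𝒰' : ∀ ρ' ∈ 𝒰', ρ' ⊆ τ ∧ ¬ ρ' ⊆ ρ := by
      intro ρ' hρ'
      rw [Finset.mem_erase] at hρ'
      exact ⟨h𝒰 _ hρ'.2, fun h => hρ'.1 (Finset.eq_of_subset_of_card_le h (hmin _ hρ'.2))⟩
    have hy : ∀ y ∈ τ \ ρ, insert y ρ ∈ 𝒰' := by
      intro y hy
      rw [Finset.mem_sdiff] at hy
      refine Finset.mem_erase.2 ⟨Finset.insert_ne_self.2 hy.2, hup ρ hρ _ ?_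
        (Finset.subset_insert _ _)⟩
      exact Finset.insert_subset hy.1 hρτ
    obtain ⟨h, hh, hid, hstr⟩ := ih 𝒰' (Finset.erase_ssubset hρ) (fun ρ' h => (h𝒰' ρ' h).1)
      (fun ρ' hρ' ρ'' h h' => Finset.mem_erase.2
        ⟨fun e => (h𝒰' ρ' hρ').2 (e ▸ h'), hup ρ' (Finset.mem_of_mem_erase hρ') _ h h'⟩)
    obtain ⟨n, bX, bY⟩ := ball ρ hρτ
    rw [bdry X hX 𝒰' ρ hρτ h𝒰' hy] at bX
    rw [bdry Y hY 𝒰' ρ hρτ h𝒰' hy] at bY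
    -- Respect for strata makes the map already built restrict to a homeomorphism between the
    -- boundaries of `X ρ` and `Y ρ`, which is then extended over the balls.
    have hd : IsHomeoOn h (X ρ ∩ (A ∪ ⋃ ρ' ∈ 𝒰', X ρ')) (Y ρ ∩ (A ∪ ⋃ ρ' ∈ 𝒰', Y ρ')) :=
      hh.restrict (bX.isCompact.inter hh.compact) inter_subset_right inter_subset_right
        fun x hx => by
          rw [mem_inter_iff, mem_inter_iff, hstr ρ hρτ x hx]
          exact and_congr_right fun _ => ⟨fun _ => hh.bij.mapsTo hx, fun _ => hx⟩
    obtain ⟨k, hk, hkh, hkd⟩ := exists_extension_of_isBallPair bX bY hd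
    obtain ⟨f, hf, fh, fk⟩ := hh.union hk (fun x hx => (hkh ⟨hx.2, hx.1⟩).symm)
      (fun x hx x' hx' e => (hstr ρ hρτ x hx).2 (e ▸ hk.bij.mapsTo hx'))
    have hU : ∀ Z : Finset V → Set E, A ∪ ⋃ ρ' ∈ 𝒰, Z ρ' = (A ∪ ⋃ ρ' ∈ 𝒰', Z ρ') ∪ Z ρ := by
      intro Z
      rw [← Finset.insert_erase hρ, Finset.set_biUnion_insert, union_assoc, union_comm (Z ρ)]
    rw [hU X, hU Y]
    refine ⟨f, hf, fun x hx => (fh (Or.inl hx)).trans (hid hx), ?_⟩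
    intro ρ' hρ' x hx
    by_cases hxU : x ∈ A ∪ ⋃ ρ' ∈ 𝒰', X ρ'
    · rw [fh hxU]; exact hstr ρ' hρ' x hxU
    have hxρ : x ∈ X ρ := hx.resolve_left hxU
    have hyρ : k x ∈ Y ρ := hk.bij.mapsTo hxρ
    have hyU : k x ∉ A ∪ ⋃ ρ' ∈ 𝒰', Y ρ' := fun hc =>
      hxU ((hkd x hxρ).2 ⟨hyρ, hc⟩).2
    rw [fk hxρ]
    by_cases hsub : ρ' ⊆ ρ
    · exact ⟨fun _ => mono Y hY _ _ hρτ hsub hyρ, fun _ => mono X hX _ _ hρτ hsub hxρ⟩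
    have hmem : ρ ∪ ρ' ∈ 𝒰' := by
      refine Finset.mem_erase.2 ⟨fun e => hsub (Finset.union_eq_left.1 e), hup ρ hρ _
        (Finset.union_subset hρτ hρ') Finset.subset_union_left⟩
    constructor
    · intro hx'
      refine absurd (Or.inr ?_) hxU
      exact mem_biUnion hmem (hX ρ hρτ ρ' hρ' ▸ ⟨hxρ, hx'⟩ : x ∈ X (ρ ∪ ρ'))
    · intro hy'
      refine absurd (Or.inr ?_) hyU
      exact mem_biUnion hmem (hY ρ hρτ ρ' hρ' ▸ ⟨hyρ, hy'⟩ : k x ∈ Y (ρ ∪ ρ'))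

/-! ### Flag complexes, links and reflections -/

section Complex

variable {V : Type} {K : AbstractSimplicialComplex V}

lemma skeleton_adj [DecidableEq V] {x y : V} :
    (skeleton K).Adj x y ↔ x ≠ y ∧ {x, y} ∈ K.faces := by
  refine and_congr_right fun _ => ⟨?_, fun h => ⟨_, h, by simp⟩⟩
  rintro ⟨s, hs, e⟩
  have : s = {x, y} := by rw [← Finset.coe_inj, e]; simp
  exact this ▸ hs

lemma face_subset {s t : Finset V} (hs : s ∈ K.faces) (h : t ⊆ s) (ht : t.Nonempty) :
    t ∈ K.faces := (K.isRelLowerSet_faces hs).2 h ht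

lemma face_nonempty {s : Finset V} (hs : s ∈ K.faces) : s.Nonempty := (K.isRelLowerSet_faces hs).1

lemma adj_of_mem_face {s : Finset V} (hs : s ∈ K.faces) {x y : V} (hx : x ∈ s) (hy : y ∈ s)
    (h : x ≠ y) : (skeleton K).Adj x y := by
  classical
  refine skeleton_adj.2 ⟨h, face_subset hs ?_ (by simp)⟩
  intro z hz
  rcases Finset.mem_insert.1 hz with rfl | hz
  · exact hx
  · rwa [Finset.mem_singleton.1 hz]

lemma IsFlag.mem_faces (hK : IsFlag K) {s : Finset V} :
    s ∈ K.faces ↔ s.Nonempty ∧ ∀ x ∈ s, ∀ y ∈ s, x ≠ y → (skeleton K).Adj x y :=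
  ⟨fun h => ⟨face_nonempty h, fun _ hx _ hy => adj_of_mem_face h hx hy⟩,
    fun h => hK s h.1 fun x hx y hy => h.2 x hx y hy⟩

variable [DecidableEq V]

variable (K) in
/-- The simplices disjoint from `σ` whose union with `ρ` is a simplex. -/
def linkFamily (σ ρ : Finset V) : Set (Finset V) := {t | Disjoint t σ ∧ t ∪ ρ ∈ K.faces}

lemma linkFamily_lower {σ ρ : Finset V} :
    ∀ s ∈ linkFamily K σ ρ, ∀ t ⊆ s, t.Nonempty → t ∈ linkFamily K σ ρ := by
  rintro s ⟨h, h'⟩ t hts ht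
  exact ⟨Finset.disjoint_of_subset_left hts h, face_subset h' (Finset.union_subset_union_left hts)
    (ht.mono Finset.subset_union_left)⟩

lemma IsFlag.union_mem (hK : IsFlag K) {a b c : Finset V} (ha : a.Nonempty) (hab : a ∪ b ∈ K.faces)
    (hac : a ∪ c ∈ K.faces) (hbc : b ∪ c ∈ K.faces) : a ∪ (b ∪ c) ∈ K.faces := by
  rw [hK.mem_faces] at *
  refine ⟨ha.mono Finset.subset_union_left, ?_⟩
  have h1 := hab.2
  have h2 := hac.2
  have h3 := hbc.2
  simp only [Finset.mem_union] at *
  rintro x (hx | hx | hx) y (hy | hy | hy) hxy <;>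
    first | exact h1 x (by tauto) y (by tauto) hxy | exact h2 x (by tauto) y (by tauto) hxy
          | exact h3 x (by tauto) y (by tauto) hxy

variable [Fintype V]

variable (K) in
/-- The complement of the open stars of the vertices of a simplex `σ = τ ∪ {w}` is homeomorphic to
the part of the closed star of `w` that avoids `τ`, by a homeomorphism that fixes the common points
and respects the links of the vertices of `τ`. -/
def HasReflectionAt (τ : Finset V) (w : V) : Prop :=
  ∃ h : (V → ℝ) → V → ℝ,
    IsHomeoOn h (geom (linkFamily K (insert w τ) ∅)) (geom (linkFamily K τ {w})) ∧
    (∀ x ∈ geom (linkFamily K (insert w τ) {w}), h x = x) ∧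
    ∀ y ∈ τ, ∀ x ∈ geom (linkFamily K (insert w τ) ∅),
      (supp x ∪ {y} ∈ K.faces ↔ supp (h x) ∪ {y} ∈ K.faces)

variable (K) in
/-- Every simplex of `K` has reflections at its vertices. -/
def HasReflections : Prop :=
  ∀ (τ : Finset V) (w : V), w ∉ τ → insert w τ ∈ K.faces → HasReflectionAt K τ w

lemma geom_iUnion {ι : Type*} (I : Finset ι) (f : ι → Set (Finset V)) :
    ⋃ i ∈ I, geom (f i) = geom (⋃ i ∈ I, f i) := by
  ext x
  simp only [geom, mem_iUnion, mem_ofPred_eq, exists_prop]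
  constructor
  · rintro ⟨i, hi, h, h'⟩; exact ⟨h, i, hi, h'⟩
  · rintro ⟨h, i, hi, h'⟩; exact ⟨i, hi, h, h'⟩

/-- The strata are the points that can be joined to `ρ`, taken away from `insert w τ` on one side
and in the star of `w` away from `τ` on the other. By flagness they intersect as
`exists_stratified_extension` requires, and the common part `A` is the link of `w` away from `τ`,
where the homeomorphism is the identity. -/
lemma hasReflectionAt_of_balls (hK : IsFlag K) {τ : Finset V} {w : V}
    (hσ : insert w τ ∈ K.faces) (ball : ∀ ρ ⊆ τ, ∃ n,
      IsBallPair n (geom (linkFamily K (insert w τ) ρ))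
        (geom (linkFamily K (insert w τ) (insert w ρ) ∪
          ⋃ y ∈ τ \ ρ, linkFamily K (insert w τ) (insert y ρ))) ∧
      IsBallPair n (geom (linkFamily K τ (insert w ρ)))
        (geom (linkFamily K (insert w τ) (insert w ρ) ∪
          ⋃ y ∈ τ \ ρ, linkFamily K τ (insert w (insert y ρ))))) :
    HasReflectionAt K τ w := by
  set σ := insert w τ with hσd
  have sub : ∀ ρ ⊆ τ, insert w ρ ⊆ σ := fun ρ hρ => Finset.insert_subset_insert _ hρ
  -- Flagness enters here: the subsets of a simplex to which `t` can be joined separately can also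
  -- be joined to it together.
  have memU : ∀ a ⊆ σ, ∀ b ⊆ σ, ∀ t : Finset V, t.Nonempty →
      (t ∪ (a ∪ b) ∈ K.faces ↔ t ∪ a ∈ K.faces ∧ t ∪ b ∈ K.faces) := by
    intro a ha b hb t ht
    constructor
    · intro h
      exact ⟨face_subset h (by grind) (ht.mono (by grind)),
        face_subset h (by grind) (ht.mono (by grind))⟩
    · rintro ⟨h1, h2⟩
      by_cases hab : (a ∪ b).Nonempty
      · exact hK.union_mem ht h1 h2 (face_subset hσ (Finset.union_subset ha hb) hab)
      · rw [Finset.not_nonempty_iff_eq_empty, Finset.union_eq_empty] at hab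
        rw [hab.1] at h1
        rw [hab.1, hab.2]; simpa using h1
  have hwσ : ({w} : Finset V) ⊆ σ := by simp [hσd]
  have hτσ : τ ⊆ σ := Finset.subset_insert _ _
  have hXA : ∀ ρ ⊆ τ, geom (linkFamily K σ ρ) ∩ geom (linkFamily K σ {w}) =
      geom (linkFamily K σ (insert w ρ)) := by
    intro ρ hρ
    rw [geom_inter]
    refine geom_congr fun t ht => ?_
    have := memU {w} hwσ ρ (hρ.trans hτσ) t ht
    rw [← Finset.insert_eq] at this
    simp only [linkFamily, mem_inter_iff, mem_ofPred_eq, this]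
    tauto
  have hYA : ∀ ρ ⊆ τ, geom (linkFamily K τ (insert w ρ)) ∩ geom (linkFamily K σ {w}) =
      geom (linkFamily K σ (insert w ρ)) := by
    intro ρ hρ
    rw [geom_inter]
    refine geom_congr fun t ht => ?_
    have := memU {w} hwσ ρ (hρ.trans hτσ) t ht
    rw [← Finset.insert_eq] at this
    simp only [linkFamily, mem_inter_iff, mem_ofPred_eq, this]
    have : Disjoint t σ → Disjoint t τ := Finset.disjoint_of_subset_right hτσ
    tauto
  obtain ⟨h, hh, hid, hstr⟩ := exists_stratified_extension τ
    (fun ρ => geom (linkFamily K σ ρ)) (fun ρ => geom (linkFamily K τ (insert w ρ)))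
    (A := geom (linkFamily K σ {w})) (isCompact_geom linkFamily_lower)
    (by
      intro ρ hρ ρ' hρ'
      rw [geom_inter]
      refine geom_congr fun t ht => ?_
      have := memU ρ (hρ.trans hτσ) ρ' (hρ'.trans hτσ) t ht
      simp only [linkFamily, mem_inter_iff, mem_ofPred_eq, this]
      tauto)
    (by
      intro ρ hρ ρ' hρ'
      rw [geom_inter]
      refine geom_congr fun t ht => ?_
      have := memU (insert w ρ) (sub ρ hρ) (insert w ρ') (sub ρ' hρ') t ht
      rw [← Finset.insert_union_distrib] at this
      simp only [linkFamily, mem_inter_iff, mem_ofPred_eq, this]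
      tauto)
    (by
      intro ρ hρ x hx
      have h1 : x ∈ _ ∩ _ ↔ x ∈ _ := Set.ext_iff.1 (hXA ρ hρ) x
      have h2 : x ∈ _ ∩ _ ↔ x ∈ _ := Set.ext_iff.1 (hYA ρ hρ) x
      rw [mem_inter_iff] at h1 h2
      tauto)
    (by
      intro ρ hρ
      obtain ⟨n, h1, h2⟩ := ball ρ hρ
      refine ⟨n, ?_, ?_⟩
      · rw [hXA ρ hρ, geom_iUnion, geom_union]; exact h1
      · rw [hYA ρ hρ, geom_iUnion, geom_union]; exact h2)
  -- The common part is contained in both total spaces, so adjoining `A` to the strata indexed by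
  -- `∅` adds nothing.
  have eX : geom (linkFamily K σ {w}) ∪ geom (linkFamily K σ ∅) = geom (linkFamily K σ ∅) := by
    rw [union_eq_right, ← insert_empty_eq w, ← hXA ∅ (Finset.empty_subset _)]
    exact inter_subset_left
  have eY : geom (linkFamily K σ {w}) ∪ geom (linkFamily K τ (insert w ∅)) =
      geom (linkFamily K τ {w}) := by
    rw [insert_empty_eq, union_eq_right, ← insert_empty_eq w, ← hYA ∅ (Finset.empty_subset _)]
    exact inter_subset_left
  simp only [eX, eY] at hh hstr
  refine ⟨h, hh, hid, fun y hy x hx => ?_⟩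
  have hyτ : ({y} : Finset V) ⊆ τ := Finset.singleton_subset_iff.2 hy
  have key := hstr {y} hyτ x hx
  have hyx := hh.bij.mapsTo hx
  have m := memU {w} hwσ {y} (hyτ.trans hτσ) (supp (h x)) (supp_nonempty hyx.1)
  rw [← Finset.insert_eq] at m
  constructor
  · intro hf
    exact (m.1 (key.1 ⟨hx.1, hx.2.1, hf⟩).2.2).2
  · intro hf
    exact (key.2 ⟨hyx.1, hyx.2.1, m.2 ⟨hyx.2.2, hf⟩⟩).2.2

end Complex

/-! ### Invariance of reflections under isomorphism -/

section Transport

variable {V W : Type} {K : AbstractSimplicialComplex V} {L : AbstractSimplicialComplex W}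
  [Fintype V] [Fintype W] [DecidableEq V] [DecidableEq W]

lemma supp_comp_symm (e : V ≃ W) (x : V → ℝ) :
    supp (x ∘ e.symm) = (supp x).map e.toEmbedding := by
  ext w
  rw [mem_supp, Finset.mem_map_equiv, mem_supp]
  rfl

lemma comp_symm_mem_geom (e : V ≃ W) {𝒜 : Set (Finset V)} {ℬ : Set (Finset W)}
    (h : ∀ s, s ∈ 𝒜 ↔ s.map e.toEmbedding ∈ ℬ) {x : V → ℝ} :
    x ∘ e.symm ∈ geom ℬ ↔ x ∈ geom 𝒜 := by
  refine and_congr ?_ ?_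
  · refine and_congr ⟨fun h v => by simpa using h (e v), fun h w => h _⟩ ?_
    rw [show ∑ w, (x ∘ e.symm) w = ∑ v, x v from Equiv.sum_comp e.symm x]
  · rw [supp_comp_symm, ← h]

lemma isHomeoOn_comp_symm (e : V ≃ W) {𝒜 : Set (Finset V)} {ℬ : Set (Finset W)}
    (h : ∀ s, s ∈ 𝒜 ↔ s.map e.toEmbedding ∈ ℬ) (hc : IsCompact (geom 𝒜)) :
    IsHomeoOn (fun x : V → ℝ => x ∘ e.symm) (geom 𝒜) (geom ℬ) := by
  refine ⟨hc, Continuous.continuousOn ?_, fun x hx => (comp_symm_mem_geom e h).2 hx, ?_, ?_⟩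
  · exact continuous_pi fun w => continuous_apply (e.symm w)
  · intro x _ y _ hxy
    exact e.symm.surjective.injective_comp_right hxy
  · intro y hy
    have : (y ∘ e) ∘ e.symm = y := by ext; simp
    exact ⟨y ∘ e, (comp_symm_mem_geom e h).1 (by rwa [this]), this⟩

lemma hasReflectionAt_of_equiv {e : V ≃ W}
    (he : ∀ s : Finset V, s ∈ K.faces ↔ s.map e.toEmbedding ∈ L.faces)
    {τ : Finset V} {w : V} (h : HasReflectionAt L (τ.map e.toEmbedding) (e w)) :
    HasReflectionAt K τ w := by
  have hl : ∀ σ ρ : Finset V, ∀ s, s ∈ linkFamily K σ ρ ↔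
      s.map e.toEmbedding ∈ linkFamily L (σ.map e.toEmbedding) (ρ.map e.toEmbedding) := by
    intro σ ρ s
    simp only [linkFamily, mem_ofPred_eq, Finset.disjoint_map, ← Finset.map_union, he]
  obtain ⟨g, hg, hfix, hstr⟩ := h
  have h1 := hl (insert w τ) ∅
  have h2 := hl (insert w τ) {w}
  have h3 := hl τ {w}
  rw [Finset.map_insert, Finset.map_empty] at h1
  rw [Finset.map_insert, Finset.map_singleton] at h2
  rw [Finset.map_singleton] at h3
  have back : ∀ y : W → ℝ, (y ∘ e) ∘ e.symm = y := fun y => by ext; simp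
  refine ⟨fun x => g (x ∘ e.symm) ∘ e, ?_, ?_, ?_⟩
  · have a1 := isHomeoOn_comp_symm e h1 (isCompact_geom (linkFamily_lower))
    have a3 := (isHomeoOn_comp_symm e h3 (isCompact_geom (linkFamily_lower)))
    have a := hg.comp a1
    refine ⟨a1.compact, ?_, ?_, ?_, ?_⟩
    · exact (continuous_pi fun v => continuous_apply (e v)).comp_continuousOn a.cont
    · intro x hx
      rw [← comp_symm_mem_geom e h3, back]
      exact a.bij.mapsTo hx
    · intro x hx y hy hxy
      exact a.bij.injOn hx hy (e.surjective.injective_comp_right hxy)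
    · intro y hy
      obtain ⟨x, hx, hxy⟩ := a.bij.surjOn ((comp_symm_mem_geom e h3).2 hy)
      refine ⟨x, hx, ?_⟩
      have hxy : g (x ∘ e.symm) = y ∘ e.symm := hxy
      beta_reduce
      rw [hxy]
      ext; simp
  · intro x hx
    beta_reduce
    rw [hfix _ ((comp_symm_mem_geom e h2).2 hx)]
    ext; simp
  · intro y hy x hx
    have := hstr (e y) (Finset.mem_map_of_mem _ hy) _ ((comp_symm_mem_geom e h1).2 hx)
    have hs := supp_comp_symm e (g (x ∘ e.symm) ∘ e)
    rw [back] at hs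
    rw [supp_comp_symm, hs] at this
    rw [he, he, Finset.map_union, Finset.map_union, Finset.map_singleton]
    exact this

end Transport

end SphereComplex

namespace SphereComplex

/-! ### Binary codes of vertex sets and certified shellings -/

section Masks

/-- `List.any`, as a recursor, which the kernel evaluates quickly. -/
noncomputable def anyL (p : ℕ → Bool) (l : List ℕ) : Bool :=
  List.rec (motive := fun _ => Bool) false (fun a _ ih => Bool.rec ih true (p a)) l

/-- `List.all`, as a recursor. -/
noncomputable def allL (p : ℕ → Bool) (l : List ℕ) : Bool :=
  List.rec (motive := fun _ => Bool) true (fun a _ ih => Bool.rec false ih (p a)) l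

/-- `List.filter`, as a recursor. -/
noncomputable def filterL (p : ℕ → Bool) (l : List ℕ) : List ℕ :=
  List.rec (motive := fun _ => List ℕ) [] (fun a _ ih => Bool.rec ih (a :: ih) (p a)) l

/-- `List.map`, as a recursor. -/
noncomputable def mapL (f : ℕ → ℕ) (l : List ℕ) : List ℕ :=
  List.rec (motive := fun _ => List ℕ) [] (fun a _ ih => f a :: ih) l

/-- `List.append`, as a recursor. -/
noncomputable def appendL (l l' : List ℕ) : List ℕ :=
  List.rec (motive := fun _ => List ℕ) l' (fun a _ ih => a :: ih) l

/-- `List.flatMap`, as a recursor. -/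
noncomputable def flatMapL (f : ℕ → List ℕ) (l : List ℕ) : List ℕ :=
  List.rec (motive := fun _ => List ℕ) [] (fun a _ ih => appendL (f a) ih) l

/-- The union of the members of a list of masks. -/
noncomputable def joinL (l : List ℕ) : ℕ :=
  List.rec (motive := fun _ => ℕ) 0 (fun a _ ih => Nat.lor a ih) l

/-- The vertex set encoded by the binary digits of `m`. -/
def ofMask (m : ℕ) : Finset (Fin 12) := Finset.univ.filter fun v => m.testBit v

/-- Inclusion of encoded vertex sets. -/
def maskSub (a b : ℕ) : Bool := Nat.beq (Nat.land (Nat.land a b) 4095) (Nat.land a 4095)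

/-- The one-element subsets of the vertex set encoded by `m`. -/
noncomputable def maskBits (m : ℕ) : List ℕ :=
  filterL (fun p => maskSub p m) [1, 2, 4, 8, 16, 32, 64, 128, 256, 512, 1024, 2048]

lemma anyL_eq (p : ℕ → Bool) (l : List ℕ) : anyL p l = l.any p := by
  induction l with
  | nil => rfl
  | cons a l ih => rw [List.any_cons, ← ih]; cases h : p a <;> simp [anyL, h]

lemma allL_eq (p : ℕ → Bool) (l : List ℕ) : allL p l = l.all p := by
  induction l with
  | nil => rfl
  | cons a l ih => rw [List.all_cons, ← ih]; cases h : p a <;> simp [allL, h]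

lemma filterL_eq (p : ℕ → Bool) (l : List ℕ) : filterL p l = l.filter p := by
  induction l with
  | nil => rfl
  | cons a l ih => rw [List.filter_cons, ← ih]; cases h : p a <;> simp [filterL, h]

lemma mapL_eq (f : ℕ → ℕ) (l : List ℕ) : mapL f l = l.map f := by
  induction l with
  | nil => rfl
  | cons a l ih => rw [List.map_cons, ← ih]; rfl

lemma appendL_eq (l l' : List ℕ) : appendL l l' = l ++ l' := by
  induction l with
  | nil => rfl
  | cons a l ih => rw [List.cons_append, ← ih]; rfl

lemma flatMapL_eq (f : ℕ → List ℕ) (l : List ℕ) : flatMapL f l = l.flatMap f := by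
  induction l with
  | nil => rfl
  | cons a l ih => rw [List.flatMap_cons, ← ih, ← appendL_eq]; rfl

lemma mem_ofMask {m : ℕ} {v : Fin 12} : v ∈ ofMask m ↔ m.testBit v = true := by simp [ofMask]

lemma ofMask_lor (a b : ℕ) : ofMask (Nat.lor a b) = ofMask a ∪ ofMask b := by
  ext v
  rw [Finset.mem_union, mem_ofMask, mem_ofMask, mem_ofMask, ← Bool.or_eq_true]
  exact Bool.eq_iff_iff.1 (Nat.testBit_or a b v)

lemma ofMask_land (a b : ℕ) : ofMask (Nat.land a b) = ofMask a ∩ ofMask b := by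
  ext v
  rw [Finset.mem_inter, mem_ofMask, mem_ofMask, mem_ofMask, ← Bool.and_eq_true]
  exact Bool.eq_iff_iff.1 (Nat.testBit_and a b v)

lemma ofMask_xor {a b : ℕ} (h : ofMask b ⊆ ofMask a) :
    ofMask (Nat.xor a b) = ofMask a \ ofMask b := by
  ext v
  have h1 : (Nat.xor a b).testBit v = (a.testBit v ^^ b.testBit v) := Nat.testBit_xor a b v
  have h2 := @h v
  rw [mem_ofMask, mem_ofMask] at h2
  rw [Finset.mem_sdiff, mem_ofMask, mem_ofMask, mem_ofMask, h1]
  revert h2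
  cases a.testBit v <;> cases b.testBit v <;> simp

lemma ofMask_two_pow (v : Fin 12) : ofMask (2 ^ (v : ℕ)) = {v} := by
  ext w
  rw [mem_ofMask, Nat.testBit_two_pow, Finset.mem_singleton, decide_eq_true_eq, Fin.ext_iff, eq_comm]

/-- Since 4095 is `2 ^ 12 - 1`, the comparison discards the digits beyond the twelve vertices, which
`ofMask` ignores as well. -/
lemma maskSub_iff {a b : ℕ} : maskSub a b = true ↔ ofMask a ⊆ ofMask b := by
  have hb : ∀ m i : ℕ, (Nat.land m 4095).testBit i = (m.testBit i && decide (i < 12)) := by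
    intro m i
    have : (4095 : ℕ) = 2 ^ 12 - 1 := rfl
    rw [this, ← Nat.testBit_two_pow_sub_one]
    exact Nat.testBit_and m _ i
  have hab : ∀ i, (Nat.land a b).testBit i = (a.testBit i && b.testBit i) := Nat.testBit_and a b
  unfold maskSub
  rw [Nat.beq_eq]
  constructor
  · intro h v hv
    rw [mem_ofMask] at *
    have := congrArg (fun m : ℕ => m.testBit v) h
    simp only [hb, hab, hv, v.2] at this
    simpa using this
  · intro h
    refine Nat.eq_of_testBit_eq fun i => ?_
    rw [hb, hb, hab]
    by_cases hi : i < 12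
    · have := @h ⟨i, hi⟩
      rw [mem_ofMask, mem_ofMask] at this
      revert this
      simp only
      cases a.testBit i <;> cases b.testBit i <;> simp
    · simp [hi]

lemma mem_maskBits {m p : ℕ} : p ∈ maskBits m ↔ ∃ v ∈ ofMask m, p = 2 ^ (v : ℕ) := by
  rw [maskBits, filterL_eq, List.mem_filter, maskSub_iff]
  have : p ∈ [1, 2, 4, 8, 16, 32, 64, 128, 256, 512, 1024, 2048] ↔ ∃ v : Fin 12, p = 2 ^ (v : ℕ) := by
    simp [Fin.exists_fin_succ]
  rw [this]
  constructor
  · rintro ⟨⟨v, rfl⟩, h⟩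
    rw [ofMask_two_pow, Finset.singleton_subset_iff] at h
    exact ⟨v, h, rfl⟩
  · rintro ⟨v, h, rfl⟩
    exact ⟨⟨v, rfl⟩, by rwa [ofMask_two_pow, Finset.singleton_subset_iff]⟩

lemma ofMask_xor_bit {m : ℕ} {v : Fin 12} (hv : v ∈ ofMask m) :
    ofMask (Nat.xor m (2 ^ (v : ℕ))) = (ofMask m).erase v := by
  rw [ofMask_xor (by rwa [ofMask_two_pow, Finset.singleton_subset_iff]), ofMask_two_pow,
    Finset.sdiff_singleton_eq_erase]

lemma mem_ofMask_joinL {l : List ℕ} {v : Fin 12} : v ∈ ofMask (joinL l) ↔ ∃ m ∈ l, v ∈ ofMask m := by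
  induction l with
  | nil => simp [joinL, mem_ofMask]
  | cons a l ih =>
    have : joinL (a :: l) = Nat.lor a (joinL l) := rfl
    rw [this, ofMask_lor, Finset.mem_union, ih]
    simp

lemma card_ofMask (m : ℕ) : (ofMask m).card = (maskBits m).length := by
  have hnd : (maskBits m).Nodup := by
    rw [maskBits, filterL_eq]
    exact List.Nodup.filter _ (by decide)
  rw [← List.toFinset_card_of_nodup hnd]
  refine Finset.card_bij (fun v _ => 2 ^ (v : ℕ)) (fun v hv => ?_) (fun v _ w _ h => ?_)
    fun p hp => ?_
  · rw [List.mem_toFinset, mem_maskBits]; exact ⟨v, hv, rfl⟩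
  · exact Fin.ext (Nat.pow_right_injective le_rfl h)
  · rw [List.mem_toFinset, mem_maskBits] at hp
    obtain ⟨v, hv, rfl⟩ := hp
    exact ⟨v, hv, rfl⟩

lemma exists_ofMask (s : Finset (Fin 12)) : ∃ m < 4096, ofMask m = s := by
  induction s using Finset.induction_on with
  | empty => exact ⟨0, by norm_num, by ext v; simp [mem_ofMask]⟩
  | insert v s _ ih =>
    obtain ⟨m, hm, rfl⟩ := ih
    refine ⟨Nat.lor (2 ^ (v : ℕ)) m, ?_, by rw [ofMask_lor, ofMask_two_pow, Finset.insert_eq]⟩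
    exact Nat.or_lt_two_pow (n := 12) (Nat.pow_lt_pow_right (by norm_num) v.2) hm

/-- The family of all subsets of the encoded sets. -/
def maskFamily (L : List ℕ) : Set (Finset (Fin 12)) := {t | ∃ m ∈ L, t ⊆ ofMask m}

lemma maskFamily_lower {L : List ℕ} :
    ∀ s ∈ maskFamily L, ∀ t ⊆ s, t.Nonempty → t ∈ maskFamily L := by
  rintro s ⟨m, hm, h⟩ t hts _
  exact ⟨m, hm, hts.trans h⟩

/-- Attach the simplex `F` to the ball with facets `Xs` and boundary facets `Ds`; the value is the
list of the new boundary facets. -/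
noncomputable def attachMask (Xs Ds : List ℕ) (F : ℕ) : Option (List ℕ) :=
  (fun B => (fun I => (fun mI => (fun J => (fun mJ => (fun H =>
    Bool.rec none (some (appendL H (mapL (Nat.xor F) J)))
      ((!(Nat.beq mI 0)) && ((!(Nat.beq mJ 0)) && (allL (fun X => !(maskSub mI X)) Xs &&
      (allL (fun R => !(maskSub R F) || !(maskSub mI R)) Ds &&
      (allL (fun R => !(maskSub mJ R)) H &&
      allL (fun i => allL (fun j => anyL (maskSub (Nat.xor (Nat.xor F i) j)) H) J) I))))))
    (filterL (fun R => !(maskSub R F)) Ds))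
    (joinL J)) (filterL (fun i => !(anyL (Nat.beq (Nat.xor F i)) Ds)) B))
    (joinL I)) (filterL (fun i => anyL (Nat.beq (Nat.xor F i)) Ds) B))
    (maskBits F)

/-- Attach the pending and the skipped simplices one by one, in any order that works. -/
noncomputable def shellMask : ℕ → List ℕ → List ℕ → List ℕ → List ℕ → Option (List ℕ)
  | 0, _, _, _, _ => none
  | _ + 1, _, Ds, [], [] => some Ds
  | _ + 1, _, _, [], _ :: _ => none
  | k + 1, Xs, Ds, F :: pending, skipped =>
    match attachMask Xs Ds F with
    | some Ds' => shellMask k (F :: Xs) Ds' (appendL skipped pending) []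
    | none => shellMask k Xs Ds pending (F :: skipped)

/-- Whether the facets `L` form a shellable `n`-ball with boundary facets `E`. -/
noncomputable def checkBall (n : ℕ) (L E : List ℕ) : Bool :=
  match L with
  | [] => false
  | F :: rest => (maskBits F).length.beq (n + 1) &&
    match shellMask 200 [F] (mapL (Nat.xor F) (maskBits F)) rest [] with
    | none => false
    | some D => allL (fun d => anyL (maskSub d) E) D && allL (fun e => anyL (maskSub e) D) E


/-- The complex with facets `Xs` is an `n`-ball whose boundary has the facets `Ds`. -/
def IsMaskBall (n : ℕ) (Xs Ds : List ℕ) : Prop :=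
  IsBallPair n (geom (maskFamily Xs)) (geom (maskFamily Ds)) ∧ maskFamily Ds ⊆ maskFamily Xs

/-- The tests in `attachMask` yield the hypotheses of `IsBallPair.attach_simplex`. Here `I` consists
of the vertices of `F` whose opposite facet is in the old boundary, `J` of the remaining ones, and
`H` lists the old boundary facets not contained in `F`. Thus `I` is the smallest new face, and
nonemptiness of `I` and `J` says that `F` is glued along some but not all of its facets. -/
lemma IsMaskBall.attach {n : ℕ} {Xs Ds D : List ℕ} {F : ℕ} (h : IsMaskBall n Xs Ds)
    (hD : attachMask Xs Ds F = some D) : IsMaskBall n (F :: Xs) D := by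
  have split : ∀ {b : Bool} {x : List ℕ}, (Bool.rec none (some x) b : Option (List ℕ)) = some D →
      b = true ∧ x = D := by
    intro b x; cases b <;> simp
  obtain ⟨hc, rfl⟩ := split hD
  clear hD split
  simp only [anyL_eq, allL_eq, filterL_eq, mapL_eq, appendL_eq, Bool.and_eq_true, List.all_eq_true,
    List.any_eq_true, Bool.not_eq_true', Bool.or_eq_true] at hc ⊢
  set Il := (maskBits F).filter fun i => Ds.any (Nat.beq (Nat.xor F i)) with hIl
  set Jl := (maskBits F).filter fun i => !(Ds.any (Nat.beq (Nat.xor F i))) with hJl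
  set H := Ds.filter fun R => !(maskSub R F) with hH
  set I := ofMask (joinL Il) with hI
  set J := ofMask (joinL Jl) with hJ
  have sub' : ∀ a b, maskSub a b = false ↔ ¬ ofMask a ⊆ ofMask b := fun a b => by
    rw [← maskSub_iff, Bool.not_eq_true]
  obtain ⟨hI0, hJ0, hXs, hDs, hHs, hIJ⟩ := hc
  have mI : ∀ v, v ∈ I ↔ v ∈ ofMask F ∧ Nat.xor F (2 ^ (v : ℕ)) ∈ Ds := by
    intro v
    rw [hI, mem_ofMask_joinL]
    simp only [hIl, List.mem_filter, List.any_eq_true, Nat.beq_eq, mem_maskBits]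
    constructor
    · rintro ⟨m, ⟨⟨w, hw, rfl⟩, x, hx, rfl⟩, hv⟩
      rw [ofMask_two_pow, Finset.mem_singleton] at hv
      exact hv ▸ ⟨hw, hx⟩
    · rintro ⟨h1, h2⟩
      exact ⟨_, ⟨⟨v, h1, rfl⟩, _, h2, rfl⟩, by simp [ofMask_two_pow]⟩
  have mJ : ∀ v, v ∈ J ↔ v ∈ ofMask F ∧ Nat.xor F (2 ^ (v : ℕ)) ∉ Ds := by
    intro v
    rw [hJ, mem_ofMask_joinL]
    simp only [hJl, List.mem_filter, Bool.not_eq_true', List.any_eq_false, Nat.beq_eq, mem_maskBits]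
    constructor
    · rintro ⟨m, ⟨⟨w, hw, rfl⟩, hx⟩, hv⟩
      rw [ofMask_two_pow, Finset.mem_singleton] at hv
      exact hv ▸ ⟨hw, fun h => hx _ h rfl⟩
    · rintro ⟨h1, h2⟩
      exact ⟨_, ⟨⟨v, h1, rfl⟩, fun x hx e => h2 (e ▸ hx)⟩, by simp [ofMask_two_pow]⟩
  have bit : ∀ {v : Fin 12}, v ∈ ofMask F → 2 ^ (v : ℕ) ∈ maskBits F := fun h =>
    mem_maskBits.2 ⟨_, h, rfl⟩
  have bI : ∀ {v : Fin 12}, v ∈ I → 2 ^ (v : ℕ) ∈ Il := by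
    intro v hv
    obtain ⟨h1, h2⟩ := (mI v).1 hv
    rw [hIl, List.mem_filter, List.any_eq_true]
    exact ⟨bit h1, _, h2, by rw [Nat.beq_eq]⟩
  have bJ : ∀ {v : Fin 12}, v ∈ J → 2 ^ (v : ℕ) ∈ Jl := by
    intro v hv
    obtain ⟨h1, h2⟩ := (mJ v).1 hv
    rw [hJl, List.mem_filter, Bool.not_eq_true', List.any_eq_false]
    exact ⟨bit h1, fun x hx e => h2 (by rw [Nat.beq_eq] at e; exact e ▸ hx)⟩
  have ne : ∀ {l : List ℕ}, l ⊆ maskBits F → Nat.beq (joinL l) 0 = false →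
      (ofMask (joinL l)).Nonempty := by
    intro l hl h0
    cases l with
    | nil => simp [joinL] at h0
    | cons a l =>
      obtain ⟨v, hv, rfl⟩ := mem_maskBits.1 (hl List.mem_cons_self)
      exact ⟨v, mem_ofMask_joinL.2 ⟨_, List.mem_cons_self, by simp [ofMask_two_pow]⟩⟩
  have hIne : I.Nonempty := ne (List.filter_subset_self _) hI0
  have hJne : J.Nonempty := ne (List.filter_subset_self _) hJ0
  have hdisj : Disjoint I J := Finset.disjoint_left.2 fun v hv hv' =>
    ((mJ v).1 hv').2 ((mI v).1 hv).2
  have hunion : I ∪ J = ofMask F := by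
    ext v; rw [Finset.mem_union, mI, mJ]; tauto
  have faceI : ∀ t : Finset (Fin 12), t ⊆ ofMask F → ¬ I ⊆ t → t ∈ maskFamily Ds := by
    intro t ht hIt
    obtain ⟨i, hi, hit⟩ := Finset.not_subset.1 hIt
    obtain ⟨h1, h2⟩ := (mI i).1 hi
    refine ⟨_, h2, ?_⟩
    rw [ofMask_xor_bit h1]
    exact fun v hv => Finset.mem_erase.2 ⟨fun e => hit (e ▸ hv), ht hv⟩
  have hHDs : maskFamily H ⊆ maskFamily Ds := by
    rintro t ⟨m, hm, ht⟩
    exact ⟨m, (List.mem_filter.1 hm).1, ht⟩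
  have eDs : geom (maskFamily Ds) = geom ({t | t ⊆ I ∪ J ∧ ¬ I ⊆ t} ∪ maskFamily H) := by
    refine geom_congr fun t _ => ⟨?_, ?_⟩
    · rintro ⟨m, hm, ht⟩
      by_cases hmF : ofMask m ⊆ ofMask F
      · left
        refine ⟨hunion ▸ ht.trans hmF, fun hIt => ?_⟩
        rcases hDs m hm with h | h
        · exact (sub' _ _).1 h hmF
        · exact (sub' _ _).1 h (hIt.trans ht)
      · right
        refine ⟨m, List.mem_filter.2 ⟨hm, ?_⟩, ht⟩
        rw [Bool.not_eq_true']
        exact (sub' _ _).2 hmF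
    · rintro (⟨ht, hIt⟩ | ht)
      · exact faceI t (hunion ▸ ht) hIt
      · exact hHDs ht
  obtain ⟨hb, hDX⟩ := h
  rw [eDs] at hb
  have key := hb.attach_simplex hIne hJne hdisj maskFamily_lower
    (by
      intro t ht _
      constructor
      · rintro ⟨m, hm, htm⟩ hIt
        exact (sub' _ _).1 (hXs m hm) (hIt.trans htm)
      · exact fun hIt => hDX (faceI t (hunion ▸ ht) hIt))
    (by
      intro t ht _ hIt
      constructor
      · rintro ⟨m, hm, htm⟩ hJt
        exact (sub' _ _).1 (hHs m hm) (hJt.trans htm)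
      · intro hJt
        obtain ⟨i, hi, hit⟩ := Finset.not_subset.1 hIt
        obtain ⟨j, hj, hjt⟩ := Finset.not_subset.1 hJt
        -- A face that misses `i` and `j` lies in `F` without these two vertices, so it suffices
        -- that each such codimension-two face belongs to the surviving boundary.
        obtain ⟨R, hR, hsub⟩ := hIJ _ (bI hi) _ (bJ hj)
        refine ⟨R, hR, ?_⟩
        rw [maskSub_iff, ofMask_xor_bit, ofMask_xor_bit ((mI i).1 hi).1] at hsub
        · refine fun v hv => hsub ?_
          rw [Finset.mem_erase, Finset.mem_erase]
          exact ⟨fun e => hjt (e ▸ hv), fun e => hit (e ▸ hv), hunion ▸ ht hv⟩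
        · rw [ofMask_xor_bit ((mI i).1 hi).1, Finset.mem_erase]
          exact ⟨fun e => Finset.disjoint_left.1 hdisj hi (e ▸ hj), ((mJ j).1 hj).1⟩)
  have eX : maskFamily (F :: Xs) = maskFamily Xs ∪ {t | t ⊆ I ∪ J} := by
    ext t
    simp only [maskFamily, List.mem_cons, exists_eq_or_imp, Set.mem_union, Set.mem_ofPred_eq, hunion]
    exact or_comm
  have eD : maskFamily (H ++ Jl.map (Nat.xor F)) =
      maskFamily H ∪ {t | t ⊆ I ∪ J ∧ ¬ J ⊆ t} := by
    ext t
    constructor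
    · rintro ⟨m, hm, ht⟩
      rcases List.mem_append.1 hm with hm | hm
      · exact Or.inl ⟨m, hm, ht⟩
      · obtain ⟨p, hp, rfl⟩ := List.mem_map.1 hm
        obtain ⟨j, hj, rfl⟩ := mem_maskBits.1 (List.mem_filter.1 hp).1
        have hjJ : j ∈ J := mem_ofMask_joinL.2 ⟨_, hp, by simp [ofMask_two_pow]⟩
        rw [ofMask_xor_bit hj] at ht
        right
        refine ⟨hunion ▸ ht.trans (Finset.erase_subset _ _), fun hJt => ?_⟩
        exact Finset.notMem_erase j _ (ht (hJt hjJ))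
    · rintro (⟨m, hm, ht⟩ | ⟨ht, hJt⟩)
      · exact ⟨m, List.mem_append_left _ hm, ht⟩
      · obtain ⟨j, hj, hjt⟩ := Finset.not_subset.1 hJt
        refine ⟨_, List.mem_append_right _ (List.mem_map_of_mem (bJ hj)), ?_⟩
        rw [ofMask_xor_bit ((mJ j).1 hj).1]
        exact fun v hv => Finset.mem_erase.2 ⟨fun e => hjt (e ▸ hv), hunion ▸ ht hv⟩
  refine ⟨by rw [eX, eD]; exact key, ?_⟩
  rw [eX, eD]
  exact Set.union_subset_union (hHDs.trans hDX) fun t ht => ht.1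

/-- A failed attachment only postpones a simplex and leaves the ball unchanged, so the search order
needs no justification; a result is returned only when nothing is left over. The number `k` merely
bounds the search. -/
lemma IsMaskBall.shell {n : ℕ} {D : List ℕ} : ∀ (k : ℕ) {Xs Ds pending skipped : List ℕ},
    IsMaskBall n Xs Ds → shellMask k Xs Ds pending skipped = some D →
    ∃ Ys, IsMaskBall n Ys D ∧ ∀ m, m ∈ Ys ↔ m ∈ Xs ∨ m ∈ pending ∨ m ∈ skipped
  | 0, _, _, _, _, _, h => by simp [shellMask] at h
  | k + 1, Xs, Ds, [], [], hb, h => by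
    simp only [shellMask, Option.some.injEq] at h
    exact ⟨Xs, h ▸ hb, by simp⟩
  | k + 1, _, _, [], _ :: _, _, h => by simp [shellMask] at h
  | k + 1, Xs, Ds, F :: pending, skipped, hb, h => by
    rw [shellMask] at h
    cases hF : attachMask Xs Ds F with
    | some D' =>
      rw [hF] at h
      obtain ⟨Ys, hY, hm⟩ := IsMaskBall.shell k (hb.attach hF) h
      refine ⟨Ys, hY, fun m => ?_⟩
      rw [hm, appendL_eq]
      simp only [List.mem_cons, List.mem_append, List.not_mem_nil]
      tauto
    | none =>
      rw [hF] at h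
      obtain ⟨Ys, hY, hm⟩ := IsMaskBall.shell k hb h
      refine ⟨Ys, hY, fun m => ?_⟩
      rw [hm]
      simp only [List.mem_cons]
      tauto

lemma isMaskBall_singleton {n F : ℕ} (h : (maskBits F).length = n + 1) :
    IsMaskBall n [F] (mapL (Nat.xor F) (maskBits F)) := by
  have e1 : maskFamily [F] = {t | t ⊆ ofMask F} := by
    ext t; simp [maskFamily]
  have e2 : maskFamily (mapL (Nat.xor F) (maskBits F)) =
      {t | t ⊆ ofMask F ∧ ¬ ofMask F ⊆ t} := by
    ext t
    rw [mapL_eq]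
    constructor
    · rintro ⟨m, hm, ht⟩
      obtain ⟨p, hp, rfl⟩ := List.mem_map.1 hm
      obtain ⟨v, hv, rfl⟩ := mem_maskBits.1 hp
      rw [ofMask_xor_bit hv] at ht
      exact ⟨ht.trans (Finset.erase_subset _ _), fun h => Finset.notMem_erase v _ (ht (h hv))⟩
    · rintro ⟨ht, hn⟩
      obtain ⟨v, hv, hvt⟩ := Finset.not_subset.1 hn
      refine ⟨_, List.mem_map_of_mem (mem_maskBits.2 ⟨v, hv, rfl⟩), ?_⟩
      rw [ofMask_xor_bit hv]
      exact fun w hw => Finset.mem_erase.2 ⟨fun e => hvt (e ▸ hw), ht hw⟩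
  refine ⟨?_, ?_⟩
  · rw [e1, e2]; exact isBallPair_simplex (by rw [card_ofMask, h])
  · rw [e1, e2]; exact fun t ht => ht.1

/-- The boundary list produced by the search may differ from `E`: the two lists generate the same
family once each member of either is contained in a member of the other. -/
lemma isBallPair_of_checkBall {n : ℕ} {L E : List ℕ} (h : checkBall n L E = true) :
    IsBallPair n (geom (maskFamily L)) (geom (maskFamily E)) := by
  cases L with
  | nil => simp [checkBall] at h
  | cons F rest =>
    rw [checkBall, Bool.and_eq_true, Nat.beq_eq] at h
    obtain ⟨hF, h⟩ := h
    cases hs : shellMask 200 [F] (mapL (Nat.xor F) (maskBits F)) rest [] with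
    | none => rw [hs] at h; simp at h
    | some D =>
      rw [hs] at h
      simp only [allL_eq, anyL_eq, Bool.and_eq_true, List.all_eq_true, List.any_eq_true,
        maskSub_iff] at h
      obtain ⟨Ys, hY, hm⟩ := (isMaskBall_singleton hF).shell 200 hs
      have eL : maskFamily Ys = maskFamily (F :: rest) := by
        ext t
        simp only [maskFamily, hm, List.not_mem_nil, or_false, List.mem_cons]
      have eD : maskFamily D = maskFamily E := by
        ext t
        constructor
        · rintro ⟨m, hm, ht⟩
          obtain ⟨e, he, hs⟩ := h.1 m hm
          exact ⟨e, he, ht.trans hs⟩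
        · rintro ⟨m, hm, ht⟩
          obtain ⟨e, he, hs⟩ := h.2 m hm
          exact ⟨e, he, ht.trans hs⟩
      rw [← eL, ← eD]
      exact hY.1

end Masks

end SphereComplex

namespace SphereComplex

/-! ### The finite computations for $T_{12}$ -/

section Twelve

/-- The facets of `T₁₂`, with the vertices `a_i` numbered `i` and `b_r` numbered `9 + r`. -/
def facetMasks : List ℕ :=
  [15, 263, 2059, 387, 2179, 1037, 1285, 1097, 2121, 449, 2241, 1345, 30, 534, 774, 2074, 658, 2194,
    898, 60, 1068, 564, 804, 1316, 120, 2136, 1128, 240, 688, 2256, 480, 1376, 928]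

/-- The facets of the family of simplices disjoint from `σ` that form a simplex with `ρ`. -/
noncomputable def linkMasks (σ ρ : ℕ) : List ℕ :=
  mapL (fun F => Nat.xor F (Nat.land F σ))
    (filterL (fun F => maskSub ρ F && maskSub (Nat.land F σ) ρ) facetMasks)

/-- The subsets of the union of a list of one-element sets. -/
noncomputable def subsetMasks (l : List ℕ) : List ℕ :=
  List.rec (motive := fun _ => List ℕ) [0] (fun v _ ih => appendL ih (mapL (Nat.lor v) ih)) l

/-- The stratum is the link of `ρ` without the open stars of the other vertices of `σ`, whence the
dimension 3 minus the size of `ρ`; its boundary consists of the strata with one more vertex of `σ`.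
For `ρ = σ` nothing is removed from the link, a ball is not to be expected, and none is needed. -/
noncomputable def checkAntistar (σ ρ : ℕ) : Bool :=
  Nat.beq σ ρ || checkBall (3 - (maskBits ρ).length) (linkMasks σ ρ)
    (flatMapL (fun y => linkMasks σ (Nat.lor ρ y)) (maskBits (Nat.xor σ ρ)))

/-- Simplices of this stratum may contain `w`: it is the cone with apex `w` over the stratum away
from `σ` for `ρ ∪ {w}`. Its boundary is the base together with the cones belonging to one more
vertex of `τ`. -/
noncomputable def checkStar (σ τ w ρ : ℕ) : Bool :=
  checkBall (3 - (maskBits ρ).length) (linkMasks τ (Nat.lor ρ w))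
    (appendL (linkMasks σ (Nat.lor ρ w))
      (flatMapL (fun y => linkMasks τ (Nat.lor (Nat.lor ρ y) w)) (maskBits (Nat.xor τ ρ))))

noncomputable def checkBalls (σ : ℕ) : Bool :=
  allL (checkAntistar σ) (subsetMasks (maskBits σ)) &&
    allL (fun w => allL (checkStar σ (Nat.xor σ w) w) (subsetMasks (maskBits (Nat.xor σ w))))
      (maskBits σ)

/-- The rotation of `T₁₂` that maps `a_i` to `a_(i+1)`, on encoded vertices. -/
noncomputable def rotateBit (p : ℕ) : ℕ :=
  cond (Nat.beq p 256) 1 (cond (Nat.beq p 2048) 512 (Nat.mul 2 p))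

/-- The rotation of `T₁₂`, on encoded vertex sets. -/
noncomputable def rotateMask (m : ℕ) : ℕ := joinL (mapL rotateBit (maskBits m))

/-- The first images of a vertex set under the powers of the rotation. -/
noncomputable def orbitMasks (k : ℕ) : ℕ → List ℕ :=
  Nat.rec (motive := fun _ => ℕ → List ℕ) (fun m => [m]) (fun _ ih m => m :: ih (rotateMask m)) k

/-- The ball pairs are checked only for the simplices whose code is minimal in its orbit. -/
noncomputable def checkFace (σ : ℕ) : Bool :=
  !(anyL (maskSub σ) facetMasks) || (anyL (fun n => Nat.blt n σ) (orbitMasks 8 σ) || checkBalls σ)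

/-- The neighbours of a vertex. -/
noncomputable def closedNeighbours (p : ℕ) : ℕ := joinL (filterL (maskSub p) facetMasks)

noncomputable def maskClique (m : ℕ) : Bool :=
  allL (fun p => maskSub m (closedNeighbours p)) (maskBits m)

/-- Whether a clique is a facet or extends by either of two vertices that are not adjacent. -/
noncomputable def checkExtension (m : ℕ) : Bool :=
  !(maskClique m) || (anyL (Nat.beq m) facetMasks || anyL (fun a => !(maskSub a m) &&
    (maskClique (Nat.lor m a) && anyL (fun b => !(maskSub b m) &&
      (!(maskSub b (closedNeighbours a)) && maskClique (Nat.lor m b))) (maskBits 4095)))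
    (maskBits 4095))

set_option maxRecDepth 100000 in
lemma checkFace_all : allL checkFace (List.range 4096) = true := by decide +kernel

set_option maxRecDepth 100000 in
lemma checkBalls_one : checkBalls 1 = true := by decide +kernel

set_option maxRecDepth 100000 in
lemma checkExtension_all : allL checkExtension (List.range 4096) = true := by decide +kernel

end Twelve

end SphereComplex

namespace SphereComplex

/-! ### The graph, its facet list and its rotation -/

section Twelve

instance : DecidableRel graphTwelve.Adj
  | .inl i, .inl j => inferInstanceAs (Decidable (i - j ∈ ({1, 2, 3, -1, -2, -3} : Finset (ZMod 9))))
  | .inl i, .inr r => inferInstanceAs (Decidable ((i.cast : ZMod 3) ≠ r))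
  | .inr r, .inl i => inferInstanceAs (Decidable ((i.cast : ZMod 3) ≠ r))
  | .inr _, .inr _ => inferInstanceAs (Decidable False)

/-- The numbering of the vertices of `T₁₂`. -/
def vertexTwelve : Fin 12 ≃ ZMod 9 ⊕ ZMod 3 :=
  (finSumFinEquiv (m := 9) (n := 3)).symm

/-- The 1-skeleton of `T₁₂`, on numbered vertices. -/
def graphFin : SimpleGraph (Fin 12) := graphTwelve.comap vertexTwelve

instance : DecidableRel graphFin.Adj := fun x y =>
  inferInstanceAs (Decidable (graphTwelve.Adj (vertexTwelve x) (vertexTwelve y)))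

/-- This ties the explicit list of facets to the defined graph, so that cliques can be recognized
from the list. -/
lemma graphFin_adj : ∀ x y : Fin 12, graphFin.Adj x y ↔ x ≠ y ∧
    facetMasks.any (fun F => F.testBit x && F.testBit y) = true := by decide +kernel

lemma exists_facet_self : ∀ x : Fin 12, facetMasks.any (fun F => F.testBit x) = true := by
  decide +kernel

lemma facet_length : facetMasks.all (fun F => (maskBits F).length.beq 4) = true := by
  decide +kernel

lemma graphFin_square : ∀ x y : Fin 12, graphFin.Adj x y → ∃ z t : Fin 12, graphFin.Adj y z ∧
    graphFin.Adj z t ∧ graphFin.Adj t x ∧ x ≠ z ∧ ¬ graphFin.Adj x z ∧ y ≠ t ∧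
    ¬ graphFin.Adj y t := by decide +kernel

/-- The rotation of `T₁₂` that maps `a_i` to `a_(i+1)`. -/
def rotation : Equiv.Perm (Fin 12) where
  toFun := ![1, 2, 3, 4, 5, 6, 7, 8, 0, 10, 11, 9]
  invFun := ![8, 0, 1, 2, 3, 4, 5, 6, 7, 11, 9, 10]
  left_inv := by decide
  right_inv := by decide

lemma graphFin_rotation : ∀ x y : Fin 12,
    graphFin.Adj x y ↔ graphFin.Adj (rotation x) (rotation y) := by decide +kernel

lemma rotateBit_two_pow : ∀ v : Fin 12, rotateBit (2 ^ (v : ℕ)) = 2 ^ (rotation v : ℕ) := by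
  decide +kernel

lemma ofMask_rotateMask (m : ℕ) : ofMask (rotateMask m) = (ofMask m).map rotation.toEmbedding := by
  ext v
  simp only [rotateMask, mem_ofMask_joinL, mapL_eq, List.mem_map, mem_maskBits, Finset.mem_map,
    Equiv.coe_toEmbedding]
  constructor
  · rintro ⟨_, ⟨_, ⟨x, hx, rfl⟩, rfl⟩, hv⟩
    rw [rotateBit_two_pow, ofMask_two_pow, Finset.mem_singleton] at hv
    exact ⟨x, hx, hv.symm⟩
  · rintro ⟨x, hx, rfl⟩
    exact ⟨_, ⟨_, ⟨x, hx, rfl⟩, rfl⟩, by rw [rotateBit_two_pow, ofMask_two_pow]; simp⟩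

lemma exists_perm_of_mem_orbitMasks {k : ℕ} : ∀ {m n : ℕ}, n ∈ orbitMasks k m →
    ∃ e : Equiv.Perm (Fin 12), (∀ x y, graphFin.Adj x y ↔ graphFin.Adj (e x) (e y)) ∧
      ofMask n = (ofMask m).map e.toEmbedding := by
  induction k with
  | zero =>
    intro m n h
    obtain rfl : n = m := List.mem_singleton.1 h
    exact ⟨Equiv.refl _, fun _ _ => Iff.rfl, by simp⟩
  | succ k ih =>
    intro m n h
    rcases List.mem_cons.1 h with rfl | h
    · exact ⟨Equiv.refl _, fun _ _ => Iff.rfl, by simp⟩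
    · obtain ⟨e, he, h⟩ := ih h
      refine ⟨rotation.trans e, fun x y => (graphFin_rotation x y).trans (he _ _), ?_⟩
      rw [h, ofMask_rotateMask, Finset.map_map]
      rfl

end Twelve

end SphereComplex

namespace SphereComplex

/-! ### $T_{12}$ is a sphere with reflections -/

section Twelve

/-- `T₁₂`, on numbered vertices. -/
def complexFin : AbstractSimplicialComplex (Fin 12) := cliqueComplex graphFin

lemma skeleton_cliqueComplex {V : Type} (G : SimpleGraph V) : skeleton (cliqueComplex G) = G := by
  classical
  ext x y
  rw [skeleton_adj]
  constructor
  · rintro ⟨hxy, -, h⟩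
    exact h (by simp) (by simp) hxy
  · intro h
    refine ⟨h.ne, by simp, ?_⟩
    rw [Finset.coe_pair, SimpleGraph.isClique_pair]
    exact fun _ => h

lemma isFlag_cliqueComplex {V : Type} (G : SimpleGraph V) : IsFlag (cliqueComplex G) := by
  intro s hs h
  rw [skeleton_cliqueComplex] at h
  exact ⟨hs, h⟩

lemma mem_complexFin {s : Finset (Fin 12)} : s ∈ complexFin.faces ↔ s.Nonempty ∧
    ∀ x ∈ s, ∀ y ∈ s, ∃ F ∈ facetMasks, x ∈ ofMask F ∧ y ∈ ofMask F := by
  refine and_congr_right fun _ => ⟨fun h x hx y hy => ?_, fun h x hx y hy hxy => ?_⟩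
  · by_cases hxy : x = y
    · subst hxy
      obtain ⟨F, hF, h⟩ := List.any_eq_true.1 (exists_facet_self x)
      exact ⟨F, hF, mem_ofMask.2 h, mem_ofMask.2 h⟩
    · obtain ⟨F, hF, h⟩ := List.any_eq_true.1 ((graphFin_adj x y).1 (h hx hy hxy)).2
      rw [Bool.and_eq_true] at h
      exact ⟨F, hF, mem_ofMask.2 h.1, mem_ofMask.2 h.2⟩
  · obtain ⟨F, hF, h1, h2⟩ := h x hx y hy
    refine (graphFin_adj x y).2 ⟨hxy, List.any_eq_true.2 ⟨F, hF, ?_⟩⟩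
    rw [Bool.and_eq_true]
    exact ⟨mem_ofMask.1 h1, mem_ofMask.1 h2⟩

lemma mem_closedNeighbours {x y : Fin 12} : y ∈ ofMask (closedNeighbours (2 ^ (x : ℕ))) ↔
    ∃ F ∈ facetMasks, x ∈ ofMask F ∧ y ∈ ofMask F := by
  simp only [closedNeighbours, mem_ofMask_joinL, filterL_eq, List.mem_filter, maskSub_iff,
    ofMask_two_pow, Finset.singleton_subset_iff, and_assoc]

lemma maskClique_iff {m : ℕ} : maskClique m = true ↔
    ∀ x ∈ ofMask m, ∀ y ∈ ofMask m, ∃ F ∈ facetMasks, x ∈ ofMask F ∧ y ∈ ofMask F := by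
  simp only [maskClique, allL_eq, List.all_eq_true, maskSub_iff, mem_maskBits]
  constructor
  · intro h x hx y hy
    exact mem_closedNeighbours.1 (h _ ⟨x, hx, rfl⟩ hy)
  · rintro h _ ⟨x, hx, rfl⟩ y hy
    exact mem_closedNeighbours.2 (h x hx y hy)

/-- A clique extends to a facet that contains no further vertex of a given clique. -/
lemma exists_facet (σ : Finset (Fin 12))
    (hσ : ∀ x ∈ σ, ∀ y ∈ σ, ∃ F ∈ facetMasks, x ∈ ofMask F ∧ y ∈ ofMask F) :
    ∀ s : Finset (Fin 12),
      (∀ x ∈ s, ∀ y ∈ s, ∃ F ∈ facetMasks, x ∈ ofMask F ∧ y ∈ ofMask F) →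
      ∃ F ∈ facetMasks, s ⊆ ofMask F ∧ ofMask F ∩ σ ⊆ s := by
  -- Induction on the number of vertices outside `s`, since a clique that is not a facet is enlarged
  -- by one vertex.
  suffices H : ∀ k, ∀ s : Finset (Fin 12), sᶜ.card = k →
      (∀ x ∈ s, ∀ y ∈ s, ∃ F ∈ facetMasks, x ∈ ofMask F ∧ y ∈ ofMask F) →
      ∃ F ∈ facetMasks, s ⊆ ofMask F ∧ ofMask F ∩ σ ⊆ s from fun s => H _ s rfl
  intro k
  induction k with
  | zero =>
    intro s hs h
    obtain ⟨m, hm, rfl⟩ := exists_ofMask s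
    have := allL_eq _ _ ▸ checkExtension_all
    rw [List.all_eq_true] at this
    have hc := this m (List.mem_range.2 hm)
    rw [checkExtension, maskClique_iff.2 h] at hc
    simp only [anyL_eq, Bool.not_true, Bool.false_or, Bool.or_eq_true, List.any_eq_true,
      Bool.and_eq_true, Bool.not_eq_true', ← Bool.not_eq_true, maskSub_iff, Nat.beq_eq] at hc
    rcases hc with ⟨F, hF, rfl⟩ | ⟨a, -, ha, -⟩
    · exact ⟨_, hF, subset_rfl, Finset.inter_subset_left⟩
    · rw [Finset.card_eq_zero, Finset.compl_eq_empty_iff] at hs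
      exact absurd (hs ▸ Finset.subset_univ _) ha
  | succ k ih =>
    intro s hs h
    obtain ⟨m, hm, rfl⟩ := exists_ofMask s
    have := allL_eq _ _ ▸ checkExtension_all
    rw [List.all_eq_true] at this
    have hc := this m (List.mem_range.2 hm)
    rw [checkExtension, maskClique_iff.2 h] at hc
    simp only [anyL_eq, Bool.not_true, Bool.false_or, Bool.or_eq_true, List.any_eq_true,
      Bool.and_eq_true, Bool.not_eq_true', ← Bool.not_eq_true, maskSub_iff, Nat.beq_eq] at hc
    rcases hc with ⟨F, hF, rfl⟩ | ⟨a, ha, ham, hma, b, hb, hbm, hba, hmb⟩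
    · exact ⟨_, hF, subset_rfl, Finset.inter_subset_left⟩
    · obtain ⟨a, -, rfl⟩ := mem_maskBits.1 ha
      obtain ⟨b, -, rfl⟩ := mem_maskBits.1 hb
      rw [ofMask_two_pow, Finset.singleton_subset_iff] at ham hbm hba
      rw [mem_closedNeighbours] at hba
      have step : ∀ c : Fin 12, c ∉ ofMask m → c ∉ σ →
          maskClique (Nat.lor m (2 ^ (c : ℕ))) = true →
          ∃ F ∈ facetMasks, ofMask m ⊆ ofMask F ∧ ofMask F ∩ σ ⊆ ofMask m := by
        intro c hcm hcσ hc
        rw [maskClique_iff] at hc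
        obtain ⟨F, hF, h1, h2⟩ := ih _ (by
          rw [ofMask_lor, ofMask_two_pow, Finset.union_comm, ← Finset.insert_eq,
            Finset.compl_insert, Finset.card_erase_of_mem (Finset.mem_compl.2 hcm), hs]
          rfl) hc
        rw [ofMask_lor, ofMask_two_pow] at h1 h2
        refine ⟨F, hF, Finset.subset_union_left.trans h1, fun x hx => ?_⟩
        rcases Finset.mem_union.1 (h2 hx) with h | h
        · exact h
        · rw [Finset.mem_singleton] at h
          exact absurd (h ▸ (Finset.mem_inter.1 hx).2) hcσ
      -- The two candidates `a` and `b` are not adjacent, so the clique `σ` cannot contain both; the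
      -- clique is extended by one outside `σ`.
      by_cases haσ : a ∈ σ
      · exact step b hbm (fun hbσ => hba (hσ a haσ b hbσ)) hmb
      · exact step a ham haσ hma

/-- If `t` avoids `σ`, the facet given by `exists_facet` for `t ∪ ρ` meets `σ` only inside `ρ`.
Hence the facets that contain `ρ` and meet `σ` only in `ρ`, with `σ` removed, generate the whole
family. -/
lemma linkFamily_eq {σ ρ : ℕ} (hσ : ofMask σ = ∅ ∨ ofMask σ ∈ complexFin.faces) :
    geom (linkFamily complexFin (ofMask σ) (ofMask ρ)) = geom (maskFamily (linkMasks σ ρ)) := by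
  refine geom_congr fun t ht => ?_
  have hσ' : ∀ x ∈ ofMask σ, ∀ y ∈ ofMask σ, ∃ F ∈ facetMasks, x ∈ ofMask F ∧ y ∈ ofMask F := by
    rcases hσ with h | h
    · simp [h]
    · exact (mem_complexFin.1 h).2
  have hF : ∀ F, ofMask (Nat.xor F (Nat.land F σ)) = ofMask F \ ofMask σ := by
    intro F
    rw [ofMask_xor (by rw [ofMask_land]; exact Finset.inter_subset_left), ofMask_land,
      Finset.sdiff_inter_self_left]
  constructor
  · rintro ⟨hd, hf⟩
    obtain ⟨F, hFm, h1, h2⟩ := exists_facet _ hσ' _ (mem_complexFin.1 hf).2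
    refine ⟨Nat.xor F (Nat.land F σ), ?_, ?_⟩
    · rw [linkMasks, mapL_eq, filterL_eq]
      refine List.mem_map_of_mem (List.mem_filter.2 ⟨hFm, ?_⟩)
      rw [Bool.and_eq_true, maskSub_iff, maskSub_iff, ofMask_land]
      refine ⟨Finset.subset_union_right.trans h1, fun x hx => ?_⟩
      exact (Finset.mem_union.1 (h2 hx)).resolve_left fun h =>
        Finset.disjoint_left.1 hd h (Finset.mem_inter.1 hx).2
    · rw [hF]
      exact fun x hx => Finset.mem_sdiff.2 ⟨h1 (Finset.mem_union_left _ hx),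
        Finset.disjoint_left.1 hd hx⟩
  · rintro ⟨m, hm, htm⟩
    rw [linkMasks, mapL_eq, filterL_eq] at hm
    obtain ⟨F, hFm, rfl⟩ := List.mem_map.1 hm
    rw [List.mem_filter, Bool.and_eq_true, maskSub_iff] at hFm
    rw [hF] at htm
    refine ⟨Finset.disjoint_left.2 fun x hx => (Finset.mem_sdiff.1 (htm hx)).2, ?_⟩
    have hsub : t ∪ ofMask ρ ⊆ ofMask F :=
      Finset.union_subset (fun x hx => (Finset.mem_sdiff.1 (htm hx)).1) hFm.2.1
    exact mem_complexFin.2 ⟨ht.mono Finset.subset_union_left,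
      fun x hx y hy => ⟨F, hFm.1, hsub hx, hsub hy⟩⟩

lemma mem_subsetMasks {m : ℕ} {ρ : Finset (Fin 12)} (h : ρ ⊆ ofMask m) :
    ∃ k ∈ subsetMasks (maskBits m), ofMask k = ρ := by
  have key : ∀ (l : List ℕ) (ρ : Finset (Fin 12)), (∀ p ∈ l, ∃ v : Fin 12, p = 2 ^ (v : ℕ)) →
      (∀ v ∈ ρ, 2 ^ (v : ℕ) ∈ l) → ∃ k ∈ subsetMasks l, ofMask k = ρ := by
    intro l
    induction l with
    | nil =>
      intro ρ _ hρ
      refine ⟨0, by simp [subsetMasks], ?_⟩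
      have : ρ = ∅ := Finset.eq_empty_of_forall_notMem fun v hv => by simpa using hρ v hv
      rw [this]; ext v; simp [mem_ofMask]
    | cons p l ih =>
      intro ρ hl hρ
      obtain ⟨v, rfl⟩ := hl p List.mem_cons_self
      have e : subsetMasks (2 ^ (v : ℕ) :: l) =
          subsetMasks l ++ (subsetMasks l).map (Nat.lor (2 ^ (v : ℕ))) := by
        rw [← mapL_eq, ← appendL_eq]; rfl
      obtain ⟨k, hk, hkρ⟩ := ih (ρ.erase v) (fun q hq => hl q (List.mem_cons_of_mem _ hq))
        (fun w hw => by
          rw [Finset.mem_erase] at hw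
          refine (List.mem_cons.1 (hρ w hw.2)).resolve_left fun h => hw.1 ?_
          exact Fin.ext (Nat.pow_right_injective le_rfl h))
      by_cases hv : v ∈ ρ
      · refine ⟨Nat.lor (2 ^ (v : ℕ)) k, ?_, ?_⟩
        · rw [e]; exact List.mem_append_right _ (List.mem_map_of_mem hk)
        · rw [ofMask_lor, ofMask_two_pow, hkρ, ← Finset.insert_eq, Finset.insert_erase hv]
      · exact ⟨k, by rw [e]; exact List.mem_append_left _ hk, by
          rw [hkρ, Finset.erase_eq_of_notMem hv]⟩
  refine key _ _ (fun p hp => ?_) fun v hv => mem_maskBits.2 ⟨v, h hv, rfl⟩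
  obtain ⟨v, -, rfl⟩ := mem_maskBits.1 hp
  exact ⟨v, rfl⟩

lemma geom_maskFamily_append {L L' : List ℕ} : geom (maskFamily (appendL L L')) =
    geom (maskFamily L) ∪ geom (maskFamily L') := by
  rw [geom_union, appendL_eq]
  congr 1
  ext t
  simp only [maskFamily, List.mem_append, Set.mem_union, Set.mem_ofPred_eq, or_and_right, exists_or]

lemma geom_maskFamily_flatMap {f : ℕ → List ℕ} {m : ℕ} {s : Finset (Fin 12)} (hs : ofMask m = s) :
    geom (maskFamily (flatMapL f (maskBits m))) =
      ⋃ y ∈ s, geom (maskFamily (f (2 ^ (y : ℕ)))) := by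
  subst hs
  rw [geom_iUnion, flatMapL_eq]
  congr 1
  ext t
  simp only [maskFamily, List.mem_flatMap, mem_maskBits, Set.mem_iUnion, Set.mem_ofPred_eq]
  constructor
  · rintro ⟨k, ⟨_, ⟨y, hy, rfl⟩, hk⟩, ht⟩; exact ⟨y, hy, k, hk, ht⟩
  · rintro ⟨y, hy, k, hk, ht⟩; exact ⟨k, ⟨_, ⟨y, hy, rfl⟩, hk⟩, ht⟩

lemma isBallPair_antistar {m : ℕ} (hb : checkBalls m = true) {σ : Finset (Fin 12)}
    (hmσ : ofMask m = σ) (hσ : σ ∈ complexFin.faces) {ρ : Finset (Fin 12)}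
    (hρ : ρ ⊂ σ) : IsBallPair (3 - ρ.card) (geom (linkFamily complexFin σ ρ))
      (⋃ y ∈ σ \ ρ, geom (linkFamily complexFin σ (insert y ρ))) := by
  subst hmσ
  simp only [checkBalls, allL_eq, Bool.and_eq_true, List.all_eq_true] at hb
  obtain ⟨hm, -⟩ := hb
  obtain ⟨k, hk, rfl⟩ := mem_subsetMasks hρ.1
  have hc := hm k hk
  rw [checkAntistar, Bool.or_eq_true, Nat.beq_eq] at hc
  have hne : m ≠ k := by rintro rfl; exact hρ.ne rfl
  have := isBallPair_of_checkBall (hc.resolve_left hne)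
  rw [geom_maskFamily_flatMap (ofMask_xor hρ.1), ← linkFamily_eq (Or.inr hσ), ← card_ofMask] at this
  simp only [← linkFamily_eq (Or.inr hσ), ofMask_lor, ofMask_two_pow] at this
  convert this using 7
  rw [Finset.union_comm, Finset.insert_eq]

lemma isBallPair_star {m : ℕ} (hb : checkBalls m = true) {τ : Finset (Fin 12)} {w : Fin 12}
    (hmσ : ofMask m = insert w τ) (hw : w ∉ τ) (hσ : insert w τ ∈ complexFin.faces) {ρ : Finset (Fin 12)} (hρ : ρ ⊆ τ) :
    IsBallPair (3 - ρ.card) (geom (linkFamily complexFin τ (insert w ρ)))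
      (geom (linkFamily complexFin (insert w τ) (insert w ρ)) ∪
        ⋃ y ∈ τ \ ρ, geom (linkFamily complexFin τ (insert w (insert y ρ)))) := by
  simp only [checkBalls, allL_eq, Bool.and_eq_true, List.all_eq_true] at hb
  obtain ⟨-, hm⟩ := hb
  have hwm : w ∈ ofMask m := hmσ ▸ Finset.mem_insert_self _ _
  have eτ : ofMask (Nat.xor m (2 ^ (w : ℕ))) = τ := by
    rw [ofMask_xor_bit hwm, hmσ, Finset.erase_insert hw]
  obtain ⟨k, hk, rfl⟩ := mem_subsetMasks (eτ ▸ hρ : ρ ⊆ ofMask (Nat.xor m (2 ^ (w : ℕ))))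
  have hc := hm _ (mem_maskBits.2 ⟨w, hwm, rfl⟩) k hk
  have hτ' : ofMask (Nat.xor m (2 ^ (w : ℕ))) = ∅ ∨
      ofMask (Nat.xor m (2 ^ (w : ℕ))) ∈ complexFin.faces := by
    rw [eτ]
    rcases τ.eq_empty_or_nonempty with h | h
    · exact Or.inl h
    · exact Or.inr (face_subset hσ (Finset.subset_insert _ _) h)
  have hσ' : ofMask m = ∅ ∨ ofMask m ∈ complexFin.faces := Or.inr (hmσ ▸ hσ)
  have := isBallPair_of_checkBall hc
  rw [geom_maskFamily_append,
    geom_maskFamily_flatMap (s := τ \ ofMask k) (by rw [ofMask_xor (eτ ▸ hρ), eτ]),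
    ← linkFamily_eq hτ', ← linkFamily_eq hσ', ← card_ofMask] at this
  simp only [← linkFamily_eq hτ', ofMask_lor, ofMask_two_pow, eτ, hmσ] at this
  convert this using 8
  · rw [Finset.union_comm, Finset.insert_eq]
  · rw [Finset.union_comm, Finset.insert_eq]
  · rw [Finset.insert_eq, Finset.insert_eq, Finset.union_comm, Finset.union_comm {_}]

lemma hasReflectionAt_of_checkBalls {m : ℕ} (hb : checkBalls m = true) {τ : Finset (Fin 12)}
    {w : Fin 12} (hmσ : ofMask m = insert w τ) (hw : w ∉ τ) (hσ : insert w τ ∈ complexFin.faces) :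
    HasReflectionAt complexFin τ w := by
  refine hasReflectionAt_of_balls (isFlag_cliqueComplex _) hσ fun ρ hρ => ⟨3 - ρ.card, ?_, ?_⟩
  · have := isBallPair_antistar hb hmσ hσ (ρ := ρ)
      ⟨hρ.trans (Finset.subset_insert _ _), fun h => hw (hρ (h (Finset.mem_insert_self _ _)))⟩
    -- The antistar boundary is indexed by all of `insert w τ \ ρ`; splitting off `w` isolates the
    -- part shared with the star.
    rwa [Finset.insert_sdiff_of_notMem _ fun h => hw (hρ h), Finset.set_biUnion_insert, geom_iUnion,
      geom_union] at this
  · have := isBallPair_star hb hmσ hw hσ hρ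
    rwa [geom_iUnion, geom_union] at this

/-- Strong induction on the code of the simplex: if some rotated copy has a smaller code, its
reflection is transported back; otherwise the kernel has checked the balls directly. -/
lemma hasReflections_complexFin : HasReflections complexFin := by
  suffices H : ∀ k, ∀ m < k, m < 4096 → ∀ τ w, ofMask m = insert w τ → w ∉ τ →
      insert w τ ∈ complexFin.faces → HasReflectionAt complexFin τ w by
    intro τ w hw hσ
    obtain ⟨m, hm, h⟩ := exists_ofMask (insert w τ)
    exact H _ m hm hm τ w h hw hσ
  intro k
  induction k with
  | zero => intro m hm; omega
  | succ k ih =>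
    intro m hmk hm τ w hmσ hw hσ
    have := allL_eq _ _ ▸ checkFace_all
    rw [List.all_eq_true] at this
    have hc := this m (List.mem_range.2 hm)
    obtain ⟨F, hF, h1, -⟩ := exists_facet ∅ (by simp) _ (mem_complexFin.1 hσ).2
    have ha : anyL (maskSub m) facetMasks = true := by
      rw [anyL_eq, List.any_eq_true]
      exact ⟨F, hF, maskSub_iff.2 (hmσ ▸ h1)⟩
    rw [checkFace, ha, Bool.not_true, Bool.false_or, Bool.or_eq_true, anyL_eq,
      List.any_eq_true] at hc
    rcases hc with ⟨n, hn, hnm⟩ | hb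
    · rw [Nat.blt_eq] at hnm
      obtain ⟨e, he, h⟩ := exists_perm_of_mem_orbitMasks hn
      have hmap : ∀ s : Finset (Fin 12),
          s ∈ complexFin.faces ↔ s.map e.toEmbedding ∈ complexFin.faces := by
        intro s
        refine and_congr Finset.map_nonempty.symm ?_
        simp only [SimpleGraph.IsClique, Finset.coe_map,
          e.toEmbedding.injective.injOn.pairwise_image]
        simp [Set.Pairwise, Function.onFun, ← he]
      refine hasReflectionAt_of_equiv hmap (ih n (by omega) (by omega) _ _ ?_ (by simpa using hw) ?_)
      · rw [h, hmσ, Finset.map_insert]; rfl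
      · have := (hmap _).1 hσ
        rwa [Finset.map_insert] at this
    · exact hasReflectionAt_of_checkBalls hb hmσ hw hσ

/-- The code 1 stands for the single vertex 0. Its antistar and its star are two certified 3-balls
that meet exactly in their common boundary, the link. -/
lemma isTriangulation_complexFin : IsTriangulationOfSphere 3 complexFin := by
  have hσ : insert 0 ∅ ∈ complexFin.faces := complexFin.singleton_mem (0 : Fin 12)
  have hm : ofMask 1 = insert 0 ∅ := ofMask_two_pow 0
  have h1 := isBallPair_antistar checkBalls_one hm hσ (ρ := ∅) (Finset.ssubset_insert (Finset.notMem_empty _))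
  have h2 := isBallPair_star checkBalls_one hm (Finset.notMem_empty _) hσ (ρ := ∅) subset_rfl
  simp only [Finset.sdiff_empty, Finset.set_biUnion_insert, Finset.notMem_empty, Set.iUnion_of_empty,
    Set.iUnion_empty, Set.union_empty, Finset.card_empty] at h1 h2
  obtain ⟨f, hf⟩ := exists_homeo_sphere_of_isBallPair h1 h2 (by
    rw [geom_inter]
    refine geom_congr fun t ht => ?_
    simp only [linkFamily, Set.mem_inter_iff, Set.mem_ofPred_eq, Finset.union_empty,
      Finset.disjoint_empty_right, true_and]
    constructor
    · rintro ⟨⟨h1, h2⟩, h3⟩; exact ⟨h1, h3⟩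
    · rintro ⟨h1, h3⟩; exact ⟨⟨h1, face_subset h3 Finset.subset_union_left ht⟩, h3⟩)
  have e : geom (linkFamily complexFin (insert 0 ∅) ∅) ∪
      geom (linkFamily complexFin ∅ (insert 0 ∅)) = realization complexFin := by
    rw [geom_union, realization_eq_geom]
    refine geom_congr fun t ht => ?_
    simp only [linkFamily, Set.mem_union, Set.mem_ofPred_eq, Finset.union_empty,
      Finset.disjoint_empty_right, true_and, insert_empty_eq, Finset.disjoint_singleton_right]
    constructor
    · rintro (h | h)
      · exact h.2
      · exact face_subset h Finset.subset_union_left ht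
    · intro h
      by_cases h0 : (0 : Fin 12) ∈ t
      · right; rwa [Finset.union_eq_left.2 (Finset.singleton_subset_iff.2 h0)]
      · exact Or.inl ⟨h0, h⟩
  rw [e] at hf
  exact hf.nonempty_homeomorph

lemma card_le_of_mem_complexFin {s : Finset (Fin 12)} (hs : s ∈ complexFin.faces) : s.card ≤ 4 := by
  obtain ⟨F, hF, h, -⟩ := exists_facet ∅ (by simp) _ (mem_complexFin.1 hs).2
  have := List.all_eq_true.1 facet_length F hF
  rw [Nat.beq_eq] at this
  exact (Finset.card_le_card h).trans (by rw [card_ofMask, this])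

end Twelve

end SphereComplex

namespace SphereComplex
open Set Metric Topology

set_option linter.unusedSectionVars false

/-! ### Cones and cone extensions of homeomorphisms -/

section Cone

variable {V W : Type} [Fintype V] [DecidableEq V] [Fintype W] [DecidableEq W]

/-- The point that divides the segment from `a` to the vertex `w` in the ratio `t : 1 - t`. -/
def conePoint (w : V) (a : V → ℝ) (t : ℝ) (v : V) : ℝ := if v = w then t else (1 - t) * a v

/-- The projection from the vertex `w` to the opposite face. -/
noncomputable def coneBase (w : V) (x : V → ℝ) (v : V) : ℝ := if v = w then 0 else x v / (1 - x w)

/-- The family of the simplices that belong to `𝒜` after removal of the vertex `w`. -/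
def coneFamily (w : V) (𝒜 : Set (Finset V)) : Set (Finset V) := {s | s.erase w ∈ 𝒜}

lemma le_one_of_mem_stdSimplex {x : V → ℝ} (hx : x ∈ stdSimplex ℝ V) (v : V) : x v ≤ 1 := by
  rw [← hx.2]; exact Finset.single_le_sum (fun w _ => hx.1 w) (Finset.mem_univ v)

lemma eq_zero_of_eq_one {x : V → ℝ} (hx : x ∈ stdSimplex ℝ V) {w v : V} (h : x w = 1)
    (hv : v ≠ w) : x v = 0 := by
  have h1 := hx.2
  rw [← Finset.sum_erase_add _ _ (Finset.mem_univ w), h, add_eq_right,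
    Finset.sum_eq_zero_iff_of_nonneg fun v _ => hx.1 v] at h1
  exact h1 v (Finset.mem_erase.2 ⟨hv, Finset.mem_univ v⟩)

lemma conePoint_coneBase {x : V → ℝ} (hx : x ∈ stdSimplex ℝ V) (w : V) :
    conePoint w (coneBase w x) (x w) = x := by
  ext v
  by_cases hv : v = w
  · simp [conePoint, hv]
  · simp only [conePoint, coneBase, if_neg hv]
    by_cases h : x w = 1
    · rw [h, eq_zero_of_eq_one hx h hv]; simp
    · rw [mul_div_cancel₀]; exact sub_ne_zero.2 (Ne.symm h)

lemma coneBase_conePoint {a : V → ℝ} {w : V} (ha : a w = 0) {t : ℝ} (ht : t ≠ 1) :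
    coneBase w (conePoint w a t) = a := by
  ext v
  by_cases hv : v = w
  · simp [coneBase, hv, ha]
  · simp only [conePoint, coneBase, if_neg hv, if_true]
    rw [mul_div_cancel_left₀]; exact sub_ne_zero.2 (Ne.symm ht)

lemma supp_conePoint (w : V) (a : V → ℝ) {t : ℝ} (ht : t ≠ 1) :
    (supp (conePoint w a t)).erase w = (supp a).erase w := by
  ext v
  simp only [Finset.mem_erase, mem_supp]
  refine and_congr_right fun hv => ?_
  rw [conePoint, if_neg hv]
  exact ⟨right_ne_zero_of_mul, mul_ne_zero (sub_ne_zero.2 (Ne.symm ht))⟩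

lemma conePoint_mem {w : V} {𝒜 : Set (Finset V)} (h0 : ∅ ∈ 𝒜) {a : V → ℝ} {t : ℝ}
    (ht0 : 0 ≤ t) (ht1 : t ≤ 1) (ha : t ≠ 1 → a ∈ geom 𝒜 ∧ a w = 0) :
    conePoint w a t ∈ geom (coneFamily w 𝒜) := by
  by_cases ht : t = 1
  · subst ht
    have e : ∀ v, conePoint w a 1 v = if v = w then 1 else 0 := fun v => by simp [conePoint]
    refine ⟨⟨fun v => by rw [e]; split_ifs <;> norm_num, by simp_rw [e]; simp⟩, ?_⟩
    have : (supp (conePoint w a 1)).erase w = ∅ := by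
      ext v
      simp only [Finset.mem_erase, mem_supp, e, Finset.notMem_empty, iff_false]
      rintro ⟨h1, h2⟩; exact h2 (if_neg h1)
    exact (this ▸ h0 : _ ∈ 𝒜)
  · obtain ⟨ha, haw⟩ := ha ht
    refine ⟨⟨fun v => ?_, ?_⟩, ?_⟩
    · unfold conePoint
      split_ifs
      · exact ht0
      · exact mul_nonneg (by linarith) (ha.1.1 v)
    · have e : ∀ v, conePoint w a t v = (1 - t) * a v + if v = w then t else 0 := by
        intro v
        unfold conePoint
        split_ifs with h
        · rw [h, haw]; ring
        · ring
      simp_rw [e, Finset.sum_add_distrib, ← Finset.mul_sum, ha.1.2]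
      simp
    · have : (supp (conePoint w a t)).erase w ∈ 𝒜 := by
        rw [supp_conePoint w a ht, Finset.erase_eq_of_notMem (notMem_supp.2 haw)]
        exact ha.2
      exact this

lemma coneBase_mem {w : V} {𝒜 : Set (Finset V)} {x : V → ℝ} (hx : x ∈ geom (coneFamily w 𝒜))
    (h : x w ≠ 1) : coneBase w x ∈ geom 𝒜 ∧ supp (coneBase w x) = (supp x).erase w := by
  have hlt : 0 < 1 - x w := sub_pos.2 ((le_one_of_mem_stdSimplex hx.1 w).lt_of_ne h)
  have hs : supp (coneBase w x) = (supp x).erase w := by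
    ext v
    simp only [Finset.mem_erase, mem_supp, coneBase]
    by_cases hv : v = w
    · simp [hv]
    · simp [hv, hlt.ne']
  refine ⟨⟨⟨fun v => ?_, ?_⟩, hs ▸ hx.2⟩, hs⟩
  · unfold coneBase
    split_ifs
    · exact le_rfl
    · exact div_nonneg (hx.1.1 v) hlt.le
  · have e : ∀ v, coneBase w x v = (x v - if v = w then x w else 0) / (1 - x w) := by
      intro v
      unfold coneBase
      split_ifs with hv
      · rw [hv]; simp
      · simp
    simp_rw [e, ← Finset.sum_div, Finset.sum_sub_distrib, hx.1.2]
    simp [hlt.ne']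

/-- A homeomorphism between two complexes extends to the cones over them. -/
lemma exists_cone_extension {w : V} {w' : W} {𝒜 : Set (Finset V)} {ℬ : Set (Finset W)}
    (h𝒜 : ∀ s ∈ 𝒜, w ∉ s) (hℬ : ∀ s ∈ ℬ, w' ∉ s) (h𝒜0 : ∅ ∈ 𝒜) (hℬ0 : ∅ ∈ ℬ)
    (hc : IsCompact (geom (coneFamily w 𝒜))) {g : (V → ℝ) → W → ℝ}
    (hg : IsHomeoOn g (geom 𝒜) (geom ℬ)) :
    ∃ k : (V → ℝ) → W → ℝ, IsHomeoOn k (geom (coneFamily w 𝒜)) (geom (coneFamily w' ℬ)) ∧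
      EqOn k g (geom 𝒜) ∧ ∀ x ∈ geom (coneFamily w 𝒜),
        ((supp x).erase w = ∅ ∧ (supp (k x)).erase w' = ∅) ∨
        ∃ a ∈ geom 𝒜, (supp x).erase w = supp a ∧ (supp (k x)).erase w' = supp (g a) := by
  have zA : ∀ {a}, a ∈ geom 𝒜 → a w = 0 := fun h => notMem_supp.1 (h𝒜 _ h.2)
  have zB : ∀ {a}, a ∈ geom ℬ → a w' = 0 := fun h => notMem_supp.1 (hℬ _ h.2)
  let k : (V → ℝ) → W → ℝ := fun x => conePoint w' (g (coneBase w x)) (x w)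
  have kw : ∀ x, k x w' = x w := fun x => if_pos rfl
  refine ⟨k, ⟨hc, ?_, ?_, ?_, ?_⟩, ?_, ?_⟩
  · intro x hx
    by_cases h : x w = 1
    · have hk : ∀ v, k x v = if v = w' then 1 else 0 := by
        intro v
        simp [k, conePoint, h]
      refine continuousWithinAt_pi.2 fun v => ?_
      have hw : ContinuousWithinAt (fun y : V → ℝ => y w) (geom (coneFamily w 𝒜)) x :=
        (continuous_apply w).continuousWithinAt
      by_cases hv : v = w'
      · subst hv
        exact hw.congr (fun y _ => kw y) (kw x)
      · rw [ContinuousWithinAt, hk, if_neg hv]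
        -- At the apex the base point is undetermined, but each coordinate other than the one at
        -- `w'` is at most `1 - y w`, which tends to 0.
        refine squeeze_zero_norm' (a := fun y : V → ℝ => 1 - y w) ?_ ?_
        · filter_upwards [self_mem_nhdsWithin] with y hy
          simp only [k, conePoint, if_neg hv]
          by_cases hy1 : y w = 1
          · simp [hy1]
          · have hm := hg.bij.mapsTo (coneBase_mem hy hy1).1
            have h1 := le_one_of_mem_stdSimplex hy.1 w
            rw [Real.norm_of_nonneg (mul_nonneg (by linarith) (hm.1.1 v))]
            exact mul_le_of_le_one_right (by linarith) (le_one_of_mem_stdSimplex hm.1 v)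
        · have : Filter.Tendsto (fun y : V → ℝ => 1 - y w) (𝓝[geom (coneFamily w 𝒜)] x)
              (𝓝 (1 - x w)) := tendsto_const_nhds.sub hw
          rwa [h, sub_self] at this
    · have ho : IsOpen {y : V → ℝ | y w ≠ 1} := isOpen_ne_fun (continuous_apply w) continuous_const
      have hb : ContinuousOn (coneBase w) {y : V → ℝ | y w ≠ 1} := by
        refine continuousOn_pi.2 fun v => ?_
        by_cases hv : v = w
        · simp only [coneBase, if_pos hv]; exact continuousOn_const
        · simp only [coneBase, if_neg hv]
          exact (continuous_apply v).continuousOn.div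
            (continuous_const.sub (continuous_apply w)).continuousOn
            fun y hy => sub_ne_zero.2 (Ne.symm hy)
      have hgb : ContinuousOn (fun y => g (coneBase w y))
          (geom (coneFamily w 𝒜) ∩ {y : V → ℝ | y w ≠ 1}) :=
        hg.cont.comp (hb.mono inter_subset_right) fun y hy => (coneBase_mem hy.1 hy.2).1
      have hk : ContinuousOn k (geom (coneFamily w 𝒜) ∩ {y : V → ℝ | y w ≠ 1}) := by
        refine continuousOn_pi.2 fun v => ?_
        by_cases hv : v = w'
        · simp only [k, conePoint, if_pos hv]; exact (continuous_apply w).continuousOn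
        · simp only [k, conePoint, if_neg hv]
          exact (continuous_const.sub (continuous_apply w)).continuousOn.mul
            (continuousOn_pi.1 hgb v)
      exact (hk x ⟨hx, h⟩).mono_of_mem_nhdsWithin
        (inter_mem_nhdsWithin _ (ho.mem_nhds h))
  · intro x hx
    refine conePoint_mem hℬ0 (hx.1.1 w) (le_one_of_mem_stdSimplex hx.1 w) fun h => ?_
    have := hg.bij.mapsTo (coneBase_mem hx h).1
    exact ⟨this, zB this⟩
  · intro x hx y hy e
    have hw : x w = y w := (kw x).symm.trans ((congrFun e w').trans (kw y))
    rw [← conePoint_coneBase hx.1 w, ← conePoint_coneBase hy.1 w, ← hw]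
    by_cases h : x w = 1
    · ext v; simp [conePoint, h]
    · have hx' := (coneBase_mem hx h).1
      have hy' := (coneBase_mem hy (hw ▸ h)).1
      have e' := congrArg (coneBase w') e
      simp only [k] at e'
      rw [coneBase_conePoint (zB (hg.bij.mapsTo hx')) h,
        coneBase_conePoint (zB (hg.bij.mapsTo hy')) (hw ▸ h)] at e'
      rw [hg.bij.injOn hx' hy' e']
  · intro y hy
    by_cases h : y w' = 1
    -- The apex does not depend on the base point, so 0 serves although it is not a point of `geom
    -- 𝒜`.
    · refine ⟨conePoint w 0 1, conePoint_mem h𝒜0 zero_le_one le_rfl (absurd rfl), ?_⟩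
      have e1 : (conePoint w (0 : V → ℝ) 1) w = 1 := if_pos rfl
      ext v
      by_cases hv : v = w'
      · rw [hv, kw, e1, h]
      · rw [eq_zero_of_eq_one hy.1 h hv]
        simp only [k, conePoint, if_neg hv]
        simp
    · have hy' := (coneBase_mem hy h).1
      obtain ⟨a, ha, e⟩ := hg.bij.surjOn hy'
      refine ⟨conePoint w a (y w'), conePoint_mem h𝒜0 (hy.1.1 w')
        (le_one_of_mem_stdSimplex hy.1 w') fun _ => ⟨ha, zA ha⟩, ?_⟩
      have e1 : (conePoint w a (y w')) w = y w' := if_pos rfl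
      simp only [k]
      rw [coneBase_conePoint (zA ha) h, e, e1, conePoint_coneBase hy.1]
  · intro a ha
    have h0 := zA ha
    have hb : coneBase w a = a := by
      ext v
      by_cases hv : v = w
      · simp [coneBase, hv, h0]
      · simp [coneBase, hv, h0]
    have hb' := zB (hg.bij.mapsTo ha)
    ext v
    by_cases hv : v = w'
    · rw [hv, kw, h0, hb']
    · simp [k, conePoint, hv, h0, hb]
  · intro x hx
    by_cases h : x w = 1
    · left
      constructor
      · ext v
        simp only [Finset.mem_erase, mem_supp, Finset.notMem_empty, iff_false]
        rintro ⟨h1, h2⟩; exact h2 (eq_zero_of_eq_one hx.1 h h1)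
      · ext v
        simp only [Finset.mem_erase, mem_supp, Finset.notMem_empty, iff_false]
        rintro ⟨h1, h2⟩; exact h2 (by simp [k, conePoint, h1, h])
    · right
      obtain ⟨hb, hs⟩ := coneBase_mem hx h
      refine ⟨_, hb, hs.symm, ?_⟩
      simp only [k]
      rw [supp_conePoint _ _ h, Finset.erase_eq_of_notMem]
      exact hℬ _ (hg.bij.mapsTo hb).2

end Cone

end SphereComplex

namespace SphereComplex
open Set Metric Topology

set_option linter.unusedSectionVars false

/-! ### The double as two copies with a folding map -/

section Double

variable {V W : Type} {K : AbstractSimplicialComplex V} {u : V} {L : AbstractSimplicialComplex W}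

variable (K u L) in
/-- `L` is the double of `K` at `u`, with the two inclusions `i` (which are irrelevant at `u`) and the
folding map `π`. -/
structure IsDouble [DecidableEq V] [DecidableEq W] (i : Bool → V → W) (π : W → V) : Prop where
  fold_ne : ∀ w, π w ≠ u
  fold_incl : ∀ b v, v ≠ u → π (i b v) = v
  cover : ∀ w, ∃ b, i b (π w) = w
  glue : ∀ v, v ≠ u → (i true v = i false v ↔ (skeleton K).Adj u v)
  face : ∀ s, s ∈ L.faces ↔ ∃ b, ∃ t ∈ K.faces, u ∉ t ∧ s = t.image (i b)

lemma exists_isDouble [DecidableEq V] [DecidableEq W] (h : Isomorphic L (double K u))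
    (hne : ∃ v, v ≠ u) : ∃ i π, IsDouble K u L i π := by
  obtain ⟨e, he⟩ := h
  obtain ⟨v₀, hv₀⟩ := hne
  -- The inclusions are total maps on `V`; this is their default value at `u`, the only reason to
  -- ask for a second vertex.
  have w₀ : W := e.symm (Quotient.mk _ (⟨v₀, hv₀⟩, true))
  let fold : DoubleVertex K u → V := Quotient.lift (fun p => p.1.1) fun p q h => congrArg _ h.1
  have fold_mk : ∀ x b, fold (doubleIncl K u b x) = x.1 := fun x b => rfl
  let i : Bool → V → W := fun b v => if h : v ≠ u then e.symm (doubleIncl K u b ⟨v, h⟩) else w₀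
  have hi : ∀ b v (h : v ≠ u), i b v = e.symm (doubleIncl K u b ⟨v, h⟩) := fun b v h => dif_pos h
  have hfold : ∀ q, fold q ≠ u := by
    intro q
    induction q using Quotient.inductionOn with
    | h p => exact p.1.2
  refine ⟨i, fun w => fold (e w), fun w => hfold _, ?_, ?_, ?_, ?_⟩
  · intro b v h
    simp only [hi b v h, Equiv.apply_symm_apply]
    rfl
  · intro w
    have : ∀ q : DoubleVertex K u, ∃ b, doubleIncl K u b ⟨fold q, hfold q⟩ = q := by
      intro q
      induction q using Quotient.inductionOn with
      | h p => exact ⟨p.2, rfl⟩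
    obtain ⟨b, hb⟩ := this (e w)
    refine ⟨b, ?_⟩
    rw [hi b _ (hfold _), hb, Equiv.symm_apply_apply]
  · intro v h
    rw [hi _ v h, hi _ v h, e.symm.injective.eq_iff]
    constructor
    · intro hq
      have : (doubleSetoid K u).r (⟨v, h⟩, true) (⟨v, h⟩, false) := Quotient.exact hq
      simpa using this.2
    · intro hadj
      exact Quotient.sound (show (doubleSetoid K u).r _ _ from ⟨rfl, Or.inr hadj⟩)
  · intro s
    rw [he]
    have key : ∀ (b : Bool) (t : Finset ({u}ᶜ : Set V)),
        s.map e.toEmbedding = t.map (doubleIncl K u b) ↔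
          s = (t.map (Function.Embedding.subtype _)).image (i b) := by
      intro b t
      have h1 : (t.map (Function.Embedding.subtype _)).image (i b) =
          (t.map (doubleIncl K u b)).map e.symm.toEmbedding := by
        ext w
        simp only [Finset.mem_image, Finset.mem_map, Function.Embedding.subtype_apply,
          Equiv.coe_toEmbedding, exists_exists_and_eq_and]
        refine exists_congr fun x => and_congr_right fun _ => ?_
        rw [hi b x x.2]
      rw [h1]
      constructor
      · intro h; rw [← h, Finset.map_map]; simp
      · intro h; rw [h, Finset.map_map]; simp
    constructor
    · rintro ⟨b, t, ht, hs⟩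
      refine ⟨b, _, ht, fun hu => ?_, (key b t).1 hs⟩
      obtain ⟨x, -, hx⟩ := Finset.mem_map.1 hu
      exact x.2 hx
    · rintro ⟨b, t, ht, hu, hs⟩
      have e1 : (t.subtype (· ∈ ({u}ᶜ : Set V))).map (Function.Embedding.subtype _) = t :=
        Finset.subtype_map_of_mem fun x hx hxu => hu (hxu ▸ hx)
      refine ⟨b, t.subtype (· ∈ ({u}ᶜ : Set V)), ?_, (key b _).2 (by rw [e1]; exact hs)⟩
      exact (e1.symm ▸ ht : _ ∈ K.faces)

namespace IsDouble

variable [DecidableEq V] [DecidableEq W] {i : Bool → V → W} {π : W → V}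

lemma ne_of_mem (h : IsDouble K u L i π) {s : Finset W} : u ∉ s.image π := by
  intro hu
  obtain ⟨w, -, hw⟩ := Finset.mem_image.1 hu
  exact h.fold_ne w hw

lemma image_fold (h : IsDouble K u L i π) {b : Bool} {t : Finset V} (ht : u ∉ t) :
    (t.image (i b)).image π = t := by
  rw [Finset.image_image]
  conv_rhs => rw [← Finset.image_id (s := t)]
  exact Finset.image_congr fun v hv => h.fold_incl b v fun e => ht (e ▸ hv)

lemma image_incl {b : Bool} {s : Finset W} (hs : ∀ w ∈ s, i b (π w) = w) :
    (s.image π).image (i b) = s := by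
  rw [Finset.image_image]
  conv_rhs => rw [← Finset.image_id (s := s)]
  exact Finset.image_congr fun w hw => hs w hw

lemma image_mem (h : IsDouble K u L i π) {b : Bool} {t : Finset V} (ht : u ∉ t) :
    t.image (i b) ∈ L.faces ↔ t ∈ K.faces := by
  rw [h.face]
  constructor
  · rintro ⟨c, t', ht', hu, e⟩
    have := congrArg (Finset.image π) e
    rw [h.image_fold ht, h.image_fold hu] at this
    exact this ▸ ht'
  · exact fun hK => ⟨b, t, hK, ht, rfl⟩

lemma fold_mem (h : IsDouble K u L i π) {b : Bool} {s : Finset W} (hs : ∀ w ∈ s, i b (π w) = w) :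
    s ∈ L.faces ↔ s.image π ∈ K.faces := by
  rw [← h.image_mem (b := b) h.ne_of_mem, image_incl hs]

lemma incl_side (h : IsDouble K u L i π) {b : Bool} {v : V} (hv : v ≠ u) :
    i b (π (i b v)) = i b v := by rw [h.fold_incl b v hv]

lemma exists_side (h : IsDouble K u L i π) {s : Finset W} (hs : s ∈ L.faces) :
    ∃ b, ∀ w ∈ s, i b (π w) = w := by
  obtain ⟨b, t, -, hu, rfl⟩ := (h.face s).1 hs
  refine ⟨b, fun w hw => ?_⟩
  obtain ⟨v, hv, rfl⟩ := Finset.mem_image.1 hw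
  exact h.incl_side fun e => hu (e ▸ hv)

lemma both_sides (h : IsDouble K u L i π) {w : W} :
    (∀ b, i b (π w) = w) ↔ (skeleton K).Adj u (π w) := by
  rw [← h.glue _ (h.fold_ne w)]
  constructor
  · intro hb; rw [hb, hb]
  · intro e b
    obtain ⟨c, hc⟩ := h.cover w
    cases b <;> cases c <;> first | exact hc | exact e.trans hc | exact e.symm.trans hc

lemma adj_iff (h : IsDouble K u L i π) {w w' : W} : (skeleton L).Adj w w' ↔
    ∃ b, i b (π w) = w ∧ i b (π w') = w' ∧ (skeleton K).Adj (π w) (π w') := by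
  rw [skeleton_adj]
  constructor
  · rintro ⟨hne, hf⟩
    obtain ⟨b, hb⟩ := h.exists_side hf
    have h1 := hb w (by simp)
    have h2 := hb w' (by simp)
    refine ⟨b, h1, h2, skeleton_adj.2 ⟨fun e => hne ?_, ?_⟩⟩
    · rw [← h1, e, h2]
    · rw [h.fold_mem hb, Finset.image_insert, Finset.image_singleton] at hf
      exact hf
  · rintro ⟨b, h1, h2, hadj⟩
    rw [skeleton_adj] at hadj
    refine ⟨fun e => hadj.1 (e ▸ rfl), ?_⟩
    rw [h.fold_mem (b := b), Finset.image_insert, Finset.image_singleton]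
    · exact hadj.2
    · intro x hx
      rcases Finset.mem_insert.1 hx with rfl | hx
      · exact h1
      · rw [Finset.mem_singleton.1 hx, h2]

/-- The point is that a clique lies in one copy. This is clear if it folds into the link of `u`;
otherwise a vertex outside the link belongs to just one copy, and every other vertex of the clique,
being adjacent to it, shares that copy. -/
lemma isFlag (h : IsDouble K u L i π) (hK : IsFlag K) : IsFlag L := by
  intro s hs hc
  have : ∃ b, ∀ w ∈ s, i b (π w) = w := by
    by_cases hall : ∀ w ∈ s, (skeleton K).Adj u (π w)
    · exact ⟨true, fun w hw => h.both_sides.2 (hall w hw) true⟩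
    · push Not at hall
      obtain ⟨w, hw, hadj⟩ := hall
      obtain ⟨b, hb⟩ := h.cover w
      refine ⟨b, fun w' hw' => ?_⟩
      by_cases e : w = w'
      · exact e ▸ hb
      obtain ⟨c, h1, h2, -⟩ := h.adj_iff.1 (hc hw hw' e)
      have : c = b := by
        by_contra hcb
        refine hadj (h.both_sides.1 fun d => ?_)
        rcases Bool.eq_or_eq_not d b with rfl | rfl
        · exact hb
        · exact (Bool.eq_not_of_ne hcb) ▸ h1
      exact this ▸ h2
  obtain ⟨b, hb⟩ := this
  rw [h.fold_mem hb, hK.mem_faces]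
  refine ⟨hs.image π, fun x hx y hy hxy => ?_⟩
  obtain ⟨w, hw, rfl⟩ := Finset.mem_image.1 hx
  obtain ⟨w', hw', rfl⟩ := Finset.mem_image.1 hy
  obtain ⟨c, -, -, hadj⟩ := h.adj_iff.1 (hc hw hw' fun e => hxy (e ▸ rfl))
  exact hadj

lemma card_le (h : IsDouble K u L i π) {n : ℕ} (hK : ∀ s ∈ K.faces, s.card ≤ n) :
    ∀ s ∈ L.faces, s.card ≤ n := by
  intro s hs
  obtain ⟨b, t, ht, -, rfl⟩ := (h.face s).1 hs
  exact Finset.card_image_le.trans (hK t ht)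

variable [Fintype V] [Fintype W]

/-- The coordinates of a point of the double with respect to one of the two copies. -/
def pull (u : V) (i : Bool → V → W) (b : Bool) (z : W → ℝ) (v : V) : ℝ :=
  if v = u then 0 else z (i b v)

/-- The point of the double with given coordinates with respect to one of the two copies. -/
def push (i : Bool → V → W) (π : W → V) (b : Bool) (x : V → ℝ) (w : W) : ℝ :=
  if i b (π w) = w then x (π w) else 0

lemma supp_pull (h : IsDouble K u L i π) {b : Bool} {z : W → ℝ}
    (hz : ∀ w ∈ supp z, i b (π w) = w) : supp (pull u i b z) = (supp z).image π := by
  ext v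
  simp only [mem_supp, pull, Finset.mem_image]
  constructor
  · intro hv
    have hvu : v ≠ u := fun e => hv (if_pos e)
    rw [if_neg hvu] at hv
    exact ⟨_, hv, h.fold_incl b v hvu⟩
  · rintro ⟨w, hw, rfl⟩
    rw [if_neg (h.fold_ne w), hz w (mem_supp.2 hw)]
    exact hw

/-- One of the two copies in the double, with the part of `K` that avoids `u`. -/
lemma isHomeoOn_pull (h : IsDouble K u L i π) (b : Bool) {𝒜 : Set (Finset V)}
    {ℬ : Set (Finset W)} (hu : ∀ t ∈ 𝒜, u ∉ t) (hc : IsCompact (geom ℬ))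
    (hℬ : ∀ s ∈ ℬ, ∀ w ∈ s, i b (π w) = w) (h𝒜ℬ : ∀ s, (∀ w ∈ s, i b (π w) = w) →
      (s ∈ ℬ ↔ s.image π ∈ 𝒜)) :
    IsHomeoOn (pull u i b) (geom ℬ) (geom 𝒜) := by
  have sum_eq : ∀ z : W → ℝ, (∀ w ∈ supp z, i b (π w) = w) →
      ∑ v, pull u i b z v = ∑ w, z w := by
    intro z hz
    have e1 : ∑ w ∈ supp z, z w = ∑ w, z w :=
      Finset.sum_subset (Finset.subset_univ _) fun w _ hw => notMem_supp.1 hw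
    have e2 : ∑ v ∈ supp (pull u i b z), pull u i b z v = ∑ v, pull u i b z v :=
      Finset.sum_subset (Finset.subset_univ _) fun w _ hw => notMem_supp.1 hw
    rw [← e1, ← e2, h.supp_pull hz, Finset.sum_image]
    · refine Finset.sum_congr rfl fun w hw => ?_
      rw [pull, if_neg (h.fold_ne w), hz w hw]
    · intro w hw w' hw' e
      rw [← hz w hw, e, hz w' hw']
  refine ⟨hc, ?_, ?_, ?_, ?_⟩
  · refine (continuous_pi fun v => ?_).continuousOn
    unfold pull
    split_ifs
    · exact continuous_const
    · exact continuous_apply _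
  · intro z hz
    have hs := hℬ _ hz.2
    refine ⟨⟨fun v => ?_, by rw [sum_eq z hs, hz.1.2]⟩, ?_⟩
    · unfold pull
      split_ifs
      · exact le_rfl
      · exact hz.1.1 _
    · rw [h.supp_pull hs, ← h𝒜ℬ _ hs]; exact hz.2
  · intro z hz z' hz' e
    have hzs := hℬ _ hz.2
    have hzs' := hℬ _ hz'.2
    ext w
    by_cases hw : i b (π w) = w
    · have := congrFun e (π w)
      simpa only [pull, if_neg (h.fold_ne w), hw] using this
    · rw [notMem_supp.1 fun hm => hw (hzs w hm), notMem_supp.1 fun hm => hw (hzs' w hm)]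
  · intro x hx
    have hxu : x u = 0 := notMem_supp.1 (hu _ hx.2)
    have hpp : pull u i b (push i π b x) = x := by
      ext v
      by_cases hv : v = u
      · rw [pull, if_pos hv, hv, hxu]
      · rw [pull, if_neg hv, push, if_pos (h.incl_side hv), h.fold_incl b v hv]
    have hside : ∀ w ∈ supp (push i π b x), i b (π w) = w := by
      intro w hw
      by_contra hn
      exact mem_supp.1 hw (if_neg hn)
    refine ⟨push i π b x, ⟨⟨fun w => ?_, ?_⟩, ?_⟩, hpp⟩
    · unfold push
      split_ifs
      · exact hx.1.1 _
      · exact le_rfl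
    · rw [← sum_eq _ hside, hpp, hx.1.2]
    · rw [h𝒜ℬ _ hside, ← h.supp_pull hside, hpp]; exact hx.2

end IsDouble

end Double

end SphereComplex

namespace SphereComplex
open Set Metric Topology

set_option linter.unusedSectionVars false

/-! ### Doubling preserves reflections and spheres -/

namespace IsDouble

variable {V W : Type} {K : AbstractSimplicialComplex V} {u : V} {L : AbstractSimplicialComplex W}
  [DecidableEq V] [DecidableEq W] {i : Bool → V → W} {π : W → V} [Fintype V] [Fintype W]

/-- Away from a simplex `σ` that is contained in one of the copies, the double is homeomorphic to
`K` away from `σ`: the other copy is reflected to the star of `u`. -/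
lemma exists_homeo (h : IsDouble K u L i π) (hK : IsFlag K) (hR : HasReflections K) (b : Bool)
    {σ : Finset V} (hu : u ∉ σ) (hσ : σ = ∅ ∨ σ ∈ K.faces) :
    ∃ g : (W → ℝ) → V → ℝ,
      IsHomeoOn g (geom (linkFamily L (σ.image (i b)) ∅)) (geom (linkFamily K σ ∅)) ∧
      ∀ y ∈ σ, ∀ z ∈ geom (linkFamily L (σ.image (i b)) ∅),
        (supp z ∪ {i b y} ∈ L.faces ↔ supp (g z) ∪ {y} ∈ K.faces) := by
  classical
  -- These are the vertices of `σ` that survive in the other copy, so reflecting that copy at `u`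
  -- has to avoid them and respect their links.
  set τ := σ.filter fun v => (skeleton K).Adj u v with hτ
  have huτ : u ∉ τ := fun hm => hu (Finset.mem_filter.1 hm).1
  have hσadj : ∀ x ∈ σ, ∀ y ∈ σ, x ≠ y → (skeleton K).Adj x y := by
    rcases hσ with rfl | hσ
    · simp
    · exact (hK.mem_faces.1 hσ).2
  have hτf : insert u τ ∈ K.faces := by
    rw [hK.mem_faces]
    refine ⟨Finset.insert_nonempty _ _, fun x hx y hy hxy => ?_⟩
    rcases Finset.mem_insert.1 hx with rfl | hx <;> rcases Finset.mem_insert.1 hy with rfl | hy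
    · exact absurd rfl hxy
    · exact (Finset.mem_filter.1 hy).2
    · exact (Finset.mem_filter.1 hx).2.symm
    · exact hσadj x (Finset.mem_filter.1 hx).1 y (Finset.mem_filter.1 hy).1 hxy
  obtain ⟨r, hr, hrid, hrstr⟩ := hR τ u huτ hτf
  -- the parts of the double in the two copies
  let 𝒰 : Bool → Set (Finset W) := fun c =>
    {s | s ∈ L.faces ∧ (∀ w ∈ s, i c (π w) = w) ∧ Disjoint s (σ.image (i b))}
  have lower : ∀ c, ∀ s ∈ 𝒰 c, ∀ t ⊆ s, t.Nonempty → t ∈ 𝒰 c := fun c s hs t hts ht =>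
    ⟨face_subset hs.1 hts ht, fun w hw => hs.2.1 w (hts hw),
      Finset.disjoint_of_subset_left hts hs.2.2⟩
  have hmemσ : ∀ {w}, w ∈ σ.image (i b) ↔ π w ∈ σ ∧ i b (π w) = w := by
    intro w
    rw [Finset.mem_image]
    constructor
    · rintro ⟨v, hv, rfl⟩
      have hvu : v ≠ u := fun e => hu (e ▸ hv)
      rw [h.fold_incl b v hvu]; exact ⟨hv, rfl⟩
    · rintro ⟨h1, h2⟩; exact ⟨_, h1, h2⟩
  have flagu : ∀ t : Finset V, u ∉ t → t ∈ K.faces →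
      (t ∪ {u} ∈ K.faces ↔ ∀ v ∈ t, (skeleton K).Adj u v) := by
    intro t hut ht
    constructor
    · intro hf v hv
      exact adj_of_mem_face hf (by simp) (by simp [hv]) fun e => hut (e ▸ hv)
    · intro hadj
      rw [hK.mem_faces] at ht ⊢
      refine ⟨ht.1.mono Finset.subset_union_left, fun x hx y hy hxy => ?_⟩
      simp only [Finset.mem_union, Finset.mem_singleton] at hx hy
      rcases hx with hx | rfl <;> rcases hy with hy | rfl
      · exact ht.2 x hx y hy hxy
      · exact (hadj x hx).symm
      · exact hadj y hy
      · exact absurd rfl hxy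
  have p1 : IsHomeoOn (pull u i b) (geom (𝒰 b)) (geom (linkFamily K (insert u σ) ∅)) := by
    refine h.isHomeoOn_pull b (fun t ht hut => ?_) (isCompact_geom (lower b))
      (fun s hs => hs.2.1) fun s hs => ?_
    · exact Finset.disjoint_left.1 ht.1 hut (Finset.mem_insert_self _ _)
    · simp only [𝒰, linkFamily, mem_ofPred_eq, Finset.union_empty, h.fold_mem hs,
        Finset.disjoint_insert_right, h.ne_of_mem, not_false_eq_true, true_and]
      have : Disjoint s (σ.image (i b)) ↔ Disjoint (s.image π) σ := by
        simp only [Finset.disjoint_left, hmemσ, Finset.mem_image]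
        constructor
        · rintro hd _ ⟨w, hw, rfl⟩ hσ'; exact hd hw ⟨hσ', hs w hw⟩
        · rintro hd w hw ⟨h1, -⟩; exact hd ⟨w, hw, rfl⟩ h1
      rw [this]
      tauto
  have p2 : IsHomeoOn (pull u i !b) (geom (𝒰 !b)) (geom (linkFamily K (insert u τ) ∅)) := by
    refine h.isHomeoOn_pull (!b) (fun t ht hut => ?_) (isCompact_geom (lower !b))
      (fun s hs => hs.2.1) fun s hs => ?_
    · exact Finset.disjoint_left.1 ht.1 hut (Finset.mem_insert_self _ _)
    · simp only [𝒰, linkFamily, mem_ofPred_eq, Finset.union_empty, h.fold_mem hs,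
        Finset.disjoint_insert_right, h.ne_of_mem, not_false_eq_true, true_and]
      have : Disjoint s (σ.image (i b)) ↔ Disjoint (s.image π) τ := by
        simp only [Finset.disjoint_left, hmemσ, Finset.mem_image, hτ, Finset.mem_filter]
        constructor
        · rintro hd _ ⟨w, hw, rfl⟩ ⟨hσ', hadj⟩
          refine hd hw ⟨hσ', ?_⟩
          have e := (h.glue _ (h.fold_ne w)).2 hadj
          have := hs w hw
          cases b
          · exact e.symm.trans this
          · exact e.trans this
        · rintro hd w hw ⟨h1, h2⟩
          refine hd ⟨w, hw, rfl⟩ ⟨h1, h.both_sides.1 fun c => ?_⟩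
          rcases Bool.eq_or_eq_not c b with rfl | rfl
          · exact h2
          · exact hs w hw
      rw [this]
      tauto
  have hboth : ∀ s : Finset W, (∀ c, ∀ w ∈ s, i c (π w) = w) ↔
      ∀ v ∈ s.image π, (skeleton K).Adj u v := by
    intro s
    constructor
    · rintro hs v hv
      obtain ⟨w, hw, rfl⟩ := Finset.mem_image.1 hv
      exact h.both_sides.1 fun c => hs c w hw
    · intro hs c w hw
      exact h.both_sides.2 (hs _ (Finset.mem_image_of_mem _ hw)) c
  have inb : ∀ {z}, z ∈ geom (𝒰 b) → supp (pull u i b z) ∪ {u} ∈ K.faces → z ∈ geom (𝒰 !b) := by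
    intro z hz hf
    have hpz := p1.bij.mapsTo hz
    have hs := h.supp_pull hz.2.2.1
    have hpf : (supp z).image π ∈ K.faces := by rw [← h.fold_mem hz.2.2.1]; exact hz.2.1
    rw [hs, flagu _ h.ne_of_mem hpf, ← hboth] at hf
    exact ⟨hz.1, hz.2.1, hf _, hz.2.2.2⟩
  -- Copy `b` stays in place and the other one is reflected into the star of `u`. The maps agree on
  -- the overlap because points in both copies come from the link of `u`, which `r` fixes.
  obtain ⟨g, hg, g1, g2⟩ := p1.union (hr.comp p2)
    (by
      rintro z ⟨hz, hz'⟩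
      have hall : ∀ c, ∀ w ∈ supp z, i c (π w) = w := by
        intro c
        rcases Bool.eq_or_eq_not c b with rfl | rfl
        · exact hz.2.2.1
        · exact hz'.2.2.1
      have e : pull u i b z = pull u i (!b) z := by
        ext v
        unfold pull
        split_ifs with hv
        · rfl
        · by_cases hadj : (skeleton K).Adj u v
          · have e := (h.glue v hv).2 hadj
            cases b
            · exact congrArg z e.symm
            · exact congrArg z e
          · have hn : ∀ c, z (i c v) = 0 := by
              intro c
              rw [← notMem_supp]
              intro hm
              have := h.both_sides.1 fun d => hall d _ hm
              rw [h.fold_incl c v hv] at this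
              exact hadj this
            rw [hn, hn]
      simp only [Function.comp]
      rw [e]
      symm
      apply hrid
      have hp := p2.bij.mapsTo hz'
      refine ⟨hp.1, hp.2.1, ?_⟩
      have hs := h.supp_pull hz'.2.2.1
      have hpf : (supp z).image π ∈ K.faces := by rw [← h.fold_mem hz'.2.2.1]; exact hz'.2.1
      rw [hs, flagu _ h.ne_of_mem hpf, ← hboth]
      exact hall)
    (by
      intro z hz z' hz' e
      refine inb hz ?_
      rw [e]
      exact (hr.bij.mapsTo (p2.bij.mapsTo hz')).2.2)
  have eL : geom (𝒰 b) ∪ geom (𝒰 !b) = geom (linkFamily L (σ.image (i b)) ∅) := by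
    rw [geom_union]
    refine geom_congr fun s hs => ?_
    simp only [𝒰, linkFamily, mem_union, mem_ofPred_eq, Finset.union_empty]
    constructor
    · rintro (⟨h1, -, h3⟩ | ⟨h1, -, h3⟩) <;> exact ⟨h3, h1⟩
    · rintro ⟨h3, h1⟩
      obtain ⟨c, hc⟩ := h.exists_side h1
      rcases Bool.eq_or_eq_not c b with rfl | rfl
      · exact Or.inl ⟨h1, hc, h3⟩
      · exact Or.inr ⟨h1, hc, h3⟩
  -- A simplex in the star of `u` can meet `σ` only in neighbours of `u`, so there avoiding `τ` is
  -- the same as avoiding `σ`.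
  have eK : geom (linkFamily K (insert u σ) ∅) ∪ geom (linkFamily K τ {u}) =
      geom (linkFamily K σ ∅) := by
    rw [geom_union]
    refine geom_congr fun t ht => ?_
    simp only [linkFamily, mem_union, mem_ofPred_eq, Finset.union_empty,
      Finset.disjoint_insert_right]
    constructor
    · rintro (⟨⟨h1, h2⟩, h3⟩ | ⟨h1, h2⟩)
      · exact ⟨h2, h3⟩
      · refine ⟨Finset.disjoint_left.2 fun v hv hvσ => ?_,
          face_subset h2 Finset.subset_union_left ht⟩
        refine Finset.disjoint_left.1 h1 hv (Finset.mem_filter.2 ⟨hvσ, ?_⟩)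
        exact adj_of_mem_face h2 (by simp) (by simp [hv]) fun e => hu (e ▸ hvσ)
    · rintro ⟨h1, h2⟩
      by_cases hut : u ∈ t
      · right
        refine ⟨Finset.disjoint_of_subset_right (Finset.filter_subset _ _) h1, ?_⟩
        rwa [Finset.union_eq_left.2 (Finset.singleton_subset_iff.2 hut)]
      · exact Or.inl ⟨⟨hut, h1⟩, h2⟩
  rw [eL, eK] at hg
  refine ⟨g, hg, fun y hy z hz => ?_⟩
  have hyu : y ≠ u := fun e => hu (e ▸ hy)
  have side : ∀ c, ∀ z ∈ geom (𝒰 c),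
      (supp z ∪ {i c y} ∈ L.faces ↔ supp (pull u i c z) ∪ {y} ∈ K.faces) := by
    intro c z hz
    rw [h.fold_mem (b := c), Finset.image_union, Finset.image_singleton, h.fold_incl c y hyu,
      h.supp_pull hz.2.2.1]
    intro w hw
    rcases Finset.mem_union.1 hw with hw | hw
    · exact hz.2.2.1 w hw
    · rw [Finset.mem_singleton.1 hw]; exact h.incl_side hyu
  by_cases hzb : z ∈ geom (𝒰 b)
  · rw [g1 hzb]; exact side b z hzb
  have hzb' : z ∈ geom (𝒰 !b) := by
    rw [← eL] at hz
    exact hz.resolve_left hzb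
  rw [g2 hzb']
  by_cases hadj : (skeleton K).Adj u y
  · have e : i b y = i (!b) y := by
      have e := (h.glue y hyu).2 hadj
      cases b
      · exact e.symm
      · exact e
    rw [e, side _ z hzb']
    exact hrstr y (Finset.mem_filter.2 ⟨hy, hadj⟩) _ (p2.bij.mapsTo hzb')
  -- When `y` is not adjacent to `u`, both sides are false. On the double, `y` lies only in copy `b`
  -- and `z` is not in that copy. On `K`, a point joined to `y` has no `u` in its support, so it
  -- already comes from copy `b`, contrary to injectivity of `g`.
  · constructor
    · intro hf
      exfalso
      obtain ⟨c, hc⟩ := h.exists_side hf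
      have hyc := hc (i b y) (by simp)
      rcases Bool.eq_or_eq_not c b with rfl | rfl
      · exact hzb ⟨hz.1, hzb'.2.1, fun w hw => hc w (Finset.mem_union_left _ hw), hzb'.2.2.2⟩
      · refine hadj ?_
        rw [← h.fold_incl b y hyu, ← h.both_sides]
        intro d
        rcases Bool.eq_or_eq_not d b with rfl | rfl
        · exact h.incl_side hyu
        · exact hyc
    · intro hf
      exfalso
      have hm := hr.bij.mapsTo (p2.bij.mapsTo hzb')
      simp only [Function.comp] at hf
      set x := r (pull u i (!b) z) with hx
      have hux : u ∉ supp x := fun hux =>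
        hadj (adj_of_mem_face hf (by simp [hux]) (by simp) hyu.symm)
      have hxb : x ∈ geom (linkFamily K (insert u σ) ∅) := by
        have : x ∈ geom (linkFamily K σ ∅) := eK ▸ Or.inr hm
        refine ⟨this.1, ?_, this.2.2⟩
        rw [Finset.disjoint_insert_right]
        exact ⟨hux, this.2.1⟩
      obtain ⟨z', hz', e⟩ := p1.bij.surjOn hxb
      have : z' = z := by
        refine hg.bij.injOn (eL ▸ Or.inl hz') hz ?_
        rw [g1 hz', g2 hzb', e]
        rfl
      exact hzb (this ▸ hz')

/-- The simplex lies in one copy and folds to `σ₀`. The reflection is `k ∘ r ∘ g`: `g` passes to `K`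
away from `σ₀`, `r` reflects into the star of `π w`, and `k` returns to the star of `w` as the cone
over the inverse of `g` on the link. Hence it is the identity on that link, and links of the
vertices of `τ` are respected at every stage. -/
lemma hasReflections (h : IsDouble K u L i π) (hK : IsFlag K) (hR : HasReflections K) :
    HasReflections L := by
  intro τ w hw hσ
  have hL := h.isFlag hK
  obtain ⟨b, hb⟩ := h.exists_side hσ
  set σ₀ := (insert w τ).image π with hσ₀
  set τ₀ := τ.image π with hτ₀
  have eσ : insert w τ = σ₀.image (i b) := (image_incl hb).symm
  have eσ₀ : σ₀ = insert (π w) τ₀ := Finset.image_insert _ _ _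
  have hwb : i b (π w) = w := hb w (Finset.mem_insert_self _ _)
  have hτb : ∀ y ∈ τ, i b (π y) = y := fun y hy => hb y (Finset.mem_insert_of_mem hy)
  have hσ₀f : σ₀ ∈ K.faces := (h.fold_mem hb).1 hσ
  have hw₀ : π w ∉ τ₀ := by
    intro hm
    obtain ⟨y, hy, e⟩ := Finset.mem_image.1 hm
    apply hw
    rw [← hwb, ← e, hτb y hy]; exact hy
  obtain ⟨g, hg, hgs⟩ := h.exists_homeo hK hR b h.ne_of_mem (Or.inr hσ₀f)
  rw [← eσ] at hg hgs
  obtain ⟨r, hr, hrid, hrs⟩ := hR τ₀ (π w) hw₀ (eσ₀ ▸ hσ₀f)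
  rw [← eσ₀] at hr hrid hrs
  -- strata
  have hgs' : ∀ y ∈ insert w τ, ∀ z ∈ geom (linkFamily L (insert w τ) ∅),
      (supp z ∪ {y} ∈ L.faces ↔ supp (g z) ∪ {π y} ∈ K.faces) := by
    intro y hy z hz
    have := hgs (π y) (Finset.mem_image_of_mem _ hy) z hz
    rwa [hb y hy] at this
  have sub : ∀ {X : Type} [Fintype X] [DecidableEq X] (M : AbstractSimplicialComplex X)
      (σ ρ : Finset X), geom (linkFamily M σ ρ) ⊆ geom (linkFamily M σ ∅) := by
    intro X _ _ M σ ρ x hx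
    refine ⟨hx.1, hx.2.1, ?_⟩
    rw [Finset.union_empty]
    exact face_subset hx.2.2 Finset.subset_union_left (supp_nonempty hx.1)
  have hgA : IsHomeoOn g (geom (linkFamily L (insert w τ) {w}))
      (geom (linkFamily K σ₀ {π w})) := by
    refine hg.restrict (isCompact_geom linkFamily_lower) (sub _ _ _) (sub _ _ _) fun z hz => ?_
    have := hgs' w (Finset.mem_insert_self _ _) z hz
    constructor
    · intro hm
      exact ⟨(hg.bij.mapsTo hz).1, (hg.bij.mapsTo hz).2.1, this.1 hm.2.2⟩
    · intro hm
      exact ⟨hz.1, hz.2.1, this.2 hm.2.2⟩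
  -- The star of `w` away from `τ` is the cone with apex `w` over the part of the link of `w` away
  -- from `τ`.
  have cone : ∀ {X : Type} [Fintype X] [DecidableEq X] (M : AbstractSimplicialComplex X)
      (τ : Finset X) (w : X), w ∉ τ →
      geom (coneFamily w (linkFamily M (insert w τ) {w})) = geom (linkFamily M τ {w}) := by
    intro X _ _ M τ w hw
    refine geom_congr fun t ht => ?_
    have e : t.erase w ∪ {w} = t ∪ {w} := by ext x; by_cases hx : x = w <;> simp [hx]
    simp only [coneFamily, linkFamily, mem_ofPred_eq, e]
    refine and_congr_left fun _ => ?_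
    simp only [Finset.disjoint_left, Finset.mem_erase, Finset.mem_insert]
    constructor
    · intro h x hx hxτ
      exact h ⟨fun e => hw (e ▸ hxτ), hx⟩ (Or.inr hxτ)
    · rintro h x ⟨hxw, hx⟩ (rfl | hxτ)
      · exact hxw rfl
      · exact h hx hxτ
  have empty_mem : ∀ {X : Type} [DecidableEq X] (M : AbstractSimplicialComplex X)
      (σ : Finset X) (w : X), ∅ ∈ linkFamily M σ {w} := by
    intro X _ M σ w
    refine ⟨Finset.disjoint_empty_left _, ?_⟩
    rw [Finset.empty_union]; exact M.singleton_mem w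
  obtain ⟨k, hk, hkg, hks⟩ := exists_cone_extension (w := π w) (w' := w)
    (𝒜 := linkFamily K σ₀ {π w}) (ℬ := linkFamily L (insert w τ) {w})
    (fun s hs hm => Finset.disjoint_left.1 hs.1 hm (eσ₀ ▸ Finset.mem_insert_self _ _))
    (fun s hs hm => Finset.disjoint_left.1 hs.1 hm (Finset.mem_insert_self _ _))
    (empty_mem _ _ _) (empty_mem _ _ _)
    (by rw [eσ₀, cone _ _ _ hw₀]; exact isCompact_geom linkFamily_lower) hgA.symm
  rw [eσ₀, cone _ _ _ hw₀, cone _ _ _ hw] at hk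
  rw [eσ₀, cone _ _ _ hw₀, ← eσ₀] at hks
  refine ⟨k ∘ r ∘ g, hk.comp (hr.comp hg), ?_, ?_⟩
  · intro x hx
    have hgx := hgA.bij.mapsTo hx
    simp only [Function.comp]
    rw [hrid _ hgx, hkg hgx, hgA.bij.invOn_invFunOn.1 hx]
  · intro y hy x hx
    have hgx := hg.bij.mapsTo hx
    rw [hgs' y (Finset.mem_insert_of_mem hy) x hx, hrs _ (Finset.mem_image_of_mem _ hy) _ hgx]
    simp only [Function.comp]
    have hx' := hr.bij.mapsTo hgx
    set x' := r (g x)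
    have hkx := hk.bij.mapsTo hx'
    -- the condition depends only on the base of the cone
    have base : ∀ {X : Type} [Fintype X] [DecidableEq X] (M : AbstractSimplicialComplex X)
        (_ : IsFlag M) (w y : X) (s : Finset X), s ∪ {w} ∈ M.faces → {w, y} ∈ M.faces →
        (s ∪ {y} ∈ M.faces ↔ s.erase w = ∅ ∨ s.erase w ∪ {y} ∈ M.faces) := by
      intro X _ _ M hM w y s hs hwy
      constructor
      · intro hf
        rcases (s.erase w).eq_empty_or_nonempty with he | hne
        · exact Or.inl he
        · exact Or.inr (face_subset hf (Finset.union_subset_union_left (Finset.erase_subset _ _))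
            (by simp))
      · rintro (he | hf)
        · refine face_subset hwy (fun v hv => ?_) (by simp)
          rcases Finset.mem_union.1 hv with hv | hv
          · by_cases hvw : v = w
            · simp [hvw]
            · exact absurd (Finset.mem_erase.2 ⟨hvw, hv⟩) (by simp [he])
          · simp [Finset.mem_singleton.1 hv]
        · rcases (s.erase w).eq_empty_or_nonempty with he | hne
          · refine face_subset hwy (fun v hv => ?_) (by simp)
            rcases Finset.mem_union.1 hv with hv | hv
            · by_cases hvw : v = w
              · simp [hvw]
              · exact absurd (Finset.mem_erase.2 ⟨hvw, hv⟩) (by simp [he])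
            · simp [Finset.mem_singleton.1 hv]
          · have := hM.union_mem (a := s.erase w) (b := {w}) (c := {y}) hne
              (face_subset hs (Finset.union_subset_union_left (Finset.erase_subset _ _))
                (by simp)) hf hwy
            refine face_subset this (fun v hv => ?_) (by simp)
            simp only [Finset.mem_union, Finset.mem_erase, Finset.mem_singleton] at hv ⊢
            tauto
    have hwy : ({w, y} : Finset W) ∈ L.faces := face_subset hσ (by
      intro v hv
      rcases Finset.mem_insert.1 hv with rfl | hv
      · exact Finset.mem_insert_self _ _
      · rw [Finset.mem_singleton.1 hv]; exact Finset.mem_insert_of_mem hy) (by simp)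
    have hwy₀ : ({π w, π y} : Finset V) ∈ K.faces := face_subset hσ₀f (by
      rw [eσ₀]
      intro v hv
      rcases Finset.mem_insert.1 hv with rfl | hv
      · exact Finset.mem_insert_self _ _
      · rw [Finset.mem_singleton.1 hv]
        exact Finset.mem_insert_of_mem (Finset.mem_image_of_mem _ hy)) (by simp)
    rw [base K hK _ _ _ hx'.2.2 hwy₀, base L hL _ _ _ hkx.2.2 hwy]
    rcases hks x' hx' with ⟨e1, e2⟩ | ⟨a, ha, e1, e2⟩
    · simp [e1, e2]
    · rw [e1, e2]
      have hga := hgA.symm.bij.mapsTo ha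
      have hne1 := (supp_nonempty ha.1).ne_empty
      have hne2 := (supp_nonempty hga.1).ne_empty
      have := hgs' y (Finset.mem_insert_of_mem hy) _ (sub _ _ _ hga)
      rw [hgA.bij.invOn_invFunOn.2 ha] at this
      simp only [hne1, hne2, false_or]
      exact this.symm

/-- With the empty simplex nothing has to be avoided, and `exists_homeo` identifies the whole double
with `K`. -/
lemma isTriangulation (h : IsDouble K u L i π) (hK : IsFlag K) (hR : HasReflections K) {n : ℕ}
    (hS : IsTriangulationOfSphere n K) : IsTriangulationOfSphere n L := by
  obtain ⟨g, hg, -⟩ := h.exists_homeo hK hR true (Finset.notMem_empty u) (Or.inl rfl)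
  have e : ∀ {X : Type} [Fintype X] [DecidableEq X] (M : AbstractSimplicialComplex X),
      geom (linkFamily M ∅ ∅) = realization M := by
    intro X _ _ M
    rw [realization_eq_geom]
    refine geom_congr fun t _ => ?_
    simp [linkFamily]
  rw [Finset.image_empty, e, e] at hg
  exact ⟨hg.nonempty_homeomorph.some.trans hS.some⟩

end IsDouble

end SphereComplex

namespace SphereComplex
open Set Metric Topology

set_option linter.unusedSectionVars false

/-! ### The effect of doubling on $\gamma_2$ -/

section Gamma

open Classical in
/-- The set of all simplices. -/
noncomputable def faceFinset {V : Type} [Fintype V] (K : AbstractSimplicialComplex V) :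
    Finset (Finset V) := Finset.univ.filter (· ∈ K.faces)

lemma mem_faceFinset {V : Type} [Fintype V] {K : AbstractSimplicialComplex V} {s : Finset V} :
    s ∈ faceFinset K ↔ s ∈ K.faces := by simp [faceFinset]

/-- The coefficient in `γ₂` of the simplices with a given number of vertices. -/
def gammaWeight : ℕ → ℤ
  | 1 => -8
  | 2 => 4
  | 3 => -2
  | 4 => 1
  | _ => 0

/-- The weights are $16(-1/2)^k$ for $1\le k\le4$, and the constant 16 is the term of the empty
simplex, which is not among the faces. -/
lemma gammaTwo_eq_sum {V : Type} [Fintype V] (K : AbstractSimplicialComplex V) :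
    gammaTwo K = 16 + ∑ s ∈ faceFinset K, gammaWeight s.card := by
  have h : ∀ i, faceCount K i = ∑ s ∈ faceFinset K, if s.card = i + 1 then (1 : ℤ) else 0 := by
    intro i
    have : {s ∈ K.faces | s.card = i + 1} =
        ((faceFinset K).filter fun s => s.card = i + 1 : Finset (Finset V)) := by
      ext s; simp [mem_faceFinset]
    rw [faceCount, this, Set.ncard_coe_finset, Finset.card_filter]
    push_cast
    rfl
  simp only [gammaTwo, h, Finset.mul_sum]
  rw [← Finset.sum_sub_distrib, ← Finset.sum_add_distrib, ← Finset.sum_sub_distrib, add_comm]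
  congr 1
  refine Finset.sum_congr rfl fun s _ => ?_
  generalize s.card = k
  match k with
  | 0 | 1 | 2 | 3 | 4 => simp [gammaWeight]
  | k + 5 => simp [gammaWeight]

/-- Doubling doubles `γ₂`. -/
lemma IsDouble.gammaTwo_eq {V W : Type} {K : AbstractSimplicialComplex V} {u : V}
    {L : AbstractSimplicialComplex W} [Fintype V] [Fintype W] [DecidableEq V] [DecidableEq W]
    {i : Bool → V → W} {π : W → V} (h : IsDouble K u L i π) (hK : IsFlag K)
    (h4 : ∀ s ∈ K.faces, s.card ≤ 4) : gammaTwo L = 2 * gammaTwo K := by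
  classical
  set T := (faceFinset K).filter fun t => u ∉ t
  set N := T.filter fun t => insert u t ∈ K.faces
  have mT : ∀ {t}, t ∈ T ↔ t ∈ K.faces ∧ u ∉ t := by simp [T, mem_faceFinset]
  have mN : ∀ {t}, t ∈ N ↔ (t ∈ K.faces ∧ u ∉ t) ∧ insert u t ∈ K.faces := by
    intro t; rw [Finset.mem_filter, mT]
  let A : Bool → Finset (Finset W) := fun b => T.image (Finset.image (i b))
  have inj : ∀ b, Set.InjOn (Finset.image (i b)) (T : Set (Finset V)) := by
    intro b t ht t' ht' e
    have := congrArg (Finset.image π) e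
    rwa [h.image_fold (mT.1 ht).2, h.image_fold (mT.1 ht').2] at this
  have card : ∀ b, ∀ t ∈ T, (t.image (i b)).card = t.card := by
    intro b t ht
    refine Finset.card_image_of_injOn fun x hx y hy e => ?_
    have hu := (mT.1 ht).2
    have := congrArg π e
    rwa [h.fold_incl b x fun e => hu (e ▸ hx), h.fold_incl b y fun e => hu (e ▸ hy)] at this
  have eF : faceFinset L = A true ∪ A false := by
    ext s
    rw [mem_faceFinset, h.face, Finset.mem_union, Bool.exists_bool, or_comm]
    simp only [A, Finset.mem_image, mT]
    refine or_congr ?_ ?_ <;>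
    · constructor
      · rintro ⟨t, h1, h2, rfl⟩; exact ⟨t, ⟨h1, h2⟩, rfl⟩
      · rintro ⟨t, ⟨h1, h2⟩, rfl⟩; exact ⟨t, h1, h2, rfl⟩
  -- A simplex in both copies has all its vertices adjacent to `u`; flagness then puts it into the
  -- link of `u`.
  have eI : A true ∩ A false = N.image (Finset.image (i true)) := by
    ext s
    simp only [A, Finset.mem_inter, Finset.mem_image]
    constructor
    · rintro ⟨⟨t, ht, rfl⟩, t', ht', e⟩
      refine ⟨t, mN.2 ⟨mT.1 ht, ?_⟩, rfl⟩
      have htf := hK.mem_faces.1 (mT.1 ht).1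
      have hu := (mT.1 ht).2
      have hadj : ∀ v ∈ t, (skeleton K).Adj u v := by
        intro v hv
        have hvu : v ≠ u := fun e => hu (e ▸ hv)
        obtain ⟨v', hv', e'⟩ := Finset.mem_image.1 (e ▸ Finset.mem_image_of_mem (i true) hv :
          i true v ∈ t'.image (i false))
        have := congrArg π e'
        rw [h.fold_incl _ v hvu, h.fold_incl _ v' fun e => (mT.1 ht').2 (e ▸ hv')] at this
        subst this
        exact (h.glue v' hvu).1 e'.symm
      rw [hK.mem_faces]
      refine ⟨Finset.insert_nonempty _ _, fun x hx y hy hxy => ?_⟩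
      rcases Finset.mem_insert.1 hx with hx | hx <;> rcases Finset.mem_insert.1 hy with hy | hy
      · exact absurd (hx.trans hy.symm) hxy
      · exact hx ▸ hadj y hy
      · exact hy ▸ (hadj x hx).symm
      · exact htf.2 x hx y hy hxy
    · rintro ⟨t, ht, rfl⟩
      obtain ⟨⟨h1, hu⟩, h3⟩ := mN.1 ht
      refine ⟨⟨t, mT.2 ⟨h1, hu⟩, rfl⟩, t, mT.2 ⟨h1, hu⟩, ?_⟩
      refine Finset.image_congr fun v hv => ?_
      have hvu : v ≠ u := fun e => hu (e ▸ hv)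
      exact ((h.glue v hvu).2 (adj_of_mem_face h3 (by simp) (Finset.mem_insert_of_mem hv)
        hvu.symm)).symm
  have sumA : ∀ b, ∑ s ∈ A b, gammaWeight s.card = ∑ t ∈ T, gammaWeight t.card := by
    intro b
    rw [Finset.sum_image (inj b)]
    exact Finset.sum_congr rfl fun t ht => by rw [card b t ht]
  have sumN : ∑ s ∈ A true ∩ A false, gammaWeight s.card = ∑ t ∈ N, gammaWeight t.card := by
    rw [eI, Finset.sum_image ((inj true).mono (Finset.coe_subset.2 (Finset.filter_subset _ _)))]
    exact Finset.sum_congr rfl fun t ht => by rw [card true t (Finset.filter_subset _ _ ht)]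
  have sumL := Finset.sum_union_inter (s₁ := A true) (s₂ := A false)
    (f := fun s => gammaWeight s.card)
  rw [← eF, sumA, sumA, sumN] at sumL
  have eU : (faceFinset K).filter (fun t => ¬ u ∉ t) = insert {u} (N.image (insert u)) := by
    ext s
    simp only [Finset.mem_filter, mem_faceFinset, Finset.mem_insert, Finset.mem_image, not_not]
    constructor
    · rintro ⟨h1, h2⟩
      by_cases he : s = {u}
      · exact Or.inl he
      · right
        refine ⟨s.erase u, mN.2 ⟨⟨face_subset h1 (Finset.erase_subset _ _) ?_,
          Finset.notMem_erase _ _⟩, ?_⟩, Finset.insert_erase h2⟩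
        · by_contra hn
          rw [Finset.not_nonempty_iff_eq_empty, Finset.erase_eq_empty_iff] at hn
          rcases hn with rfl | hn
          · simp at h2
          · exact he hn
        · rwa [Finset.insert_erase h2]
    · rintro (rfl | ⟨t, ht, rfl⟩)
      · exact ⟨K.singleton_mem u, Finset.mem_singleton_self u⟩
      · exact ⟨(mN.1 ht).2, Finset.mem_insert_self _ _⟩
  have sumU : ∑ s ∈ (faceFinset K).filter (fun t => ¬ u ∉ t), gammaWeight s.card =
      -8 + ∑ t ∈ N, gammaWeight (t.card + 1) := by
    rw [eU, Finset.sum_insert, Finset.sum_image, Finset.card_singleton]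
    · congr 1
      refine Finset.sum_congr rfl fun t ht => ?_
      rw [Finset.card_insert_of_notMem (mN.1 ht).1.2]
    · intro t ht t' ht' e
      have := congrArg (fun s => s.erase u) e
      beta_reduce at this
      rwa [Finset.erase_insert (mN.1 ht).1.2, Finset.erase_insert (mN.1 ht').1.2] at this
    · intro hm
      obtain ⟨t, ht, e⟩ := Finset.mem_image.1 hm
      obtain ⟨v, hv⟩ := face_nonempty (mN.1 ht).1.1
      have : v ∈ ({u} : Finset V) := e ▸ Finset.mem_insert_of_mem hv
      rw [Finset.mem_singleton] at this
      exact (mN.1 ht).1.2 (this ▸ hv)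
  -- Adding a vertex multiplies the weight by $-1/2$. Only sizes 1 to 3 occur in the link, since
  -- adding `u` gives a simplex with at most four vertices.
  have key : ∑ t ∈ N, gammaWeight t.card = -2 * ∑ t ∈ N, gammaWeight (t.card + 1) := by
    rw [Finset.mul_sum]
    refine Finset.sum_congr rfl fun t ht => ?_
    have h1 := (face_nonempty (mN.1 ht).1.1).card_pos
    have h2 := h4 _ (mN.1 ht).2
    rw [Finset.card_insert_of_notMem (mN.1 ht).1.2] at h2
    have h3 : t.card = 1 ∨ t.card = 2 ∨ t.card = 3 := by omega
    rcases h3 with h3 | h3 | h3 <;> rw [h3] <;> simp [gammaWeight]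
  rw [gammaTwo_eq_sum, gammaTwo_eq_sum,
    ← Finset.sum_filter_add_sum_filter_not (faceFinset K) (fun t => u ∉ t), sumU]
  have : ∑ x ∈ faceFinset K with u ∉ x, gammaWeight x.card = ∑ t ∈ T, gammaWeight t.card := rfl
  rw [this]
  linarith

end Gamma

/-! ### Induced 4-cycles and squares -/

section Squares

variable {V W : Type}

/-- Every edge lies in an induced cycle of length four. -/
def HasSquares (G : SimpleGraph V) : Prop :=
  ∀ x y, G.Adj x y → ∃ z t, G.Adj y z ∧ G.Adj z t ∧ G.Adj t x ∧ x ≠ z ∧ ¬ G.Adj x z ∧ y ≠ t ∧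
    ¬ G.Adj y t

/-- The edge lies in copy `b`, and its induced 4-cycle in `K` lifts there unless it passes through
`u`. In that case `u` is replaced by the mirror image of the opposite vertex: the two remaining
vertices are neighbours of `u`, hence common to both copies, and the opposite vertex, not adjacent
to `u`, is neither equal nor adjacent to its mirror image. -/
lemma IsDouble.hasSquares {K : AbstractSimplicialComplex V} {u : V}
    {L : AbstractSimplicialComplex W} [DecidableEq V] [DecidableEq W]
    {i : Bool → V → W} {π : W → V} (h : IsDouble K u L i π) (hs : HasSquares (skeleton K)) :
    HasSquares (skeleton L) := by
  have adj : ∀ b {v v'}, v ≠ u → v' ≠ u → (skeleton K).Adj v v' →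
      (skeleton L).Adj (i b v) (i b v') := by
    intro b v v' hv hv' ha
    refine h.adj_iff.2 ⟨b, h.incl_side hv, h.incl_side hv', ?_⟩
    rwa [h.fold_incl b v hv, h.fold_incl b v' hv']
  have nadj : ∀ b c {v v'}, v ≠ u → v' ≠ u → ¬ (skeleton K).Adj v v' →
      ¬ (skeleton L).Adj (i b v) (i c v') := by
    intro b c v v' hv hv' hn ha
    obtain ⟨_, -, -, ha⟩ := h.adj_iff.1 ha
    rw [h.fold_incl b v hv, h.fold_incl c v' hv'] at ha
    exact hn ha
  have ne : ∀ b c {v v'}, v ≠ u → v' ≠ u → v ≠ v' → i b v ≠ i c v' := by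
    intro b c v v' hv hv' hn e
    have := congrArg π e
    rw [h.fold_incl b v hv, h.fold_incl c v' hv'] at this
    exact hn this
  have glue : ∀ b {v}, v ≠ u → (i b v = i (!b) v ↔ (skeleton K).Adj u v) := by
    intro b v hv
    rw [← h.glue v hv]
    cases b
    · exact eq_comm
    · exact Iff.rfl
  intro w w' hww
  obtain ⟨b, hw, hw', ha⟩ := h.adj_iff.1 hww
  obtain ⟨z, t, h1, h2, h3, h4, h5, h6, h7⟩ := hs _ _ ha
  have hx := h.fold_ne w
  have hy := h.fold_ne w'
  by_cases hz : z = u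
  · subst hz
    refine ⟨i (!b) (π w), i b t, ?_, ?_, ?_, ?_, ?_, ?_, ?_⟩
    · rw [← hw', (glue b hy).2 h1.symm]; exact adj _ hy hx ha.symm
    · rw [(glue b h2.ne').2 h2]; exact adj _ hx h2.ne' h3.symm
    · rw [← hw]; exact adj _ h2.ne' hx h3
    · nth_rewrite 1 [← hw]
      exact fun e => h5 ((glue b hx).1 e).symm
    · nth_rewrite 1 [← hw]
      exact nadj _ _ hx hx (skeleton K).irrefl
    · rw [← hw']; exact ne _ _ hy h2.ne' h6
    · rw [← hw']; exact nadj _ _ hy h2.ne' h7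
  by_cases ht : t = u
  · subst ht
    refine ⟨i b z, i (!b) (π w'), ?_, ?_, ?_, ?_, ?_, ?_, ?_⟩
    · rw [← hw']; exact adj _ hy hz h1
    · rw [(glue b hz).2 h2.symm]; exact adj _ hz hy h1.symm
    · rw [← hw, (glue b hx).2 h3]; exact adj _ hy hx ha.symm
    · rw [← hw]; exact ne _ _ hx hz h4
    · rw [← hw]; exact nadj _ _ hx hz h5
    · nth_rewrite 1 [← hw']
      exact fun e => h7 ((glue b hy).1 e).symm
    · nth_rewrite 1 [← hw']
      exact nadj _ _ hy hy (skeleton K).irrefl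
  refine ⟨i b z, i b t, ?_, adj b hz ht h2, ?_, ?_, ?_, ?_, ?_⟩
  · rw [← hw']; exact adj _ hy hz h1
  · rw [← hw]; exact adj _ ht hx h3
  · rw [← hw]; exact ne _ _ hx hz h4
  · rw [← hw]; exact nadj _ _ hx hz h5
  · rw [← hw']; exact ne _ _ hy ht h6
  · rw [← hw']; exact nadj _ _ hy ht h7

/-- A shelling of length two: the edge from `b` to `c` is attached to the edge from `a` to `b` at
`b`, which is the face opposite `I = {c}`. -/
lemma isBallPair_path [Fintype V] [DecidableEq V] {a b c : V} (hab : a ≠ b) (hbc : b ≠ c)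
    (hac : a ≠ c) :
    IsBallPair 1 (geom ({t | t ⊆ {a, b}} ∪ {t | t ⊆ {b, c}}))
      (geom ({t : Finset V | t ⊆ {a}} ∪ {t | t ⊆ {c}})) := by
  have h1 := isBallPair_simplex (n := 1) (s := ({a, b} : Finset V)) (Finset.card_pair hab)
  have eU : ({c} : Finset V) ∪ {b} = {b, c} := by ext; simp [or_comm]
  have key := IsBallPair.attach_simplex (n := 1) (𝒳 := {t | t ⊆ {a, b}}) (ℋ := {t | t ⊆ {a}})
    (I := {c}) (J := {b}) (by simp) (by simp) (by simpa using hbc.symm)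
    (fun s hs t ht _ => ht.trans hs)
    (by
      convert h1 using 1
      refine geom_congr fun t ht => ?_
      have e1 : ({a, b} : Finset V) ⊆ t ↔ a ∈ t ∧ b ∈ t := by
        rw [Finset.insert_subset_iff, Finset.singleton_subset_iff]
      have e2 : t ⊆ {a} ↔ ∀ x ∈ t, x = a := by simp [Finset.subset_iff]
      have e3 : t ⊆ {a, b} ↔ ∀ x ∈ t, x = a ∨ x = b := by simp [Finset.subset_iff]
      have e4 : t ⊆ {b, c} ↔ ∀ x ∈ t, x = b ∨ x = c := by simp [Finset.subset_iff]
      clear h1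
      simp only [eU, mem_union, mem_ofPred_eq, Finset.singleton_subset_iff, e1, e2, e3, e4]
      grind)
    (by
      intro t ht hne
      rw [eU] at ht
      simp only [mem_ofPred_eq, Finset.singleton_subset_iff]
      simp only [Finset.subset_iff, Finset.mem_insert, Finset.mem_singleton] at ht ⊢
      grind)
    (by
      intro t ht hne
      rw [eU] at ht
      simp only [mem_ofPred_eq, Finset.singleton_subset_iff]
      simp only [Finset.subset_iff, Finset.mem_insert, Finset.mem_singleton] at ht ⊢
      obtain ⟨x, hx⟩ := hne
      grind)
  rw [eU] at key
  convert key using 1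
  refine geom_congr fun t ht => ?_
  simp only [mem_union, mem_ofPred_eq, Finset.singleton_subset_iff]
  simp only [Finset.subset_iff, Finset.mem_insert, Finset.mem_singleton]
  grind

/-- The paths from `a` to `c` through `b` and through `d` are 1-balls that meet exactly in their
ends. -/
lemma isTriangulation_cycle [Fintype V] [DecidableEq V] {M : AbstractSimplicialComplex V}
    {a b c d : V} (hab : a ≠ b) (hac : a ≠ c) (had : a ≠ d) (hbc : b ≠ c) (hbd : b ≠ d)
    (hcd : c ≠ d) (hM : ∀ s : Finset V, s.Nonempty →
      (s ∈ M.faces ↔ s ⊆ {a, b} ∨ s ⊆ {b, c} ∨ s ⊆ {c, d} ∨ s ⊆ {d, a})) :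
    IsTriangulationOfSphere 1 M := by
  obtain ⟨f, hf⟩ := exists_homeo_sphere_of_isBallPair (isBallPair_path hab hbc hac)
    (isBallPair_path had hcd.symm hac) (by
      rw [geom_inter]
      refine geom_congr fun t ht => ?_
      simp only [mem_inter_iff, mem_union, mem_ofPred_eq]
      simp only [Finset.subset_iff, Finset.mem_insert, Finset.mem_singleton]
      grind)
  have e : geom ({t | t ⊆ {a, b}} ∪ {t | t ⊆ {b, c}}) ∪
      geom ({t | t ⊆ {a, d}} ∪ {t | t ⊆ {d, c}}) = realization M := by
    rw [realization_eq_geom, geom_union]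
    refine geom_congr fun t ht => ?_
    rw [hM t ht, Finset.pair_comm a d, Finset.pair_comm d c]
    simp only [mem_union, mem_ofPred_eq]
    tauto
  rw [e] at hf
  exact hf.nonempty_homeomorph

/-- By flagness, the full subcomplex on an induced 4-cycle consists of its vertices and four edges:
the missing diagonals exclude everything else. -/
lemma HasSquares.everyEdgeInSquare {K : AbstractSimplicialComplex V} (hK : IsFlag K)
    (h : HasSquares (skeleton K)) : EveryEdgeInSquare K := by
  classical
  intro x y hxy
  obtain ⟨z, t, hyz, hzt, htx, hxz, nxz, hyt, nyt⟩ := h x y hxy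
  let S : Finset V := {x, y, z, t}
  have hS : (S : Set V).Finite := S.finite_toSet
  have mem : ∀ v, v ∈ (S : Set V) ↔ v = x ∨ v = y ∨ v = z ∨ v = t := by simp [S]
  refine ⟨S, ⟨?_, ?_⟩, by simp [S], by simp [S]⟩
  · rw [Set.ncard_coe_finset]
    simp only [S]
    rw [Finset.card_insert_of_notMem, Finset.card_insert_of_notMem, Finset.card_pair hzt.ne]
    · simp [hyz.ne, hyt]
    · simp [hxy.ne, hxz, htx.ne']
  · let x' : (S : Set V) := ⟨x, by simp [S]⟩
    let y' : (S : Set V) := ⟨y, by simp [S]⟩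
    let z' : (S : Set V) := ⟨z, by simp [S]⟩
    let t' : (S : Set V) := ⟨t, by simp [S]⟩
    have ne : ∀ {p q : (S : Set V)}, (p : V) ≠ q → p ≠ q := fun h e => h (congrArg _ e)
    have cases4 : ∀ p : (S : Set V), p = x' ∨ p = y' ∨ p = z' ∨ p = t' := by
      rintro ⟨p, hp⟩
      simpa [x', y', z', t', Subtype.ext_iff] using (mem p).1 hp
    refine isTriangulation_cycle (a := x') (b := y') (c := z') (d := t') (ne hxy.ne) (ne hxz)
      (ne htx.ne') (ne hyz.ne) (ne hyt) (ne hzt.ne) fun s hs => ?_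
    have hf : s ∈ (fullSubcomplex K (S : Set V)).faces ↔
        ∀ p ∈ s, ∀ q ∈ s, p ≠ q → (skeleton K).Adj p q := by
      have : s ∈ (fullSubcomplex K (S : Set V)).faces ↔
        s.map (Function.Embedding.subtype _) ∈ K.faces := Iff.rfl
      rw [this, hK.mem_faces]
      constructor
      · intro h p hp q hq hpq
        exact h.2 p (Finset.mem_map_of_mem _ hp) q (Finset.mem_map_of_mem _ hq)
          fun e => hpq (Subtype.ext e)
      · intro h
        refine ⟨Finset.map_nonempty.2 hs, fun p hp q hq hpq => ?_⟩
        obtain ⟨p', hp', rfl⟩ := Finset.mem_map.1 hp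
        obtain ⟨q', hq', rfl⟩ := Finset.mem_map.1 hq
        exact h p' hp' q' hq' fun e => hpq (e ▸ rfl)
    rw [hf]
    constructor
    · intro hadj
      have h1 : ¬ (x' ∈ s ∧ z' ∈ s) := fun h => nxz (hadj _ h.1 _ h.2 (ne hxz))
      have h2 : ¬ (y' ∈ s ∧ t' ∈ s) := fun h => nyt (hadj _ h.1 _ h.2 (ne hyt))
      simp only [Finset.subset_iff, Finset.mem_insert, Finset.mem_singleton]
      by_cases hx : x' ∈ s <;> by_cases hy : y' ∈ s
      · left; intro p hp
        rcases cases4 p with rfl | rfl | rfl | rfl <;> tauto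
      · right; right; right; intro p hp
        rcases cases4 p with rfl | rfl | rfl | rfl <;> tauto
      · right; left; intro p hp
        rcases cases4 p with rfl | rfl | rfl | rfl <;> tauto
      · right; right; left; intro p hp
        rcases cases4 p with rfl | rfl | rfl | rfl <;> tauto
    · have pair : ∀ a b : (S : Set V), (skeleton K).Adj a b → s ⊆ {a, b} →
          ∀ p ∈ s, ∀ q ∈ s, p ≠ q → (skeleton K).Adj p q := by
        intro a b hab hsub p hp q hq hpq
        have h1 := hsub hp
        have h2 := hsub hq
        simp only [Finset.mem_insert, Finset.mem_singleton] at h1 h2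
        rcases h1 with rfl | rfl <;> rcases h2 with rfl | rfl
        · exact absurd rfl hpq
        · exact hab
        · exact hab.symm
        · exact absurd rfl hpq
      rintro (h | h | h | h)
      · exact pair _ _ hxy h
      · exact pair _ _ hyz h
      · exact pair _ _ hzt h
      · exact pair _ _ htx h

end Squares

end SphereComplex

namespace SphereComplex
open Set Metric Topology

set_option linter.unusedSectionVars false

/-! ### Invariance of the remaining properties under isomorphism -/

section Transport

variable {V W : Type}

lemma Isomorphic.refl (K : AbstractSimplicialComplex V) : Isomorphic K K :=
  ⟨Equiv.refl V, fun s => by simp⟩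

variable {K : AbstractSimplicialComplex V} {L : AbstractSimplicialComplex W}

lemma map_map_symm (e : V ≃ W) (s : Finset W) :
    (s.map e.symm.toEmbedding).map e.toEmbedding = s := by
  ext x; simp

lemma Isomorphic.gammaTwo_eq (h : Isomorphic K L) : gammaTwo K = gammaTwo L := by
  obtain ⟨e, he⟩ := h
  have key : ∀ i, faceCount K i = faceCount L i := by
    intro i
    have : (fun s : Finset V => s.map e.toEmbedding) '' {s ∈ K.faces | s.card = i + 1} =
        {s ∈ L.faces | s.card = i + 1} := by
      ext s
      constructor
      · rintro ⟨t, ⟨h1, h2⟩, rfl⟩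
        exact ⟨(he t).1 h1, by rw [Finset.card_map]; exact h2⟩
      · rintro ⟨h1, h2⟩
        refine ⟨s.map e.symm.toEmbedding, ⟨(he _).2 ?_, ?_⟩, map_map_symm e s⟩
        · rwa [map_map_symm]
        · rw [Finset.card_map]; exact h2
    rw [faceCount, faceCount, ← this, Set.ncard_image_of_injective _ (Finset.map_injective _)]
  simp only [gammaTwo, key]

lemma adj_iff_of_equiv {e : V ≃ W}
    (he : ∀ s : Finset V, s ∈ K.faces ↔ s.map e.toEmbedding ∈ L.faces) {x y : V} :
    (skeleton K).Adj x y ↔ (skeleton L).Adj (e x) (e y) := by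
  classical
  rw [skeleton_adj, skeleton_adj, he, e.injective.ne_iff]
  simp [Finset.map_insert]

lemma isFlag_of_equiv {e : V ≃ W}
    (he : ∀ s : Finset V, s ∈ K.faces ↔ s.map e.toEmbedding ∈ L.faces) (h : IsFlag L) :
    IsFlag K := by
  intro s hs hc
  rw [he]
  refine h _ (Finset.map_nonempty.2 hs) ?_
  intro x hx y hy hxy
  obtain ⟨x', hx', rfl⟩ := Finset.mem_map.1 (Finset.mem_coe.1 hx)
  obtain ⟨y', hy', rfl⟩ := Finset.mem_map.1 (Finset.mem_coe.1 hy)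
  exact (adj_iff_of_equiv he).1 (hc hx' hy' fun e => hxy (e ▸ rfl))

lemma hasSquares_of_equiv {e : V ≃ W}
    (he : ∀ s : Finset V, s ∈ K.faces ↔ s.map e.toEmbedding ∈ L.faces)
    (h : HasSquares (skeleton L)) : HasSquares (skeleton K) := by
  intro x y hxy
  obtain ⟨z, t, h⟩ := h _ _ ((adj_iff_of_equiv he).1 hxy)
  refine ⟨e.symm z, e.symm t, ?_⟩
  simp only [adj_iff_of_equiv he, e.apply_symm_apply, ne_eq, Equiv.eq_symm_apply]
  exact h

variable [Fintype V] [Fintype W] [DecidableEq V] [DecidableEq W]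

lemma isTriangulation_of_equiv {e : V ≃ W}
    (he : ∀ s : Finset V, s ∈ K.faces ↔ s.map e.toEmbedding ∈ L.faces) {n : ℕ}
    (h : IsTriangulationOfSphere n L) : IsTriangulationOfSphere n K := by
  obtain ⟨f⟩ := h
  have := isHomeoOn_comp_symm e he (isCompact_geom fun s hs t => face_subset hs)
  rw [← realization_eq_geom, ← realization_eq_geom] at this
  obtain ⟨g⟩ := this.nonempty_homeomorph
  exact ⟨g.trans f⟩

lemma hasReflections_of_equiv {e : V ≃ W}
    (he : ∀ s : Finset V, s ∈ K.faces ↔ s.map e.toEmbedding ∈ L.faces) (h : HasReflections L) :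
    HasReflections K := fun τ w hw hσ => hasReflectionAt_of_equiv he <|
  h _ _ (by simpa using hw) (by
    have := (he _).1 hσ
    rwa [Finset.map_insert] at this)

end Transport

end SphereComplex

namespace SphereComplex
open Set Metric Topology

/-! ### Doubling sequences -/

section Sequence

lemma faceCount_complexFin (i : ℕ) : faceCount complexFin i =
    ((Finset.univ.powersetCard (i + 1)).filter (fun s : Finset (Fin 12) =>
      ∀ x ∈ s, ∀ y ∈ s, x ≠ y → graphFin.Adj x y)).card := by
  rw [faceCount, ← Set.ncard_coe_finset]
  congr 2
  ext s
  simp only [mem_ofPred_eq, Finset.coe_filter, Finset.mem_powersetCard, Finset.subset_univ,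
    true_and]
  constructor
  · rintro ⟨⟨-, h⟩, hc⟩
    exact ⟨hc, fun x hx y hy => h hx hy⟩
  · rintro ⟨hc, h⟩
    exact ⟨⟨Finset.card_pos.1 (by omega), fun x hx y hy => h x hx y hy⟩, hc⟩

lemma gammaTwo_complexFin : gammaTwo complexFin = 1 := by
  have h0 : ((Finset.univ.powersetCard 1).filter (fun s : Finset (Fin 12) =>
      ∀ x ∈ s, ∀ y ∈ s, x ≠ y → graphFin.Adj x y)).card = 12 := by decide +kernel
  have h1 : ((Finset.univ.powersetCard 2).filter (fun s : Finset (Fin 12) =>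
      ∀ x ∈ s, ∀ y ∈ s, x ≠ y → graphFin.Adj x y)).card = 45 := by decide +kernel
  have h2 : ((Finset.univ.powersetCard 3).filter (fun s : Finset (Fin 12) =>
      ∀ x ∈ s, ∀ y ∈ s, x ≠ y → graphFin.Adj x y)).card = 66 := by decide +kernel
  have h3 : ((Finset.univ.powersetCard 4).filter (fun s : Finset (Fin 12) =>
      ∀ x ∈ s, ∀ y ∈ s, x ≠ y → graphFin.Adj x y)).card = 33 := by decide +kernel
  simp only [gammaTwo, faceCount_complexFin, h0, h1, h2, h3]
  norm_num

/-- A sphere of positive dimension has no triangulation with only one vertex. -/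
lemma IsTriangulationOfSphere.nontrivial {V : Type} {K : AbstractSimplicialComplex V} {n : ℕ}
    (h : IsTriangulationOfSphere n K) : Nontrivial V := by
  by_contra hV
  rw [not_nontrivial_iff_subsingleton] at hV
  obtain ⟨f⟩ := h
  have : Subsingleton (realization K) := by
    refine ⟨?_⟩
    rintro ⟨x, -, s, hs, -, hx⟩ ⟨y, -, t, ht, -, hy⟩
    refine Subtype.ext (funext fun v => ?_)
    have e : ∀ s ∈ K.faces, s = {v} := by
      intro s hs
      obtain ⟨w, hw⟩ := face_nonempty hs
      exact Finset.eq_singleton_iff_unique_mem.2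
        ⟨Subsingleton.elim w v ▸ hw, fun _ _ => Subsingleton.elim _ _⟩
    rw [e s hs, Finset.sum_singleton] at hx
    rw [e t ht, Finset.sum_singleton] at hy
    exact hx.trans hy.symm
  have hs := f.symm.injective.subsingleton
  let p : EuclideanSpace ℝ (Fin (n + 1)) := EuclideanSpace.single 0 1
  have hp : p ∈ sphere (0 : EuclideanSpace ℝ (Fin (n + 1))) 1 := by simp [p]
  have hn : -p ∈ sphere (0 : EuclideanSpace ℝ (Fin (n + 1))) 1 := by simp [p]
  have e : p = -p := congrArg Subtype.val (Subsingleton.elim (⟨p, hp⟩ : sphere _ _) ⟨-p, hn⟩)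
  have := congrArg (fun q : EuclideanSpace ℝ (Fin (n + 1)) => q 0) e
  norm_num [p] at this

/-- The properties of a complex that are preserved by doubling. -/
structure IsReflectiveSphere {V : Type} (K : AbstractSimplicialComplex V) : Prop where
  flag : IsFlag K
  card_le : ∀ s ∈ K.faces, s.card ≤ 4
  sphere : IsTriangulationOfSphere 3 K
  squares : HasSquares (skeleton K)
  reflections : ∀ [Fintype V] [DecidableEq V], HasReflections K

lemma IsReflectiveSphere.of_isomorphic_complexTwelve {V : Type} {K : AbstractSimplicialComplex V}
    [Finite V] (h : Isomorphic K complexTwelve) : IsReflectiveSphere K ∧ gammaTwo K = 1 := by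
  classical
  have := Fintype.ofFinite V
  have key : Isomorphic K complexFin := by
    obtain ⟨e, he⟩ := h
    refine ⟨e.trans vertexTwelve.symm, fun s => (he s).trans ?_⟩
    refine and_congr (by rw [Finset.map_nonempty, Finset.map_nonempty]) ?_
    simp only [SimpleGraph.IsClique, Finset.coe_map,
      (Equiv.toEmbedding _).injective.injOn.pairwise_image]
    simp [Set.Pairwise, Function.onFun, graphFin]
  have hγ := key.gammaTwo_eq
  obtain ⟨e, he⟩ := key
  refine ⟨⟨isFlag_of_equiv he (isFlag_cliqueComplex _), fun s hs => ?_,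
    isTriangulation_of_equiv he isTriangulation_complexFin, hasSquares_of_equiv he ?_,
    fun {_ _} => hasReflections_of_equiv he hasReflections_complexFin⟩,
    hγ.trans gammaTwo_complexFin⟩
  · rw [← Finset.card_map e.toEmbedding]
    exact card_le_of_mem_complexFin ((he s).1 hs)
  · rw [complexFin, skeleton_cliqueComplex]
    exact graphFin_square

lemma IsReflectiveSphere.of_isomorphic_double {V W : Type} {K : AbstractSimplicialComplex V}
    {L : AbstractSimplicialComplex W} [Finite V] [Finite W] (hK : IsReflectiveSphere K) {v : V}
    (h : Isomorphic L (double K v)) : IsReflectiveSphere L ∧ gammaTwo L = 2 * gammaTwo K := by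
  classical
  have := Fintype.ofFinite V
  have := Fintype.ofFinite W
  have := hK.sphere.nontrivial
  obtain ⟨i, π, hD⟩ := exists_isDouble h (exists_ne v)
  refine ⟨⟨hD.isFlag hK.flag, hD.card_le hK.card_le,
    hD.isTriangulation hK.flag hK.reflections hK.sphere, hD.hasSquares hK.squares, ?_⟩,
    hD.gammaTwo_eq hK.flag hK.card_le⟩
  intro _ _
  -- The double data are chosen again for the instances just introduced, since reflections are
  -- required for arbitrary ones.
  obtain ⟨i, π, hD⟩ := exists_isDouble h (exists_ne v)
  exact hD.hasReflections hK.flag hK.reflections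

lemma IsDoublingSequence.isReflectiveSphere {T : ℕ → FiniteComplex} (hT : IsDoublingSequence T)
    (n : ℕ) : IsReflectiveSphere (T n).complex ∧ gammaTwo (T n).complex = 2 ^ n := by
  have fin : ∀ n, Finite (T n).V := fun n => (T n).finite
  induction n with
  | zero => simpa using IsReflectiveSphere.of_isomorphic_complexTwelve hT.1
  | succ n ih =>
    obtain ⟨v, hv⟩ := hT.2 n
    obtain ⟨h1, h2⟩ := ih.1.of_isomorphic_double hv
    exact ⟨h1, by rw [h2, ih.2, pow_succ, mul_comm]⟩

/-- The double of a finite complex. -/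
def FiniteComplex.double (T : FiniteComplex) (v : T.V) : FiniteComplex where
  V := DoubleVertex T.complex v
  finite := have := T.finite; inferInstance
  complex := SphereComplex.double T.complex v

lemma exists_isDoublingSequence : ∃ T : ℕ → FiniteComplex, IsDoublingSequence T := by
  -- Carrying the sphere property along the recursion guarantees a vertex at which to double.
  let S : Type 1 := {T : FiniteComplex // IsReflectiveSphere T.complex}
  have ne : ∀ T : S, Nonempty T.1.V := fun T => T.2.sphere.nontrivial.to_nonempty
  have good : ∀ (T : S) v, IsReflectiveSphere (T.1.double v).complex := fun T v =>
    have := T.1.finite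
    have := (T.1.double v).finite
    (T.2.of_isomorphic_double (Isomorphic.refl _)).1
  let T₀ : S := ⟨⟨_, inferInstance, complexTwelve⟩,
    (IsReflectiveSphere.of_isomorphic_complexTwelve (Isomorphic.refl _)).1⟩
  let T : ℕ → S := Nat.rec T₀ fun _ T => ⟨_, good T (ne T).some⟩
  exact ⟨fun n => (T n).1, Isomorphic.refl _, fun n => ⟨(ne (T n)).some, Isomorphic.refl _⟩⟩

end Sequence

end SphereComplex

open SphereComplex in
theorem proposition5p6 :
    (∃ T : ℕ → FiniteComplex, IsDoublingSequence T) ∧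
    ∀ T : ℕ → FiniteComplex, IsDoublingSequence T →
      (∀ n, IsTriangulationOfSphere 3 (T n).complex ∧ IsFlag (T n).complex ∧
        0 < gammaTwo (T n).complex ∧ EveryEdgeInSquare (T n).complex) ∧
      (∀ n, gammaTwo (T (n + 1)).complex = 2 * gammaTwo (T n).complex) ∧
      (∀ m n, m ≠ n → ¬ Isomorphic (T m).complex (T n).complex) := by
  refine ⟨exists_isDoublingSequence, fun T hT => ⟨fun n => ?_, fun n => ?_, fun m n hmn h => ?_⟩⟩
  · obtain ⟨h, hγ⟩ := hT.isReflectiveSphere n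
    exact ⟨h.sphere, h.flag, by rw [hγ]; positivity, h.squares.everyEdgeInSquare h.flag⟩
  · rw [(hT.isReflectiveSphere n).2, (hT.isReflectiveSphere (n + 1)).2, pow_succ, mul_comm]
  · have := h.gammaTwo_eq
    rw [(hT.isReflectiveSphere m).2, (hT.isReflectiveSphere n).2] at this
    exact hmn (pow_right_injective₀ (by norm_num) (by norm_num) this)
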